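/- Fix an integer $n \ge 0$. There are a deterministic algorithm and constants $C, c$, depending only on $n$, with the following property. Let $p$ be a prime, $m \ge 1$, let $\mathbb{F}_q$ be a finite field of characteristic $p$, presented as $\mathbb{F}_p[t]/(\mu)$ with $\mu$ monic irreducible, and let $f \in \mathbb{F}_q[x_1,\dots,x_n]$ be a polynomial of total degree $d$ (with $d = 0$ if $f = 0$). Let $X$ be the hypersurface $f = 0$ in the torus $\mathbb{G}_m^n$ over $\mathbb{F}_q$, let $N_k(X) = \#\{x \in (\mathbb{F}_{q^k}^{*})^n : f(x) = 0\}$, and let $$Z(X,T) = \exp\Big(\sum_{k \ge 1} \frac{N_k(X)}{k} T^k\Big).$$ Then $Z(X,T)$ has integer coefficients, and from $p$, $m$, $\mu$ and a list of the terms of $f$ (with pairwise distinct exponents, each of degree at most $d$, in any order, zero coefficients being allowed) the algorithm computes polynomials $g, h \in (\mathbb{Z}/p^m\mathbb{Z})[T]$ with $h(0) = 1$ and $$Z(X,T) \equiv \frac{g(T)}{h(T)} \pmod{p^m}$$ as power series, in time at most $$C \left( p^m \binom{d+n}{n} \lfloor \log_2 q \rfloor \right)^{c}.$$ Time is measured on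 a random access machine with the logarithmic cost criterion (equivalently, up to a polynomial, on a Turing machine). In particular, for fixed $n$ and small $p^m$, the zeta function $Z(X,T)$ modulo $p^m$ is computed in time polynomial in the input size. -/

import Mathlib

open Polynomial

/-! ## The machine model: a random access machine with logarithmic cost

The memory is a sequence of registers indexed by `ℕ`, each holding a natural number of arbitrary
size; there is a read-only input tape and a write-only output tape of natural numbers.  Every
instruction is charged one plus the bit lengths of the numbers that it handles (operands,
contents, and addresses that are computed at run time).  This is the usual logarithmic cost
criterion, which is polynomially equivalent to time on a Turing machine.  Control flow is
structured (sequence, branch, loop). -/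

namespace RAM

/-- The arithmetic instructions: sum, truncated difference, product and integer quotient of
natural numbers (the quotient by zero is zero). -/
inductive Op
  | add
  | sub
  | mul
  | div

/-- The value of an arithmetic instruction. -/
def Op.eval : Op → ℕ → ℕ → ℕ
  | .add, x, y => x + y
  | .sub, x, y => x - y
  | .mul, x, y => x * y
  | .div, x, y => x / y

/-- Programs; `R r` denotes the content of register `r`. -/
inductive Prog
  /-- do nothing -/
  | skip
  /-- `R r := c` -/
  | const (r c : ℕ)
  /-- `R r := R s op R t` -/
  | arith (op : Op) (r s t : ℕ)
  /-- `R r := R (R s)` -/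
  | load (r s : ℕ)
  /-- `R (R r) := R s` -/
  | store (r s : ℕ)
  /-- move the next number of the input tape to `R r` (zero if there is none left) -/
  | read (r : ℕ)
  /-- append `R r` to the output tape -/
  | write (r : ℕ)
  /-- first `P`, then `Q` -/
  | seq (P Q : Prog)
  /-- if `R r ≠ 0` then `P` else `Q` -/
  | branch (r : ℕ) (P Q : Prog)
  /-- while `R r ≠ 0` do `P` -/
  | loop (r : ℕ) (P : Prog)

/-- Configurations of the machine: registers, unread input, output written so far. -/
structure Config where
  mem : ℕ → ℕ
  input : List ℕ
  output : List ℕ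

/-- `Config.set s r v` is `s` after the assignment `R r := v`. -/
def Config.set (s : Config) (r v : ℕ) : Config :=
  { s with mem := Function.update s.mem r v }

/-- `Run P s s' t`: started in configuration `s`, the program `P` halts in configuration `s'`,
at total cost `t`.  `Nat.size` is the number of binary digits. -/
inductive Run : Prog → Config → Config → ℕ → Prop
  | skip (s : Config) : Run .skip s s 1
  | const (s : Config) (r c : ℕ) : Run (.const r c) s (s.set r c) (1 + Nat.size c)
  | arith (s : Config) (op : Op) (r i j : ℕ) :
      Run (.arith op r i j) s (s.set r (op.eval (s.mem i) (s.mem j)))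
        (1 + Nat.size (s.mem i) + Nat.size (s.mem j))
  | load (s : Config) (r i : ℕ) :
      Run (.load r i) s (s.set r (s.mem (s.mem i)))
        (1 + Nat.size (s.mem i) + Nat.size (s.mem (s.mem i)))
  | store (s : Config) (r i : ℕ) :
      Run (.store r i) s (s.set (s.mem r) (s.mem i))
        (1 + Nat.size (s.mem r) + Nat.size (s.mem i))
  | read (s : Config) (r : ℕ) :
      Run (.read r) s { s.set r (s.input.headD 0) with input := s.input.tail }
        (1 + Nat.size (s.input.headD 0))
  | write (s : Config) (r : ℕ) :
      Run (.write r) s { s with output := s.output ++ [s.mem r] } (1 + Nat.size (s.mem r))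
  | seq {P Q : Prog} {s s' s'' : Config} {t t' : ℕ} (hP : Run P s s' t) (hQ : Run Q s' s'' t') :
      Run (.seq P Q) s s'' (t + t')
  | branch_true {P Q : Prog} {r : ℕ} {s s' : Config} {t : ℕ} (hr : s.mem r ≠ 0)
      (hP : Run P s s' t) : Run (.branch r P Q) s s' (1 + Nat.size (s.mem r) + t)
  | branch_false {P Q : Prog} {r : ℕ} {s s' : Config} {t : ℕ} (hr : s.mem r = 0)
      (hQ : Run Q s s' t) : Run (.branch r P Q) s s' (1 + t)
  | loop_done {P : Prog} {r : ℕ} {s : Config} (hr : s.mem r = 0) : Run (.loop r P) s s 1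
  | loop_step {P : Prog} {r : ℕ} {s s' s'' : Config} {t t' : ℕ} (hr : s.mem r ≠ 0)
      (hP : Run P s s' t) (hL : Run (.loop r P) s' s'' t') :
      Run (.loop r P) s s'' (1 + Nat.size (s.mem r) + t + t')

/-- Started with all registers zero, input tape `inp` and empty output tape, the program `P`
halts at total cost `t` with output tape `out`. -/
def Computes (P : Prog) (inp out : List ℕ) (t : ℕ) : Prop :=
  ∃ s : Config, Run P ⟨fun _ => 0, inp, []⟩ s t ∧ s.output = out

end RAM

/-! ## Zeta functions of hypersurfaces in the torus -/

noncomputable section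

/-- The number `N_k(X)` of points, with coordinates in the extension of degree `k` of the finite
field `K`, of the hypersurface `f = 0` in the torus `𝔾_m ^ n`. -/
def torusPointCount (p : ℕ) [Fact p.Prime] {K : Type*} [Field K] [Finite K] [CharP K p] {n : ℕ}
    (f : MvPolynomial (Fin n) K) (k : ℕ) [NeZero k] : ℕ :=
  Nat.card {x : Fin n → (FiniteField.Extension K p k)ˣ //
    MvPolynomial.aeval (fun i => (x i : FiniteField.Extension K p k)) f = 0}

/-- The series `∑_{k ≥ 1} N_k(X) T ^ k / k`, written as `T * ∑_{j ≥ 0} N_{j+1}(X) T ^ j / (j+1)`. -/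
def torusLogZeta (p : ℕ) [Fact p.Prime] {K : Type*} [Field K] [Finite K] [CharP K p] {n : ℕ}
    (f : MvPolynomial (Fin n) K) : PowerSeries ℚ :=
  PowerSeries.X * PowerSeries.mk fun j => (torusPointCount p f (j + 1) : ℚ) / ((j + 1 : ℕ) : ℚ)

/-- The zeta function `Z(X, T) = exp (∑_{k ≥ 1} N_k(X) T ^ k / k)`. -/
def torusZeta (p : ℕ) [Fact p.Prime] {K : Type*} [Field K] [Finite K] [CharP K p] {n : ℕ}
    (f : MvPolynomial (Fin n) K) : PowerSeries ℚ :=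
  (PowerSeries.exp ℚ).subst (torusLogZeta p f)

/-- The power series `Z` has integer coefficients, and its reduction modulo `N` is the rational
function `g / h`, where `h` has constant term `1`. -/
def IsReductionMod (N : ℕ) (Z : PowerSeries ℚ) (g h : (ZMod N)[X]) : Prop :=
  h.coeff 0 = 1 ∧ ∃ Z' : PowerSeries ℤ, PowerSeries.map (Int.castRingHom ℚ) Z' = Z ∧
    (h : PowerSeries (ZMod N)) * PowerSeries.map (Int.castRingHom (ZMod N)) Z' = g

/-! ## Encoding of the data -/

/-- The polynomial with the given list of coefficients, constant term first. -/
def polyOfList {R : Type*} [Semiring R] (l : List R) : R[X] :=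
  ∑ i : Fin l.length, monomial (i : ℕ) (l.get i)

/-- A list of elements of `ℤ / N`: its length, followed by the least nonnegative residues. -/
def encodeResidues {N : ℕ} (l : List (ZMod N)) : List ℕ :=
  l.length :: l.map ZMod.val

/-- The input for the hypersurface `f = 0` and the modulus `p ^ m`.  The finite field `K` is
presented as `𝔽_p[t] / (μ)`, `μ` being the minimal polynomial of the generator of the power
basis `b`, and elements of `K` are given by their coordinates in `b`.  The polynomial `f` is given
by the list of its terms with exponents in the list `E`.  In order: `p`, `m`, the degree of `K`
over `𝔽_p`, the coefficients of `μ` except the leading coefficient `1`, the number of terms, and,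
for each term, the `n` exponents and the coordinates of the coefficient. -/
def encodeInput {p : ℕ} [Fact p.Prime] {K : Type*} [Field K] [Algebra (ZMod p) K] (m : ℕ)
    (b : PowerBasis (ZMod p) K) {n : ℕ} (f : MvPolynomial (Fin n) K) (E : List (Fin n →₀ ℕ)) :
    List ℕ :=
  [p, m, b.dim] ++ List.ofFn (fun i : Fin b.dim => ((minpoly (ZMod p) b.gen).coeff i).val) ++
    [E.length] ++ E.flatMap fun e =>
      List.ofFn (fun i : Fin n => e i) ++
        List.ofFn (fun i : Fin b.dim => (b.basis.repr (f.coeff e) i).val)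

end

/-! Let `q = p ^ a`. Lift the presentation `μ` of the field and the polynomial `f` to integral
polynomials `G` and `H` in `r = n + 1` variables, the first of which stands for the generator of
`K`. The common zeros of `G` and `H` in the torus of dimension `r` over `𝔽_p` are the hypersurface
seen over the prime field: the number of those fixed by the `k`-th power of Frobenius is `a
N_{k/a}(X)` if `a ∣ k`, and zero otherwise (`card_commonZeros`). Their zeta function is therefore
`Z(X, T ^ a)`.

By inclusion and exclusion it suffices to treat the loci `Q ≠ 0` for `Q = 1, G, H, G H`. Give a
point `x` the weight `φ(x̂)`, where `φ = Q ^ ((p - 1) p ^ m)` and `x̂` is the Teichmüller lift of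
`x` in the Witt vectors. Modulo `p ^ m` this weight is zero where `Q` vanishes and a Frobenius
coboundary elsewhere. So modulo `p ^ m` the weighted Frobenius matrix `M` has the same `det (1 - T
M)` as the permutation matrix of Frobenius on `Q ≠ 0` (`charpolyRev_torusWeight`).

Dwork's trace formula (`trace_torusWeight`) says `tr (M ^ k) = (p ^ k - 1) ^ r tr (A ^ k)`, where
the integral matrix `A` is multiplication by `φ` followed by `x ^ (p u) ↦ x ^ u`, on a finite box of
monomials. Expanding `(p ^ k - 1) ^ r` makes the right side an alternating sum of traces of powers
of the matrices `p ^ i A`. These are collected by sign in two block diagonal matrices `B 0` and `B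
1` (`zetaMatrix`). Traces cannot be compared modulo `p ^ m`, since passing to the zeta function
divides by `k`. They are compared exactly, in characteristic zero; Newton's identities turn this
into an identity of determinants, and only that is reduced. The result is `Z(X, T ^ a) ≡ det (1 - T
B 1) / det (1 - T B 0)` (`charpolyRev_zetaMatrix`), from which `isReductionMod_torusZeta` takes
every `a`-th coefficient.

For fixed `n` the size of these matrices is polynomial in `p ^ m`, the number of monomials and `log
q`. Their entries are coefficients of powers, computed modulo `p ^ m` after Kronecker substitution,
and the determinants come from a recursion without divisions (`coeff_charpolyRev_leading`).
Everything is a nesting of finite sums and table recursions. These are written as terms of a small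
language whose compiler to the machine is proved correct (`Tm.correct`), with cost polynomial in a
bound for the numbers of the input (`Tm.polyBounded_cost`). -/

/-! ## Runs with an upper bound for the cost -/

namespace RAM

/-- `P` takes `s` to `s'` at cost at most `T`. -/
def RunLE (P : Prog) (s s' : Config) (T : ℕ) : Prop := ∃ t ≤ T, Run P s s' t

/-- Costs are estimated by the numbers themselves instead of their bit lengths. The time bound aimed
at is polynomial in `p ^ m`, so the loss is harmless. -/
theorem size_le_self (n : ℕ) : Nat.size n ≤ n := Nat.size_le.2 Nat.lt_two_pow_self

theorem RunLE.mono {P : Prog} {s s' : Config} {T T' : ℕ} (h : RunLE P s s' T) (hT : T ≤ T') :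
    RunLE P s s' T' := by
  obtain ⟨t, ht, hr⟩ := h
  exact ⟨t, ht.trans hT, hr⟩

theorem RunLE.seq {P Q : Prog} {s s' s'' : Config} {T T' : ℕ} (h : RunLE P s s' T)
    (h' : RunLE Q s' s'' T') : RunLE (.seq P Q) s s'' (T + T') := by
  obtain ⟨t, ht, hr⟩ := h
  obtain ⟨t', ht', hr'⟩ := h'
  exact ⟨t + t', by omega, .seq hr hr'⟩

theorem RunLE.const (s : Config) (r c : ℕ) : RunLE (.const r c) s (s.set r c) (1 + c) :=
  ⟨_, by have := size_le_self c; omega, .const s r c⟩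

theorem RunLE.arith (s : Config) (o : Op) (r i j : ℕ) :
    RunLE (.arith o r i j) s (s.set r (o.eval (s.mem i) (s.mem j))) (1 + s.mem i + s.mem j) :=
  ⟨_, by have := size_le_self (s.mem i); have := size_le_self (s.mem j); omega,
    .arith s o r i j⟩

theorem RunLE.load (s : Config) (r i : ℕ) :
    RunLE (.load r i) s (s.set r (s.mem (s.mem i))) (1 + s.mem i + s.mem (s.mem i)) :=
  ⟨_, by have := size_le_self (s.mem i); have := size_le_self (s.mem (s.mem i)); omega,
    .load s r i⟩

theorem RunLE.store (s : Config) (r i : ℕ) :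
    RunLE (.store r i) s (s.set (s.mem r) (s.mem i)) (1 + s.mem r + s.mem i) :=
  ⟨_, by have := size_le_self (s.mem i); have := size_le_self (s.mem r); omega,
    .store s r i⟩

theorem RunLE.read (s : Config) (r : ℕ) :
    RunLE (.read r) s { s.set r (s.input.headD 0) with input := s.input.tail }
      (1 + s.input.headD 0) :=
  ⟨_, by have := size_le_self (s.input.headD 0); omega, .read s r⟩

theorem RunLE.write (s : Config) (r : ℕ) :
    RunLE (.write r) s { s with output := s.output ++ [s.mem r] } (1 + s.mem r) :=
  ⟨_, by have := size_le_self (s.mem r); omega, .write s r⟩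

/-- The programs of a list, one after the other. -/
def seqs : List Prog → Prog
  | [] => .skip
  | P :: l => .seq P (seqs l)

theorem RunLE.nil (s : Config) : RunLE (seqs []) s s 1 := ⟨1, le_rfl, .skip s⟩

theorem RunLE.cons {P : Prog} {l : List Prog} {s s' s'' : Config} {T T' : ℕ}
    (h : RunLE P s s' T) (h' : RunLE (seqs l) s' s'' T') :
    RunLE (seqs (P :: l)) s s'' (T + T') := h.seq h'

theorem set_mem (s : Config) (r v x : ℕ) :
    (s.set r v).mem x = if x = r then v else s.mem x := by
  simp [Config.set, Function.update_apply]

@[simp] theorem set_input (s : Config) (r v : ℕ) : (s.set r v).input = s.input := rfl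

@[simp] theorem set_output (s : Config) (r v : ℕ) : (s.set r v).output = s.output := rfl

/-- A loop that counts register `r` down from `n`, with an invariant `I`. -/
theorem loop_run {P : Prog} {r n T : ℕ} {I : ℕ → Config → Prop} {s : Config} (h0 : I 0 s)
    (hr : s.mem r = n)
    (step : ∀ i s, i < n → I i s → s.mem r = n - i →
      ∃ s', RunLE P s s' T ∧ I (i + 1) s' ∧ s'.mem r = n - (i + 1)) :
    ∃ s', RunLE (.loop r P) s s' (1 + n * (1 + n + T)) ∧ I n s' ∧ s'.mem r = 0 := by
  -- Induction on the number `j` of rounds that remain.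
  have key : ∀ j i s, i + j = n → I i s → s.mem r = j →
      ∃ s', RunLE (.loop r P) s s' (1 + j * (1 + n + T)) ∧ I n s' ∧ s'.mem r = 0 := by
    intro j
    induction j with
    | zero =>
      intro i s hi hI hs
      obtain rfl : i = n := by omega
      exact ⟨s, ⟨1, by omega, .loop_done hs⟩, hI, hs⟩
    | succ j ih =>
      intro i s hi hI hs
      obtain ⟨s1, ⟨t1, ht1, hr1⟩, hI1, hs1⟩ := step i s (by omega) hI (by omega)
      obtain ⟨s2, ⟨t2, ht2, hr2⟩, hI2, hs2⟩ := ih (i + 1) s1 (by omega) hI1 (by omega)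
      refine ⟨s2, ⟨_, ?_, .loop_step (by omega) hr1 hr2⟩, hI2, hs2⟩
      have := size_le_self (s.mem r)
      have e : (j + 1) * (1 + n + T) = j * (1 + n + T) + (1 + n + T) := by ring
      omega
  exact key n 0 s (by omega) h0 hr

/-! ## A language of terms

Register `16 * k` is the scalar number `k`, and register `16 * i + a + 1` is the entry number `i`
of the array number `a`, for `a < 15`. -/

/-- The environment `ρ`, preceded by `x`. -/
def push (x : ℕ) (ρ : ℕ → ℕ) : ℕ → ℕ
  | 0 => x
  | i + 1 => ρ i

@[simp] theorem push_zero (x : ℕ) (ρ : ℕ → ℕ) : push x ρ 0 = x := rfl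

@[simp] theorem push_succ (x : ℕ) (ρ : ℕ → ℕ) (i : ℕ) : push x ρ (i + 1) = ρ i := rfl

/-- The array whose entries `0, …, n - 1` are filled in this order, entry `t` being `f t S`, where
`S` is the array as filled so far; the other entries are zero. -/
def table (f : ℕ → (ℕ → ℕ) → ℕ) : ℕ → ℕ → ℕ
  | 0 => fun _ => 0
  | n + 1 => Function.update (table f n) n (f n (table f n))

/-- Terms, in an environment of numbers (with de Bruijn indices) and of named arrays. -/
inductive Tm
  /-- a constant -/
  | const (c : ℕ)
  /-- a variable -/
  | var (i : ℕ)
  /-- an arithmetic operation -/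
  | op (o : Op) (e₁ e₂ : Tm)
  /-- an entry of an array -/
  | look (a : ℕ) (e : Tm)
  /-- renaming of the variables -/
  | ren (σ : ℕ → ℕ) (e : Tm)
  /-- binding of a variable -/
  | letin (e body : Tm)
  /-- the sum of `body` over the numbers less than `n` -/
  | sum (n body : Tm)
  /-- the entry `q` of the table `a` of length `n` filled with `body`, reduced modulo `M + 1` -/
  | tab (a : ℕ) (n M body q : Tm)

/-- The value of a term. -/
def Tm.eval : Tm → (ℕ → ℕ → ℕ) → (ℕ → ℕ) → ℕ
  | .const c, _, _ => c
  | .var i, _, ρ => ρ i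
  | .op o e₁ e₂, α, ρ => o.eval (e₁.eval α ρ) (e₂.eval α ρ)
  | .look a e, α, ρ => α a (e.eval α ρ)
  | .ren σ e, α, ρ => e.eval α (fun i => ρ (σ i))
  | .letin e b, α, ρ => b.eval α (push (e.eval α ρ) ρ)
  | .sum n b, α, ρ => ∑ t ∈ Finset.range (n.eval α ρ), b.eval α (push t ρ)
  | .tab a n M b q, α, ρ =>
      table (fun t S => b.eval (Function.update α a S) (push t ρ) % (M.eval α ρ + 1))
        (n.eval α ρ) (q.eval α ρ)

/-- The term uses only legal array names, and those bound in it are increasing and at least `l`. -/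
def Tm.OK : ℕ → Tm → Prop
  | _, .const _ => True
  | _, .var _ => True
  | l, .op _ e₁ e₂ => e₁.OK l ∧ e₂.OK l
  | l, .look a e => a < 15 ∧ e.OK l
  | l, .ren _ e => e.OK l
  | l, .letin e b => e.OK l ∧ b.OK l
  | l, .sum n b => n.OK l ∧ b.OK l
  | l, .tab a n M b q => l ≤ a ∧ a < 15 ∧ n.OK l ∧ M.OK l ∧ b.OK (a + 1) ∧ q.OK l

/-- A bound for the value of a term, if the environment is bounded by `B`. -/
def Tm.bnd : Tm → ℕ → ℕ
  | .const c, _ => c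
  | .var _, B => B
  | .op _ e₁ e₂, B => e₁.bnd B + e₂.bnd B + e₁.bnd B * e₂.bnd B
  | .look _ _, B => B
  | .ren _ e, B => e.bnd B
  | .letin e b, B => b.bnd (B + e.bnd B)
  | .sum n b, B => n.bnd B * b.bnd (B + n.bnd B)
  | .tab _ _ M _ _, B => M.bnd B

/-- The program `R x := R t * 16 + a + 1` on scalars: the address of an entry of the array `a`; the
scalar `y` is used as well. -/
def addr (a x t y : ℕ) : Prog :=
  seqs [.const (16 * x) 16, .arith .mul (16 * x) (16 * t) (16 * x), .const (16 * y) (a + 1),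
    .arith .add (16 * x) (16 * x) (16 * y)]

/-- The program `R x := R x % R m` on scalars; the scalar `y` is used as well. -/
def modulo (x m y : ℕ) : Prog :=
  seqs [.arith .div (16 * y) (16 * x) (16 * m), .arith .mul (16 * y) (16 * y) (16 * m),
    .arith .sub (16 * x) (16 * x) (16 * y)]

/-- The program that increases the scalar `t` and decreases the scalar `c` by one; the scalar `y`
is used as well. -/
def tick (t c y : ℕ) : Prog :=
  seqs [.const (16 * y) 1, .arith .add (16 * t) (16 * t) (16 * y),
    .arith .sub (16 * c) (16 * c) (16 * y)]

/-- The program that computes the term, with the variable `i` in the scalar `v i`, and with the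
scalars from `k` on free; the result is put into the scalar `k`. -/
def Tm.compile : Tm → (ℕ → ℕ) → ℕ → Prog
  | .const c, _, k => .const (16 * k) c
  -- The machine has no copy instruction; a move is the addition of zero.
  | .var i, v, k => seqs [.const (16 * (k + 1)) 0,
      .arith .add (16 * k) (16 * v i) (16 * (k + 1))]
  | .op o e₁ e₂, v, k => seqs [e₁.compile v k, e₂.compile v (k + 1),
      .arith o (16 * k) (16 * k) (16 * (k + 1))]
  | .look a e, v, k => seqs [e.compile v k, addr a (k + 1) k (k + 2),
      .load (16 * k) (16 * (k + 1))]
  | .ren σ e, v, k => e.compile (fun i => v (σ i)) k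
  | .letin e b, v, k => seqs [e.compile v k, b.compile (push k v) (k + 1), .const (16 * k) 0,
      .arith .add (16 * k) (16 * k) (16 * (k + 1))]
  | .sum n b, v, k => seqs [n.compile v k, .const (16 * (k + 1)) 0, .const (16 * (k + 2)) 0,
      .loop (16 * k) (seqs [b.compile (push (k + 2) v) (k + 3),
        .arith .add (16 * (k + 1)) (16 * (k + 1)) (16 * (k + 3)), tick (k + 2) k (k + 3)]),
      .arith .add (16 * k) (16 * k) (16 * (k + 1))]
  | .tab a n M b q, v, k => seqs [q.compile v k, n.compile v (k + 1), M.compile v (k + 2),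
      .const (16 * (k + 3)) 1,
      .arith .add (16 * (k + 2)) (16 * (k + 2)) (16 * (k + 3)),
      .const (16 * (k + 3)) 0,
      .arith .add (16 * (k + 4)) (16 * (k + 1)) (16 * (k + 3)),
      .loop (16 * (k + 4)) (seqs [b.compile (push (k + 3) v) (k + 5), modulo (k + 5) (k + 2) (k + 6),
        addr a (k + 6) (k + 3) (k + 7), .store (16 * (k + 6)) (16 * (k + 5)),
        tick (k + 3) (k + 4) (k + 6)]),
      addr a (k + 5) k (k + 6),
      .load (16 * k) (16 * (k + 5)),
      -- The last loop clears the array, so that its name can be bound again by a later table.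
      .const (16 * (k + 3)) 0,
      .arith .add (16 * (k + 4)) (16 * (k + 1)) (16 * (k + 3)),
      .loop (16 * (k + 4)) (seqs [addr a (k + 6) (k + 3) (k + 7), .const (16 * (k + 5)) 0,
        .store (16 * (k + 6)) (16 * (k + 5)), tick (k + 3) (k + 4) (k + 6)])]

/-- A bound for the cost of the program of a term, if the environment is bounded by `B`. -/
def Tm.cost : Tm → ℕ → ℕ
  | .const c, _ => 1 + c
  | .var _, B => 10 + B
  | .op _ e₁ e₂, B => e₁.cost B + e₂.cost B + 10 + e₁.bnd B + e₂.bnd B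
  | .look _ e, B => e.cost B + 200 + 100 * e.bnd B + 2 * B
  | .ren _ e, B => e.cost B
  | .letin e b, B => e.cost B + b.cost (B + e.bnd B) + 10 + b.bnd (B + e.bnd B)
  | .sum n b, B => n.cost B + 20 + n.bnd B * (1 + n.bnd B +
      (b.cost (B + n.bnd B) + 20 + 4 * n.bnd B + 4 * b.bnd (B + n.bnd B)
        + n.bnd B * b.bnd (B + n.bnd B))) + n.bnd B * b.bnd (B + n.bnd B)
  | .tab _ n M b q, B => q.cost B + n.cost B + M.cost B +
      n.bnd B * (1 + n.bnd B + (b.cost (B + n.bnd B + M.bnd B) + 200 + 100 * n.bnd B +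
        10 * M.bnd B + 10 * b.bnd (B + n.bnd B + M.bnd B))) +
      n.bnd B * (1 + n.bnd B + (200 + 100 * n.bnd B)) + 300 + 100 * q.bnd B +
        100 * n.bnd B + 100 * M.bnd B

/-! ## Correctness of the compiler -/

/-- `s'` differs from `s` at most in the scalars from `k` on. -/
structure Frame (k : ℕ) (s s' : Config) : Prop where
  input : s'.input = s.input
  output : s'.output = s.output
  mem : ∀ x, (∀ j, k ≤ j → x ≠ 16 * j) → s'.mem x = s.mem x

theorem Frame.refl (k : ℕ) (s : Config) : Frame k s s := ⟨rfl, rfl, fun _ _ => rfl⟩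

theorem Frame.trans {k : ℕ} {s s' s'' : Config} (h : Frame k s s') (h' : Frame k s' s'') :
    Frame k s s'' :=
  ⟨h'.input.trans h.input, h'.output.trans h.output,
    fun x hx => (h'.mem x hx).trans (h.mem x hx)⟩

theorem Frame.mono {k k' : ℕ} {s s' : Config} (h : Frame k' s s') (hk : k ≤ k') :
    Frame k s s' :=
  ⟨h.input, h.output, fun x hx => h.mem x fun j hj => hx j (hk.trans hj)⟩

theorem Frame.set {k : ℕ} {s s' : Config} (h : Frame k s s') {j : ℕ} (hj : k ≤ j) (x : ℕ) :
    Frame k s (s'.set (16 * j) x) :=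
  ⟨h.input, h.output, fun y hy => by rw [set_mem, if_neg (hy j hj), h.mem y hy]⟩

theorem Frame.scalar {k : ℕ} {s s' : Config} (h : Frame k s s') {j : ℕ} (hj : j < k) :
    s'.mem (16 * j) = s.mem (16 * j) := h.mem _ fun i hi => by omega

theorem Frame.array {k : ℕ} {s s' : Config} (h : Frame k s s') {a : ℕ} (ha : a < 15) (i : ℕ) :
    s'.mem (16 * i + a + 1) = s.mem (16 * i + a + 1) := h.mem _ fun i hi => by omega

/-- The memory represents the environment. -/
structure Rep (s : Config) (v : ℕ → ℕ) (k : ℕ) (α : ℕ → ℕ → ℕ) (ρ : ℕ → ℕ) : Prop where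
  lt : ∀ i, v i < k
  scalar : ∀ i, s.mem (16 * v i) = ρ i
  array : ∀ a < 15, ∀ i, s.mem (16 * i + a + 1) = α a i

theorem Rep.frame {s s' : Config} {v : ℕ → ℕ} {k k' : ℕ} {α : ℕ → ℕ → ℕ} {ρ : ℕ → ℕ}
    (h : Rep s v k α ρ) (hf : Frame k s s') (hk : k ≤ k') : Rep s' v k' α ρ :=
  ⟨fun i => (h.lt i).trans_le hk, fun i => by rw [hf.scalar (h.lt i), h.scalar],
    fun a ha i => by rw [hf.array ha, h.array a ha]⟩

theorem Rep.push {s : Config} {v : ℕ → ℕ} {k k' j x : ℕ} {α : ℕ → ℕ → ℕ} {ρ : ℕ → ℕ}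
    (h : Rep s v k α ρ) (hk : k ≤ k') (hj : j < k') (hx : s.mem (16 * j) = x) :
    Rep s (RAM.push j v) k' α (RAM.push x ρ) :=
  ⟨fun i => by cases i with
    | zero => exact hj
    | succ i => exact (h.lt i).trans_le hk,
   fun i => by cases i with
    | zero => exact hx
    | succ i => exact h.scalar i,
   h.array⟩

theorem set_set (s : Config) (r v w : ℕ) : (s.set r v).set r w = s.set r w := by
  simp [Config.set]

theorem set_comm (s : Config) {r r' : ℕ} (h : r ≠ r') (v w : ℕ) :
    (s.set r v).set r' w = (s.set r' w).set r v := by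
  simp [Config.set, Function.update_comm h]

theorem RunLE.arith_of_eq {s : Config} {o : Op} (r : ℕ) {i j x y z : ℕ} (hx : s.mem i = x)
    (hy : s.mem j = y) (hz : o.eval x y = z) :
    RunLE (.arith o r i j) s (s.set r z) (1 + x + y) := by
  subst hx hy hz
  exact RunLE.arith s o r i j

theorem addr_run {s : Config} {a x t y v : ℕ} (ht : s.mem (16 * t) = v) (ha : a < 15)
    (hxt : x ≠ t) (hxy : x ≠ y) :
    RunLE (addr a x t y) s ((s.set (16 * y) (a + 1)).set (16 * x) (16 * v + a + 1))
      (90 + 20 * v) := by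
  have hxt' := hxt.symm
  have e : ((((s.set (16 * x) 16).set (16 * x) (v * 16)).set (16 * y) (a + 1)).set (16 * x)
      (16 * v + a + 1)) = ((s.set (16 * y) (a + 1)).set (16 * x) (16 * v + a + 1)) := by
    rw [set_set, set_comm s (r := 16 * x) (r' := 16 * y) (by omega), set_set]
  rw [← e]
  refine ((RunLE.const _ _ _).cons ((RunLE.arith_of_eq (x := v) (y := 16) _ ?_ ?_ ?_).cons
    ((RunLE.const _ _ _).cons ((RunLE.arith_of_eq (x := v * 16) (y := a + 1) _ ?_ ?_ ?_).cons
      (RunLE.nil _))))).mono (by omega)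
  · simp [set_mem, hxt', ht]
  · simp [set_mem]
  · rfl
  · simp [set_mem, hxy]
  · simp [set_mem]
  · simp [Op.eval]
    ring

theorem modulo_run {s : Config} {x m y v w : ℕ} (hv : s.mem (16 * x) = v)
    (hw : s.mem (16 * m) = w) (hxy : x ≠ y) (hmy : m ≠ y) :
    RunLE (modulo x m y) s ((s.set (16 * y) (v / w * w)).set (16 * x) (v % w))
      (4 + 4 * v + 2 * w) := by
  have h1 : v / w ≤ v := Nat.div_le_self _ _
  have h2 : v / w * w ≤ v := Nat.div_mul_le_self _ _
  rw [← set_set s (16 * y) (v / w)]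
  refine ((RunLE.arith_of_eq (x := v) (y := w) _ hv hw rfl).cons
    ((RunLE.arith_of_eq (x := v / w) (y := w) _ ?_ ?_ ?_).cons
    ((RunLE.arith_of_eq (x := v) (y := v / w * w) _ ?_ ?_ ?_).cons
      (RunLE.nil _)))).mono (by omega)
  · simp [set_mem, Op.eval]
  · simp [set_mem, hmy, hw]
  · rfl
  · simp [set_mem, hxy, hv]
  · simp [set_mem]
  · rw [Nat.mod_eq_sub_mul_div, mul_comm]
    rfl

theorem tick_run {s : Config} {t c y v w : ℕ} (hv : s.mem (16 * t) = v)
    (hw : s.mem (16 * c) = w) (hty : t ≠ y) (hcy : c ≠ y) (hct : c ≠ t) :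
    RunLE (tick t c y) s (((s.set (16 * y) 1).set (16 * t) (v + 1)).set (16 * c) (w - 1))
      (7 + v + w) := by
  refine ((RunLE.const _ _ _).cons
    ((RunLE.arith_of_eq (x := v) (y := 1) _ ?_ ?_ rfl).cons
    ((RunLE.arith_of_eq (x := w) (y := 1) _ ?_ ?_ rfl).cons
      (RunLE.nil _)))).mono (by omega)
  · simp [set_mem, hty, hv]
  · simp [set_mem]
  · simp [set_mem, hcy, hct, hw]
  · simp [set_mem, hty.symm]

/-- The environment is bounded by `B`. -/
structure Bounded (α : ℕ → ℕ → ℕ) (ρ : ℕ → ℕ) (B : ℕ) : Prop where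
  scalar : ∀ i, ρ i ≤ B
  array : ∀ a i, α a i ≤ B

theorem Bounded.push {α : ℕ → ℕ → ℕ} {ρ : ℕ → ℕ} {B B' x : ℕ} (h : Bounded α ρ B) (hB : B ≤ B')
    (hx : x ≤ B') : Bounded α (push x ρ) B' :=
  ⟨fun i => by cases i with
    | zero => exact hx
    | succ i => exact (h.scalar i).trans hB,
   fun a i => (h.array a i).trans hB⟩

theorem Bounded.update {α : ℕ → ℕ → ℕ} {ρ : ℕ → ℕ} {B B' : ℕ} (h : Bounded α ρ B) (hB : B ≤ B')
    (a : ℕ) {S : ℕ → ℕ} (hS : ∀ i, S i ≤ B') : Bounded (Function.update α a S) ρ B' :=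
  ⟨fun i => (h.scalar i).trans hB, fun b i => by
    by_cases hb : b = a
    · subst hb; simpa using hS i
    · simpa [hb] using (h.array b i).trans hB⟩

theorem Op.eval_le (o : Op) {x y X Y : ℕ} (hx : x ≤ X) (hy : y ≤ Y) :
    o.eval x y ≤ X + Y + X * Y := by
  have h : x * y ≤ X * Y := Nat.mul_le_mul hx hy
  cases o <;> simp only [Op.eval]
  · omega
  · omega
  · omega
  · have := Nat.div_le_self x y
    omega

theorem table_le {f : ℕ → (ℕ → ℕ) → ℕ} {M : ℕ} (h : ∀ t S, f t S ≤ M) (n i : ℕ) :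
    table f n i ≤ M := by
  induction n with
  | zero => exact Nat.zero_le _
  | succ n ih =>
    rw [table, Function.update_apply]
    split_ifs
    · exact h _ _
    · exact ih

theorem table_of_le {f : ℕ → (ℕ → ℕ) → ℕ} {n i : ℕ} (h : n ≤ i) : table f n i = 0 := by
  induction n with
  | zero => rfl
  | succ n ih => rw [table, Function.update_of_ne (by omega), ih (by omega)]

theorem table_stable {f : ℕ → (ℕ → ℕ) → ℕ} {n n' i : ℕ} (h : i < n) (h' : n ≤ n') :
    table f n' i = table f n i := by
  induction n', h' using Nat.le_induction with
  | base => rfl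
  | succ m hm ih => rw [table, Function.update_of_ne (by omega), ih]

/-- Later steps leave entry `i` alone, so it is what step `i` wrote from the entries before it. This
unfolds the recursions of the algorithm. -/
theorem table_eq {f : ℕ → (ℕ → ℕ) → ℕ} {n i : ℕ} (h : i < n) :
    table f n i = f i (table f i) := by
  rw [table_stable (Nat.lt_succ_self i) h, table, Function.update_self]

/-- A table is bounded by the reduction modulo `M + 1` alone, so a recursion along it cannot make
the values grow. -/
theorem Tm.eval_le (t : Tm) {α : ℕ → ℕ → ℕ} {ρ : ℕ → ℕ} {B : ℕ} (h : Bounded α ρ B) :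
    t.eval α ρ ≤ t.bnd B := by
  induction t generalizing α ρ B with
  | const c => exact le_rfl
  | var i => exact h.scalar i
  | op o e₁ e₂ h₁ h₂ => exact o.eval_le (h₁ h) (h₂ h)
  | look a e _ => exact h.array _ _
  | ren σ e he => exact he ⟨fun i => h.scalar _, h.array⟩
  | letin e b he hb => exact hb (h.push (by omega) ((he h).trans (by omega)))
  | sum n b hn hb =>
    simp only [eval, bnd]
    refine (Finset.sum_le_card_nsmul _ _ (b.bnd (B + n.bnd B)) fun t ht => ?_).trans ?_
    · have := hn h
      have := Finset.mem_range.1 ht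
      exact hb (h.push (by omega) (by omega))
    · simpa using Nat.mul_le_mul_right _ (hn h)
  | tab a n M b q _ hM _ _ =>
    refine table_le (fun t S => ?_) _ _
    have := hM h
    have := Nat.mod_lt (b.eval (Function.update α a S) (push t ρ))
      (show 0 < M.eval α ρ + 1 by omega)
    simp only [bnd]
    omega

end RAM

/-! ### Correctness of compiled terms, one constructor at a time -/

namespace RAM

/-- The term is compiled correctly. -/
def Tm.Correct (t : Tm) : Prop :=
  ∀ ⦃l : ℕ⦄, t.OK l → ∀ ⦃v : ℕ → ℕ⦄ ⦃k : ℕ⦄ ⦃α : ℕ → ℕ → ℕ⦄ ⦃ρ : ℕ → ℕ⦄ ⦃B : ℕ⦄ ⦃s : Config⦄,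
    Rep s v k α ρ → Bounded α ρ B → (∀ a, l ≤ a → ∀ i, α a i = 0) →
    ∃ s', RunLE (t.compile v k) s s' (t.cost B) ∧ Frame k s s' ∧ s'.mem (16 * k) = t.eval α ρ

theorem correct_const (c : ℕ) : (Tm.const c).Correct := by
  intro l _ v k α ρ B s hr hb hz
  exact ⟨_, RunLE.const s _ c, (Frame.refl k s).set le_rfl c, by simp [set_mem, Tm.eval]⟩

theorem correct_var (i : ℕ) : (Tm.var i).Correct := by
  intro l _ v k α ρ B s hr hb hz
  have h1 := hr.lt i
  have h2 := hr.scalar i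
  have h3 := hb.scalar i
  refine ⟨_, ((RunLE.const s _ _).cons ((RunLE.arith _ _ _ _ _).cons (RunLE.nil _))).mono ?_,
    ((Frame.refl k s).set (by omega) _).set (by omega) _, ?_⟩
  · have : v i ≠ k + 1 := by omega
    simp only [set_mem, mul_eq_mul_left_iff, this, Tm.cost]
    simp
    omega
  · have : v i ≠ k + 1 := by omega
    simp [set_mem, this, h2, Tm.eval, Op.eval]

theorem correct_op (o : Op) {e₁ e₂ : Tm} (h₁ : e₁.Correct) (h₂ : e₂.Correct) :
    (Tm.op o e₁ e₂).Correct := by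
  intro l ⟨ok₁, ok₂⟩ v k α ρ B s hr hb hz
  obtain ⟨s1, r1, f1, m1⟩ := h₁ ok₁ hr hb hz
  obtain ⟨s2, r2, f2, m2⟩ := h₂ ok₂ (hr.frame f1 k.le_succ) hb hz
  have hm : s2.mem (16 * k) = e₁.eval α ρ := by rw [f2.scalar (by omega), m1]
  refine ⟨_, (r1.cons (r2.cons ((RunLE.arith _ _ _ _ _).cons (RunLE.nil _)))).mono ?_,
    (f1.trans (f2.mono k.le_succ)).set le_rfl _, ?_⟩
  · have := e₁.eval_le hb
    have := e₂.eval_le hb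
    rw [hm, m2, Tm.cost]
    omega
  · rw [set_mem, if_pos rfl, hm, m2, Tm.eval]

theorem correct_look (a : ℕ) {e : Tm} (h : e.Correct) : (Tm.look a e).Correct := by
  intro l ⟨ha, ok⟩ v k α ρ B s hr hb hz
  obtain ⟨s1, r1, f1, m1⟩ := h ok hr hb hz
  have h1 := e.eval_le hb
  have h2 := hb.array a (e.eval α ρ)
  have h3 : s1.mem (16 * e.eval α ρ + a + 1) = α a (e.eval α ρ) := by
    rw [← hr.array a ha, ← f1.array ha]
  have e1 : ∀ j, 16 * e.eval α ρ + a + 1 ≠ 16 * j := by omega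
  refine ⟨_, (r1.cons ((addr_run m1 ha (by omega) (by omega)).cons
      ((RunLE.load _ _ _).cons (RunLE.nil _)))).mono ?_,
    ((f1.set (by omega) _).set (by omega) _).set (by omega) _, ?_⟩
  · simp [set_mem, e1, h3, Tm.cost]
    omega
  · simp [set_mem, e1, h3, Tm.eval]

theorem correct_ren (σ : ℕ → ℕ) {e : Tm} (h : e.Correct) : (Tm.ren σ e).Correct := by
  intro l ok v k α ρ B s hr hb hz
  exact h ok ⟨fun i => hr.lt _, fun i => hr.scalar _, hr.array⟩
    ⟨fun i => hb.scalar _, hb.array⟩ hz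

theorem correct_letin {e b : Tm} (he : e.Correct) (h : b.Correct) : (Tm.letin e b).Correct := by
  intro l ⟨ok₁, ok₂⟩ v k α ρ B s hr hb hz
  obtain ⟨s1, r1, f1, m1⟩ := he ok₁ hr hb hz
  have hB := hb.push (B' := B + e.bnd B) (by omega) ((e.eval_le hb).trans (by omega))
  obtain ⟨s2, r2, f2, m2⟩ := h ok₂ ((hr.frame f1 k.le_succ).push le_rfl k.lt_succ_self m1) hB hz
  have := b.eval_le hB
  refine ⟨_, (r1.cons (r2.cons ((RunLE.const _ _ _).cons ((RunLE.arith _ _ _ _ _).cons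
    (RunLE.nil _))))).mono ?_,
    ((f1.trans (f2.mono k.le_succ)).set le_rfl _).set le_rfl _, ?_⟩
  · simp [set_mem, m2, Tm.cost]
    omega
  · simp [set_mem, m2, Tm.eval, Op.eval]

theorem correct_sum {n b : Tm} (hn : n.Correct) (h : b.Correct) : (Tm.sum n b).Correct := by
  intro l ⟨ok₁, ok₂⟩ v k α ρ B s hr hb hz
  obtain ⟨s1, r1, f1, m1⟩ := hn ok₁ hr hb hz
  have hnb := n.eval_le hb
  set N := n.eval α ρ with hN
  set NB := n.bnd B with hNB
  set BB := b.bnd (B + NB) with hBB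
  have hB (t : ℕ) (ht : t < N) : Bounded α (push t ρ) (B + NB) :=
    hb.push (by omega) (by omega)
  have hval (t : ℕ) (ht : t < N) : b.eval α (push t ρ) ≤ BB := b.eval_le (hB t ht)
  have hacc (t : ℕ) (ht : t ≤ N) : ∑ t ∈ Finset.range t, b.eval α (push t ρ) ≤ NB * BB := by
    refine (Finset.sum_le_card_nsmul _ _ BB fun j hj => hval j ?_).trans ?_
    · have := Finset.mem_range.1 hj
      omega
    · simpa using Nat.mul_le_mul_right _ (ht.trans hnb)
  -- Scalar `k` counts down, scalar `k + 1` accumulates the sum, and scalar `k + 2` is the index,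
  -- hence the bound variable of the body.
  obtain ⟨s2, r2, ⟨f2, m2, m2'⟩, m3⟩ := loop_run
    (P := seqs [b.compile (push (k + 2) v) (k + 3),
        .arith .add (16 * (k + 1)) (16 * (k + 1)) (16 * (k + 3)), tick (k + 2) k (k + 3)])
    (s := (s1.set (16 * (k + 1)) 0).set (16 * (k + 2)) 0)
    (r := 16 * k) (n := N) (T := b.cost (B + NB) + 20 + 4 * NB + 4 * BB + NB * BB)
    (I := fun i s' => Frame k s s' ∧ s'.mem (16 * (k + 1)) =
      ∑ t ∈ Finset.range i, b.eval α (push t ρ) ∧ s'.mem (16 * (k + 2)) = i)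
    ⟨(f1.set (by omega) _).set (by omega) _, by simp [set_mem], by simp [set_mem]⟩
    (by simp [set_mem, m1]) (by
      rintro i s' hi ⟨g1, g2, g3⟩ g4
      obtain ⟨s3, r3, f3, m3⟩ := h ok₂ (((hr.frame g1 (by omega : k ≤ k + 3)).push le_rfl
        (by omega) g3)) (hB i hi) hz
      have := hval i hi
      have := hacc i hi.le
      rw [← f3.scalar (by omega)] at g2 g3 g4
      refine ⟨_, (r3.cons ((RunLE.arith_of_eq _ g2 m3 rfl).cons ((tick_run (v := i)
        (w := N - i) ?_ ?_ (by omega) (by omega) (by omega)).cons (RunLE.nil _)))).mono ?_,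
        ⟨((((g1.trans (f3.mono (by omega))).set (by omega) _).set (by omega) _).set
          (by omega) _).set (by omega) _, ?_, ?_⟩, ?_⟩
      · simp [set_mem, g3]
      · simp [set_mem, g4]
      · omega
      · simp [set_mem, Op.eval, Finset.sum_range_succ]
      · simp [set_mem]
      · simp [set_mem]
        omega)
  have := hacc N le_rfl
  refine ⟨_, (r1.cons ((RunLE.const _ _ _).cons ((RunLE.const _ _ _).cons (r2.cons
    ((RunLE.arith _ _ _ _ _).cons (RunLE.nil _)))))).mono ?_, f2.set le_rfl _, ?_⟩
  · have : N * (1 + N + (b.cost (B + NB) + 20 + 4 * NB + 4 * BB + NB * BB)) ≤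
      NB * (1 + NB + (b.cost (B + NB) + 20 + 4 * NB + 4 * BB + NB * BB)) := by gcongr
    simp only [m3, m2, Tm.cost, ← hNB, ← hBB]
    omega
  · simp [set_mem, m3, m2, Op.eval, Tm.eval, hN]

/-- `s'` differs from `s` at most in the scalars from `k` on and in the array `a`, whose content
is `S`. -/
structure FrameArray (k a : ℕ) (S : ℕ → ℕ) (s s' : Config) : Prop where
  input : s'.input = s.input
  output : s'.output = s.output
  mem : ∀ x, (∀ j, k ≤ j → x ≠ 16 * j) → (∀ i, x ≠ 16 * i + a + 1) → s'.mem x = s.mem x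
  array : ∀ i, s'.mem (16 * i + a + 1) = S i

theorem FrameArray.trans {k a : ℕ} {S : ℕ → ℕ} {s s' s'' : Config} (h : FrameArray k a S s s')
    (ha : a < 15) (h' : Frame k s' s'') : FrameArray k a S s s'' :=
  ⟨h'.input.trans h.input, h'.output.trans h.output,
    fun x hx hx' => (h'.mem x hx).trans (h.mem x hx hx'),
    fun i => by rw [h'.array ha, h.array]⟩

theorem FrameArray.set {k a : ℕ} {S : ℕ → ℕ} {s s' : Config} (h : FrameArray k a S s s')
    (ha : a < 15) {j : ℕ} (hj : k ≤ j) (x : ℕ) : FrameArray k a S s (s'.set (16 * j) x) :=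
  h.trans ha ((Frame.refl k s').set hj x)

theorem FrameArray.set_array {k a : ℕ} {S : ℕ → ℕ} {s s' : Config} (h : FrameArray k a S s s')
    (i x : ℕ) : FrameArray k a (Function.update S i x) s (s'.set (16 * i + a + 1) x) :=
  ⟨h.input, h.output, fun y hy hy' => by rw [set_mem, if_neg (hy' i), h.mem y hy hy'],
    fun j => by
      by_cases hj : j = i
      · simp [hj, set_mem]
      · have : 16 * j + a + 1 ≠ 16 * i + a + 1 := by omega
        rw [Function.update_of_ne hj, set_mem, if_neg this, h.array]⟩

theorem Rep.frameArray {s s' : Config} {v : ℕ → ℕ} {k k' a : ℕ} {α : ℕ → ℕ → ℕ} {ρ S : ℕ → ℕ}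
    (h : Rep s v k α ρ) (hf : FrameArray k a S s s') (ha : a < 15) (hk : k ≤ k') :
    Rep s' v k' (Function.update α a S) ρ :=
  ⟨fun i => (h.lt i).trans_le hk, fun i => by
      have := h.lt i
      rw [hf.mem _ (by omega) (by omega), h.scalar],
    fun b hb i => by
      by_cases hab : b = a
      · subst hab; rw [hf.array, Function.update_self]
      · rw [Function.update_of_ne hab, hf.mem _ (by omega) (by omega), h.array b hb]⟩

end RAM

/-! ### Correctness of table filling, and of all terms -/

namespace RAM

theorem RunLE.store_of_eq {s : Config} {r i x y : ℕ} (hx : s.mem r = x) (hy : s.mem i = y) :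
    RunLE (.store r i) s (s.set x y) (1 + x + y) := by
  subst hx hy
  exact RunLE.store s r i

theorem RunLE.load_of_eq {s : Config} (r : ℕ) {i x y : ℕ} (hx : s.mem i = x)
    (hy : s.mem x = y) : RunLE (.load r i) s (s.set r y) (1 + x + y) := by
  subst hx hy
  exact RunLE.load s r i

/-- While the array `a` is being filled, the body sees the partial table under this name and binds
only names above `a`, which are still zero. The clearing loop then restores the zeros, so that for
the outside only scalars have changed. -/
theorem correct_tab (a : ℕ) {n M b q : Tm} (hn : n.Correct) (hM : M.Correct) (h : b.Correct)
    (hq : q.Correct) : (Tm.tab a n M b q).Correct := by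
  rintro l ⟨hla, ha, okn, okM, okb, okq⟩ v k α ρ B s hr hb hz
  obtain ⟨s1, r1, f1, m1⟩ := hq okq hr hb hz
  obtain ⟨s2, r2, f2, m2⟩ := hn okn (hr.frame f1 (by omega : k ≤ k + 1)) hb hz
  have f12 := f1.trans (f2.mono (by omega))
  obtain ⟨s3, r3, f3, m3⟩ := hM okM (hr.frame f12 (by omega : k ≤ k + 2)) hb hz
  have f123 := f12.trans (f3.mono (by omega))
  have hqb := q.eval_le hb
  have hnb := n.eval_le hb
  have hMb := M.eval_le hb
  have m1' : s3.mem (16 * k) = q.eval α ρ := by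
    rw [f3.scalar (by omega), f2.scalar (by omega), m1]
  have m2' : s3.mem (16 * (k + 1)) = n.eval α ρ := by rw [f3.scalar (by omega), m2]
  simp only [Tm.cost, Tm.eval]
  set N := n.eval α ρ with hN
  set Q := q.eval α ρ with hQ
  set m := M.eval α ρ with hm
  set NB := n.bnd B with hNB
  set QB := q.bnd B with hQB
  set MB := M.bnd B with hMB
  set BB := b.bnd (B + NB + MB) with hBB
  set F : ℕ → (ℕ → ℕ) → ℕ :=
    fun t S => b.eval (Function.update α a S) (push t ρ) % (m + 1) with hF
  have hFle (t : ℕ) (S : ℕ → ℕ) : F t S ≤ MB := by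
    have := Nat.mod_lt (b.eval (Function.update α a S) (push t ρ)) (show 0 < m + 1 by omega)
    simp only [hF]
    omega
  have hB (t : ℕ) (ht : t < N) :
      Bounded (Function.update α a (table F t)) (push t ρ) (B + NB + MB) :=
    (hb.push (B' := B + NB + MB) (by omega) (by omega)).update le_rfl a
      fun i => (table_le hFle t i).trans (by omega)
  have hzero (i : ℕ) : s.mem (16 * i + a + 1) = 0 := by rw [hr.array a ha, hz a hla]
  -- The scalars `k`, …, `k + 4` hold the position to be looked up, the length, the modulus, the
  -- index and the counter.
  obtain ⟨s4, r4, ⟨f4, c0, c1, c2, c3⟩, c4⟩ := loop_run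
    (P := seqs [b.compile (push (k + 3) v) (k + 5), modulo (k + 5) (k + 2) (k + 6),
        addr a (k + 6) (k + 3) (k + 7), .store (16 * (k + 6)) (16 * (k + 5)),
        tick (k + 3) (k + 4) (k + 6)])
    (s := (((s3.set (16 * (k + 3)) 1).set (16 * (k + 2)) (m + 1)).set (16 * (k + 3)) 0).set
      (16 * (k + 4)) N)
    (r := 16 * (k + 4)) (n := N) (T := b.cost (B + NB + MB) + 200 + 100 * NB + 10 * MB + 10 * BB)
    (I := fun i s' => FrameArray k a (table F i) s s' ∧ s'.mem (16 * k) = Q ∧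
      s'.mem (16 * (k + 1)) = N ∧ s'.mem (16 * (k + 2)) = m + 1 ∧ s'.mem (16 * (k + 3)) = i)
    (by
      have g := (((f123.set (j := k + 3) (by omega) 1).set (j := k + 2) (by omega) (m + 1)).set
        (j := k + 3) (by omega) 0).set (j := k + 4) (by omega) N
      refine ⟨⟨g.input, g.output, fun x hx _ => g.mem x hx, fun i => ?_⟩, ?_, ?_, ?_, ?_⟩
      · rw [g.array ha, hzero, table]
      · simp [set_mem, m1']
      · simp [set_mem, m2']
      · simp [set_mem]
      · simp [set_mem])
    (by simp [set_mem]) (by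
      rintro i s' hi ⟨g, g0, g1, g2, g3⟩ g4
      obtain ⟨s5, r5, f5, m5⟩ := h okb (((hr.frameArray g ha (by omega : k ≤ k + 5)).push
        le_rfl (by omega) g3)) (hB i hi) (fun b' hb' i => by
          rw [Function.update_of_ne (by omega), hz b' (by omega)])
      have hx := b.eval_le (hB i hi)
      rw [← hBB] at hx
      set x := b.eval (Function.update α a (table F i)) (push i ρ) with hxdef
      rw [← f5.scalar (by omega)] at g0 g1 g2 g3 g4
      have hne : ∀ j, ¬ 16 * j = 16 * i + a + 1 := by omega
      have g' := ((((g.trans ha (f5.mono (by omega))).set ha (j := k + 6) (by omega)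
        (x / (m + 1) * (m + 1))).set ha (j := k + 5) (by omega) (F i (table F i))).set ha
        (j := k + 7) (by omega) (a + 1)).set ha (j := k + 6) (by omega) (16 * i + a + 1)
      have g'' := (((g'.set_array i (F i (table F i))).set ha (j := k + 6) (by omega) 1).set ha
        (j := k + 3) (by omega) (i + 1)).set ha (j := k + 4) (by omega) (N - i - 1)
      refine ⟨_, (r5.cons ((modulo_run m5 g2 (by omega) (by omega)).cons
        ((addr_run (v := i) ?_ ha (by omega) (by omega)).cons
        ((RunLE.store_of_eq (x := 16 * i + a + 1) (y := F i (table F i)) ?_ ?_).cons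
        ((tick_run (v := i) (w := N - i) ?_ ?_ (by omega) (by omega) (by omega)).cons
        (RunLE.nil _)))))).mono ?_, ⟨g'', ?_, ?_, ?_, ?_⟩, ?_⟩
      · simp [set_mem, g3]
      · simp [set_mem]
      · simp [set_mem, hF, hxdef]
      · simp [set_mem, g3, hne]
      · simp [set_mem, g4, hne]
      · have := hFle i (table F i)
        omega
      all_goals simp [set_mem, hne, g0, g1, g2]
      omega)
  have d0 : s4.mem (16 * Q + a + 1) = table F N Q := f4.array Q
  have e1 : ∀ j, ¬ 16 * Q + a + 1 = 16 * j := by omega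
  have f5 := ((((f4.set ha (j := k + 6) (by omega) (a + 1)).set ha (j := k + 5) (by omega)
    (16 * Q + a + 1)).set ha (j := k) (by omega) (table F N Q)).set ha (j := k + 3) (by omega)
    0).set ha (j := k + 4) (by omega) N
  obtain ⟨s6, r6, ⟨f6, b0, b3⟩, b4⟩ := loop_run
    (P := seqs [addr a (k + 6) (k + 3) (k + 7), .const (16 * (k + 5)) 0,
        .store (16 * (k + 6)) (16 * (k + 5)), tick (k + 3) (k + 4) (k + 6)])
    (r := 16 * (k + 4)) (n := N) (T := 200 + 100 * NB)
    (I := fun i s' => FrameArray k a (fun j => if j < i then 0 else table F N j) s s' ∧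
      s'.mem (16 * k) = table F N Q ∧ s'.mem (16 * (k + 3)) = i)
    ⟨by simpa using f5, by simp [set_mem], by simp [set_mem]⟩
    (by simp [set_mem]) (by
      rintro i s' hi ⟨g, g0, g3⟩ g4
      have hne : ∀ j, ¬ 16 * j = 16 * i + a + 1 := by omega
      have g' := ((g.set ha (j := k + 7) (by omega) (a + 1)).set ha (j := k + 6) (by omega)
        (16 * i + a + 1)).set ha (j := k + 5) (by omega) 0
      have g'' := (((g'.set_array i 0).set ha (j := k + 6) (by omega) 1).set ha
        (j := k + 3) (by omega) (i + 1)).set ha (j := k + 4) (by omega) (N - i - 1)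
      have e3 : Function.update (fun j => if j < i then 0 else table F N j) i 0 =
          fun j => if j < i + 1 then 0 else table F N j := by
        funext j
        rw [Function.update_apply]
        split_ifs <;> first | rfl | omega
      rw [e3] at g''
      refine ⟨_, ((addr_run (v := i) g3 ha (by omega) (by omega)).cons
        ((RunLE.const _ _ _).cons
        ((RunLE.store_of_eq (x := 16 * i + a + 1) (y := 0) ?_ ?_).cons
        ((tick_run (v := i) (w := N - i) ?_ ?_ (by omega) (by omega) (by omega)).cons
        (RunLE.nil _))))).mono ?_, ⟨g'', ?_, ?_⟩, ?_⟩
      · simp [set_mem]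
      · simp [set_mem]
      · simp [set_mem, g3, hne]
      · simp [set_mem, g4, hne]
      · omega
      all_goals simp [set_mem, hne, g0]
      omega)
  refine ⟨s6, (r1.cons (r2.cons (r3.cons ((RunLE.const _ _ _).cons
    ((RunLE.arith_of_eq (x := m) (y := 1) (z := m + 1) _ ?_ ?_ rfl).cons
    ((RunLE.const _ _ _).cons ((RunLE.arith_of_eq (x := N) (y := 0) (z := N) _ ?_ ?_ rfl).cons
    (r4.cons ((addr_run c0 ha (by omega) (by omega)).cons
    ((RunLE.load_of_eq (x := 16 * Q + a + 1) (y := table F N Q) _ ?_ ?_).cons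
    ((RunLE.const _ _ _).cons ((RunLE.arith_of_eq (x := N) (y := 0) (z := N) _ ?_ ?_ rfl).cons
    (r6.cons (RunLE.nil _)))))))))))))).mono ?_, ⟨f6.input, f6.output, fun x hx => ?_⟩, b0⟩
  · simp [set_mem, m3]
  · simp [set_mem]
  · simp [set_mem, m2']
  · simp [set_mem]
  · simp [set_mem]
  · simp [set_mem, e1, d0]
  · simp [set_mem, c1]
  · simp [set_mem]
  · have h1 : N * (1 + N + (b.cost (B + NB + MB) + 200 + 100 * NB + 10 * MB + 10 * BB)) ≤
      NB * (1 + NB + (b.cost (B + NB + MB) + 200 + 100 * NB + 10 * MB + 10 * BB)) := by gcongr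
    have h2 : N * (1 + N + (200 + 100 * NB)) ≤ NB * (1 + NB + (200 + 100 * NB)) := by gcongr
    have h3 := table_le hFle N Q
    omega
  -- The array `a` was zero before; now its entries below `N` have been cleared, and the others were
  -- never written.
  · by_cases hxa : ∃ i, x = 16 * i + a + 1
    · obtain ⟨i, rfl⟩ := hxa
      rw [f6.array, hzero]
      split_ifs with hi
      · rfl
      · exact table_of_le (by omega)
    · push Not at hxa
      exact f6.mem x hx hxa

theorem Tm.correct (t : Tm) : t.Correct := by
  induction t with
  | const c => exact correct_const c
  | var i => exact correct_var i
  | op o e₁ e₂ h₁ h₂ => exact correct_op o h₁ h₂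
  | look a e h => exact correct_look a h
  | ren σ e h => exact correct_ren σ h
  | letin e b he hb => exact correct_letin he hb
  | sum n b hn hb => exact correct_sum hn hb
  | tab a n M b q hn hM hb hq => exact correct_tab a hn hM hb hq

end RAM

namespace RAM

/-! ## Polynomial bounds -/

/-- `f` is bounded by a power of its argument, for arguments at least `2`. -/
def PolyBounded (f : ℕ → ℕ) : Prop := ∃ c, ∀ B, 2 ≤ B → f B ≤ B ^ c

theorem PolyBounded.const (k : ℕ) : PolyBounded fun _ => k :=
  ⟨k, fun _ hB => Nat.lt_two_pow_self.le.trans (Nat.pow_le_pow_left hB k)⟩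

theorem PolyBounded.id : PolyBounded fun B => B := ⟨1, fun B _ => by simp⟩

theorem PolyBounded.add {f g : ℕ → ℕ} (hf : PolyBounded f) (hg : PolyBounded g) :
    PolyBounded fun B => f B + g B := by
  obtain ⟨c, hc⟩ := hf
  obtain ⟨d, hd⟩ := hg
  refine ⟨c + d + 1, fun B hB => ?_⟩
  have h1 : B ^ c ≤ B ^ (c + d) := Nat.pow_le_pow_right (by omega) (by omega)
  have h2 : B ^ d ≤ B ^ (c + d) := Nat.pow_le_pow_right (by omega) (by omega)
  have h3 : B ^ (c + d) * 2 ≤ B ^ (c + d + 1) := by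
    rw [pow_succ]
    exact Nat.mul_le_mul_left _ hB
  have := hc B hB
  have := hd B hB
  change f B + g B ≤ _
  omega

theorem PolyBounded.mul {f g : ℕ → ℕ} (hf : PolyBounded f) (hg : PolyBounded g) :
    PolyBounded fun B => f B * g B := by
  obtain ⟨c, hc⟩ := hf
  obtain ⟨d, hd⟩ := hg
  exact ⟨c + d, fun B hB => by rw [pow_add]; exact Nat.mul_le_mul (hc B hB) (hd B hB)⟩

theorem PolyBounded.comp {f g : ℕ → ℕ} (hf : PolyBounded f) (hg : PolyBounded g)
    (h : ∀ B, 2 ≤ B → 2 ≤ g B) : PolyBounded fun B => f (g B) := by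
  obtain ⟨c, hc⟩ := hf
  obtain ⟨d, hd⟩ := hg
  exact ⟨d * c, fun B hB => by
    rw [pow_mul]; exact (hc _ (h B hB)).trans (Nat.pow_le_pow_left (hd B hB) c)⟩

theorem Tm.polyBounded_bnd (t : Tm) : PolyBounded t.bnd := by
  induction t with
  | const c => exact .const c
  | var i => exact .id
  | op o e₁ e₂ h₁ h₂ => exact (h₁.add h₂).add (h₁.mul h₂)
  | look a e h => exact .id
  | ren σ e h => exact h
  | letin e b he hb => exact hb.comp (PolyBounded.id.add he) fun B hB => by omega
  | sum n b hn hb => exact hn.mul (hb.comp (PolyBounded.id.add hn) fun B hB => by omega)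
  | tab a n M b q hn hM hb hq => exact hM

/-- The cost is built by finitely many sums, products and compositions from the bounds for the
subterms. With `Tm.correct`, writing a function as a term is enough to have it computed in time
polynomial in the numbers of its environment. -/
theorem Tm.polyBounded_cost (t : Tm) : PolyBounded t.cost := by
  induction t with
  | const c => exact .const _
  | var i => exact (PolyBounded.const _).add .id
  | op o e₁ e₂ h₁ h₂ =>
    exact (((h₁.add h₂).add (.const _)).add e₁.polyBounded_bnd).add e₂.polyBounded_bnd
  | look a e h =>
    exact ((h.add (.const _)).add ((PolyBounded.const _).mul e.polyBounded_bnd)).add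
      ((PolyBounded.const _).mul .id)
  | ren σ e h => exact h
  | letin e b he hb =>
    have hB : PolyBounded fun B => B + e.bnd B := PolyBounded.id.add e.polyBounded_bnd
    exact ((he.add (hb.comp hB fun B hB => by omega)).add (.const _)).add
      (b.polyBounded_bnd.comp hB fun B hB => by omega)
  | sum n b hn hb =>
    have hN := n.polyBounded_bnd
    have hB : PolyBounded fun B => B + n.bnd B := PolyBounded.id.add hN
    have h1 := hb.comp hB fun B hB => by omega
    have h2 := b.polyBounded_bnd.comp hB fun B hB => by omega
    change PolyBounded fun B => Tm.cost _ B
    simp only [Tm.cost]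
    repeat' first
      | exact hN | exact hn | exact h1 | exact h2 | exact .const _ | exact .id
      | apply PolyBounded.add | apply PolyBounded.mul
  | tab a n M b q hn hM hb hq =>
    have hN := n.polyBounded_bnd
    have hM' := M.polyBounded_bnd
    have hQ := q.polyBounded_bnd
    have hB : PolyBounded fun B => B + n.bnd B + M.bnd B := (PolyBounded.id.add hN).add hM'
    have h1 := hb.comp hB fun B hB => by omega
    have h2 := b.polyBounded_bnd.comp hB fun B hB => by omega
    change PolyBounded fun B => Tm.cost _ B
    simp only [Tm.cost]
    repeat' first
      | exact hN | exact hn | exact hM | exact hM' | exact hQ | exact hq | exact h1 | exact h2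
      | exact .const _ | exact .id | apply PolyBounded.add | apply PolyBounded.mul

/-! ## Complete programs -/

/-- The program that reads `R 1` numbers (on scalars) to the array `0`, from the position `R 0`
on. -/
def readLoop : Prog :=
  .loop (16 * 1) (seqs [.read (16 * 2), addr 0 3 0 4, .store (16 * 3) (16 * 2), tick 0 1 4])

/-- The first `j` numbers of the input have been read to the array `0`. -/
structure HasRead (inp : List ℕ) (j : ℕ) (s : Config) : Prop where
  input : s.input = inp.drop j
  output : s.output = []
  pos : s.mem (16 * 0) = j
  array_zero : ∀ i, s.mem (16 * i + 0 + 1) = if i < j then inp.getD i 0 else 0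
  array : ∀ a, 0 < a → a < 15 → ∀ i, s.mem (16 * i + a + 1) = 0

theorem HasRead.set {inp : List ℕ} {j : ℕ} {s : Config} (h : HasRead inp j s) {i : ℕ} (hi : 0 < i)
    (x : ℕ) : HasRead inp j (s.set (16 * i) x) :=
  ⟨h.input, h.output, by rw [set_mem, if_neg (by omega), h.pos],
    fun b => by rw [set_mem, if_neg (by omega), h.array_zero],
    fun a ha ha' b => by rw [set_mem, if_neg (by omega), h.array a ha ha']⟩

theorem headD_drop (l : List ℕ) (j : ℕ) : (l.drop j).headD 0 = l.getD j 0 := by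
  rw [List.headD_eq_head?_getD, List.head?_drop, List.getD_eq_getElem?_getD]

theorem readLoop_run {inp : List ℕ} {j c B : ℕ} {s : Config} (h : HasRead inp j s)
    (hc : s.mem (16 * 1) = c) (hB : ∀ i, inp.getD i 0 ≤ B) :
    ∃ s', RunLE readLoop s s' (1 + c * (1 + c + (200 + 50 * (j + c) + 5 * B))) ∧
      HasRead inp (j + c) s' := by
  obtain ⟨s', hr, hI, _⟩ := loop_run (P := seqs [.read (16 * 2), addr 0 3 0 4,
    .store (16 * 3) (16 * 2), tick 0 1 4]) (r := 16 * 1) (n := c)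
    (T := 200 + 50 * (j + c) + 5 * B)
    (I := fun i s' => HasRead inp (j + i) s') h hc (by
      rintro i s1 hi g g1
      have hx := headD_drop inp (j + i)
      rw [← g.input] at hx
      have hb := hB (j + i)
      set x := inp.getD (j + i) 0 with hxdef
      have r1 := RunLE.read s1 (16 * 2)
      rw [hx] at r1
      set s2 : Config := { s1.set (16 * 2) x with input := s1.input.tail } with hs2
      have hm (y : ℕ) : s2.mem y = if y = 16 * 2 then x else s1.mem y := set_mem s1 _ _ _
      have e1 : ∀ k, ¬ 16 * k = 16 * (j + i) + 0 + 1 := by omega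
      refine ⟨_, (r1.cons ((addr_run (v := j + i) ?_ (by omega) (by omega) (by omega)).cons
        ((RunLE.store_of_eq (x := 16 * (j + i) + 0 + 1) (y := x) ?_ ?_).cons
        ((tick_run (v := j + i) (w := c - i) ?_ ?_ (by omega) (by omega) (by omega)).cons
        (RunLE.nil _))))).mono ?_, ⟨?_, ?_, ?_, ?_, ?_⟩, ?_⟩
      · rw [hm, if_neg (by omega), g.pos]
      · simp [set_mem]
      · simp [set_mem, hm]
      · rw [set_mem, if_neg (e1 _), set_mem, if_neg (by omega), set_mem, if_neg (by omega), hm,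
          if_neg (by omega), g.pos]
      · rw [set_mem, if_neg (e1 _), set_mem, if_neg (by omega), set_mem, if_neg (by omega), hm,
          if_neg (by omega), g1]
      · omega
      · simp [hs2, g.input, List.tail_drop, add_assoc]
      · exact g.output
      · simp [set_mem]
        ring
      · intro k
        rw [set_mem, if_neg (by omega), set_mem, if_neg (by omega), set_mem, if_neg (by omega),
          set_mem]
        by_cases hk : k = j + i
        · subst hk
          rw [if_pos rfl, if_pos (by omega)]
        · rw [if_neg (by omega), set_mem, if_neg (by omega), set_mem, if_neg (by omega), hm,
            if_neg (by omega), g.array_zero]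
          by_cases hk' : k < j + i
          · rw [if_pos hk', if_pos (by omega)]
          · rw [if_neg hk', if_neg (by omega)]
      · intro a ha ha' k
        rw [set_mem, if_neg (by omega), set_mem, if_neg (by omega), set_mem, if_neg (by omega),
          set_mem, if_neg (by omega), set_mem, if_neg (by omega), set_mem, if_neg (by omega), hm,
          if_neg (by omega), g.array a ha ha']
      · simp [set_mem]
        omega)
  exact ⟨s', hr, hI⟩

/-- The arrays at the beginning of the computation proper: the input and one more number `N`. -/
def initArrays (inp : List ℕ) (N : ℕ) (a i : ℕ) : ℕ :=
  if a = 0 then inp.getD i 0 else if a = 1 ∧ i = 0 then N else 0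

/-- The program that reads an input of the length `4 + a + e * (n + a)`, where `a` is the number in
position `2` and `e` the number in position `3 + a`, computes the power `N` of the first number with
exponent the second number, and writes the values of `out` at the numbers less than `cnt`. -/
def mainProg (n : ℕ) (cnt out : Tm) : Prog :=
  -- The length of the input is not known in advance, so it is read in three batches. Register `16 *
  -- i + 0 + 1` is entry `i` of the input array.
  seqs [.const (16 * 1) 3, readLoop,
    .const (16 * 1) 1, .arith .add (16 * 1) (16 * 2 + 0 + 1) (16 * 1), readLoop,
    -- The number read last, at position `3 + a`, is the number of terms.
    .const (16 * 2) 1, .arith .sub (16 * 3) (16 * 0) (16 * 2), addr 0 5 3 4,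
    .load (16 * 5) (16 * 5), .const (16 * 2) n,
    .arith .add (16 * 2) (16 * 2 + 0 + 1) (16 * 2),
    .arith .mul (16 * 1) (16 * 5) (16 * 2), readLoop,
    -- From here on scalar `5` is zero. It serves for copying, and it represents all variables of
    -- `cnt` and all but the first variable of `out`.
    .const (16 * 5) 0, .const (16 * 2) 1,
    .arith .add (16 * 1) (16 * 1 + 0 + 1) (16 * 5), .const (16 * 4) 0,
    .loop (16 * 1) (seqs [.arith .mul (16 * 2) (16 * 0 + 0 + 1) (16 * 2), tick 4 1 3]),
    .arith .add (16 * 0 + 1 + 1) (16 * 2) (16 * 5),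
    cnt.compile (fun _ => 5) 6, .const (16 * 7) 0,
    .loop (16 * 6) (seqs [out.compile (push 7 fun _ => 5) 8, .write (16 * 8), tick 7 6 8])]

end RAM

/-! ### Correctness and cost of the complete program -/

namespace RAM

theorem HasRead.stepRead {inp : List ℕ} {j j' c B L : ℕ} {s : Config} (h : HasRead inp j s)
    (hc : s.mem (16 * 1) = c) (hB : ∀ i, inp.getD i 0 ≤ B) (hj : j + c = j') (hL : j' ≤ L) :
    ∃ s', RunLE readLoop s s' (1 + L * (1 + L + (200 + 50 * L + 5 * B))) ∧
      HasRead inp j' s' := by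
  subst hj
  obtain ⟨s', hr, hI⟩ := readLoop_run h hc hB
  refine ⟨s', hr.mono ?_, hI⟩
  have : c ≤ L := by omega
  gcongr

/-- A bound for the cost of `mainProg`. -/
def mainCost (n : ℕ) (cnt out : Tm) (B : ℕ) : ℕ :=
  3 * (1 + (4 + B + B * (n + B)) * (1 + (4 + B + B * (n + B)) +
    (200 + 50 * (4 + B + B * (n + B)) + 5 * B))) +
  (1 + B * (1 + B + (20 + 10 * B))) + cnt.cost B +
  (1 + cnt.bnd B * (1 + cnt.bnd B + (out.cost (B + cnt.bnd B) + 20 +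
    4 * out.bnd (B + cnt.bnd B) + 4 * cnt.bnd B))) +
  1000 + 1000 * B + 100 * (4 + B + B * (n + B)) + 100 * n

theorem polyBounded_mainCost (n : ℕ) (cnt out : Tm) : PolyBounded (mainCost n cnt out) := by
  have hC := cnt.polyBounded_bnd
  have hC' := cnt.polyBounded_cost
  have hB : PolyBounded fun B => B + cnt.bnd B := PolyBounded.id.add hC
  have h1 := out.polyBounded_cost.comp hB fun B hB => by omega
  have h2 := out.polyBounded_bnd.comp hB fun B hB => by omega
  change PolyBounded fun B => mainCost n cnt out B
  unfold mainCost
  repeat' first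
    | exact hC | exact hC' | exact h1 | exact h2
    | exact .const _ | exact .id | apply PolyBounded.add | apply PolyBounded.mul

-- This is all that is needed about the machine: what remains is to find terms `cnt` and `out` for
-- the length and the entries of the output, and a bound `B` for the input and the powers of `p`.
set_option maxHeartbeats 1000000 in
theorem mainProg_run {n : ℕ} {cnt out : Tm} (hcnt : cnt.OK 2) (hout : out.OK 2) {inp : List ℕ}
    {p m a e B : ℕ} (hp : inp.getD 0 0 = p) (hm : inp.getD 1 0 = m) (ha : inp.getD 2 0 = a)
    (he : inp.getD (3 + a) 0 = e) (hlen : inp.length ≤ 4 + a + e * (n + a))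
    (hB : ∀ i, inp.getD i 0 ≤ B) (hpow : ∀ i ≤ m, p ^ i ≤ B) :
    ∃ t ≤ mainCost n cnt out B, Computes (mainProg n cnt out) inp
      ((List.range (cnt.eval (initArrays inp (p ^ m)) fun _ => 0)).map fun i =>
        out.eval (initArrays inp (p ^ m)) (push i fun _ => 0)) t := by
  set s0 : Config := ⟨fun _ => 0, inp, []⟩ with hs0
  have hpB := hp ▸ hB 0
  have hmB := hm ▸ hB 1
  have haB := ha ▸ hB 2
  have heB := he ▸ hB (3 + a)
  set L := 4 + B + B * (n + B) with hL
  have hLe : e * (n + a) ≤ B * (n + B) := by gcongr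
  have h0 : HasRead inp 0 s0 := ⟨rfl, rfl, rfl, by simp [hs0], by simp [hs0]⟩
  obtain ⟨s1, r1, h1⟩ := (h0.set one_pos 3).stepRead (B := B) (L := L) (by simp [set_mem]) hB
    (zero_add 3) (by omega)
  have a1 : s1.mem (16 * 2 + 0 + 1) = a := by rw [h1.array_zero, if_pos (by omega), ha]
  obtain ⟨s2, r2, h2⟩ := ((h1.set one_pos 1).set one_pos (a + 1)).stepRead (B := B) (L := L)
    (j' := 4 + a) (c := a + 1) (by simp [set_mem]) hB (by omega) (by omega)
  have a2 : s2.mem (16 * 2 + 0 + 1) = a := by rw [h2.array_zero, if_pos (by omega), ha]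
  have e2 : s2.mem (16 * (3 + a) + 0 + 1) = e := by rw [h2.array_zero, if_pos (by omega), he]
  have g2 := (((((((h2.set (i := 2) (by omega) 1).set (i := 3) (by omega) (3 + a)).set (i := 4)
    (by omega) (0 + 1)).set (i := 5) (by omega) (16 * (3 + a) + 0 + 1)).set (i := 5) (by omega)
    e).set (i := 2) (by omega) n).set (i := 2) (by omega) (n + a)).set (i := 1) (by omega)
    (e * (n + a))
  obtain ⟨s3, r3, h3⟩ := g2.stepRead (B := B) (L := L)
    (j' := 4 + a + e * (n + a)) (c := e * (n + a)) (by simp [set_mem]) hB rfl (by omega)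
  have m3 : s3.mem (16 * 1 + 0 + 1) = m := by rw [h3.array_zero, if_pos (by omega), hm]
  have g3 := (((h3.set (i := 5) (by omega) 0).set (i := 2) (by omega) 1).set (i := 1) (by omega)
    m).set (i := 4) (by omega) 0
  obtain ⟨s4, r4, ⟨h4, b1, b2, b3⟩, _⟩ := loop_run
    (P := seqs [.arith .mul (16 * 2) (16 * 0 + 0 + 1) (16 * 2), tick 4 1 3])
    (r := 16 * 1) (n := m) (T := 20 + 10 * B)
    (I := fun i s' => HasRead inp (4 + a + e * (n + a)) s' ∧ s'.mem (16 * 2) = p ^ i ∧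
      s'.mem (16 * 5) = 0 ∧ s'.mem (16 * 4) = i)
    ⟨g3, by simp [set_mem], by simp [set_mem], by simp [set_mem]⟩ (by simp [set_mem]) (by
      rintro i s' hi ⟨f1, f2, f3, f4⟩ f5
      have := hpow i hi.le
      have f6 : s'.mem (16 * 0 + 0 + 1) = p := by rw [f1.array_zero, if_pos (by omega), hp]
      refine ⟨_, ((RunLE.arith_of_eq (z := p ^ (i + 1)) _ f6 f2 ?_).cons
        ((tick_run (v := i) (w := m - i) ?_ ?_ (by omega) (by omega) (by omega)).cons
        (RunLE.nil _))).mono ?_, ⟨(((f1.set (by omega) _).set (by omega) _).set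
          (by omega) _).set (by omega) _, ?_, ?_, ?_⟩, ?_⟩
      · rw [pow_succ']
        rfl
      · simp [set_mem, f4]
      · simp [set_mem, f5]
      · omega
      · simp [set_mem]
      · simp [set_mem, f3]
      · simp [set_mem]
      · simp [set_mem]
        omega)
  set α := initArrays inp (p ^ m) with hα
  set s5 := s4.set (16 * 0 + 1 + 1) (p ^ m) with hs5
  have rep : Rep s5 (fun _ => 5) 6 α (fun _ => 0) := by
    refine ⟨fun _ => by omega, fun _ => ?_, fun b hb i => ?_⟩
    · rw [hs5, set_mem, if_neg (by omega), b2]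
    · rw [hs5, set_mem, hα, initArrays]
      rcases Nat.eq_zero_or_pos b with rfl | hb0
      · rw [if_neg (by omega), if_pos rfl, h4.array_zero]
        split_ifs with hi
        · rfl
        · rw [List.getD_eq_default _ _ (by omega)]
      · rw [if_neg (show b ≠ 0 by omega)]
        by_cases hbi : b = 1 ∧ i = 0
        · rw [if_pos hbi, if_pos (by omega)]
        · rw [if_neg hbi, if_neg (by omega), h4.array b hb0 hb]
  have bd : Bounded α (fun _ => 0) B := by
    refine ⟨fun _ => by omega, fun b i => ?_⟩
    rw [hα, initArrays]
    split_ifs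
    · exact hB i
    · exact hpow m le_rfl
    · omega
  -- The arrays `0` and `1` hold the input and `p ^ m`; the others are zero, so terms may bind the
  -- names from `2` on.
  have hz (b : ℕ) (hb : 2 ≤ b) (i : ℕ) : α b i = 0 := by
    rw [hα, initArrays, if_neg (by omega), if_neg (by omega)]
  obtain ⟨s6, r6, f6, m6⟩ := cnt.correct hcnt rep bd hz
  have hC := cnt.eval_le bd
  set N := cnt.eval α fun _ => 0 with hN
  have bd' (i : ℕ) (hi : i < N) : Bounded α (push i fun _ => 0) (B + cnt.bnd B) :=
    bd.push (by omega) (by omega)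
  obtain ⟨s7, r7, ⟨f7, f7', o7, m7⟩, _⟩ := loop_run
    (s := s6.set (16 * 7) 0)
    (P := seqs [out.compile (push 7 fun _ => 5) 8, .write (16 * 8), tick 7 6 8])
    (r := 16 * 6) (n := N) (T := out.cost (B + cnt.bnd B) + 20 + 4 * out.bnd (B + cnt.bnd B) +
      4 * cnt.bnd B)
    (I := fun i s' => (∀ x, (∀ j, 6 ≤ j → x ≠ 16 * j) → s'.mem x = s5.mem x) ∧ s'.input = s5.input ∧
      s'.output = (List.range i).map (fun i => out.eval α (push i fun _ => 0)) ∧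
      s'.mem (16 * 7) = i)
    ⟨(f6.set (by omega) 0).mem, (f6.set (j := 7) (by omega) 0).input,
      by simpa [hs5, h4.output] using f6.output, by simp [set_mem]⟩
    (by simp [set_mem, m6]) (by
      rintro i s' hi ⟨d1, d2, d3, d4⟩ d5
      have rep' : Rep s' (fun _ => 5) 8 α (fun _ => 0) :=
        ⟨fun _ => by omega, fun _ => by rw [d1 _ (by omega), rep.scalar 0],
          fun b hb i => by rw [d1 _ (by omega), rep.array b hb]⟩
      obtain ⟨s8, r8, f8, m8⟩ := out.correct hout (rep'.push le_rfl (by omega) d4) (bd' i hi) hz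
      have hO := out.eval_le (bd' i hi)
      refine ⟨_, (r8.cons ((RunLE.write _ _).cons ((tick_run (v := i) (w := N - i) ?_ ?_
        (by omega) (by omega) (by omega)).cons (RunLE.nil _)))).mono ?_, ⟨?_, ?_, ?_, ?_⟩, ?_⟩
      · exact (f8.scalar (by omega)).trans d4
      · exact (f8.scalar (by omega)).trans d5
      · rw [m8]
        omega
      · intro x hx
        rw [set_mem, if_neg (hx 6 (by omega)), set_mem, if_neg (hx 7 (by omega)), set_mem,
          if_neg (hx 8 (by omega))]
        exact (f8.mem x fun j hj => hx j (by omega)).trans (d1 x hx)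
      · exact f8.input.trans d2
      · simp [f8.output, d3, m8, List.range_succ]
      · simp [set_mem]
      · simp [set_mem]
        omega)
  have hfin : RunLE (mainProg n cnt out) s0 s7 (mainCost n cnt out B) := by
    refine ((RunLE.const _ _ _).cons (r1.cons ((RunLE.const _ _ _).cons
      ((RunLE.arith_of_eq (x := a) (y := 1) (z := a + 1) _ ?_ ?_ rfl).cons (r2.cons
      ((RunLE.const _ _ _).cons
      ((RunLE.arith_of_eq (x := 4 + a) (y := 1) (z := 3 + a) _ ?_ ?_ ?_).cons
      ((addr_run (v := 3 + a) ?_ (by omega) (by omega) (by omega)).cons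
      ((RunLE.load_of_eq (x := 16 * (3 + a) + 0 + 1) (y := e) _ ?_ ?_).cons
      ((RunLE.const _ _ _).cons
      ((RunLE.arith_of_eq (x := a) (y := n) (z := n + a) _ ?_ ?_ ?_).cons
      ((RunLE.arith_of_eq (x := e) (y := n + a) (z := e * (n + a)) _ ?_ ?_ rfl).cons (r3.cons
      ((RunLE.const _ _ _).cons ((RunLE.const _ _ _).cons
      ((RunLE.arith_of_eq (x := m) (y := 0) (z := m) _ ?_ ?_ rfl).cons
      ((RunLE.const _ _ _).cons (r4.cons
      ((RunLE.arith_of_eq (x := p ^ m) (y := 0) (z := p ^ m) _ ?_ ?_ rfl).cons (r6.cons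
      ((RunLE.const _ _ _).cons (r7.cons (RunLE.nil _))))))))))))))))))))))).mono ?_
    · simp [set_mem, a1]
    · simp [set_mem]
    · rw [set_mem, if_neg (by omega), h2.pos]
    · simp [set_mem]
    · simp only [Op.eval]
      omega
    · simp [set_mem]
    · simp [set_mem]
    · rw [set_mem, if_neg (by omega), set_mem, if_neg (by omega), set_mem, if_neg (by omega),
        set_mem, if_neg (by omega), e2]
    · rw [set_mem, if_neg (by omega), set_mem, if_neg (by omega), set_mem, if_neg (by omega),
        set_mem, if_neg (by omega), set_mem, if_neg (by omega), set_mem, if_neg (by omega), a2]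
    · simp [set_mem]
    · simp [Op.eval]
      ring
    · simp [set_mem]
    · simp [set_mem]
    · rw [set_mem, if_neg (by omega), set_mem, if_neg (by omega), m3]
    · simp [set_mem]
    · exact b1
    · exact b2
    · have k1 : m * (1 + m + (20 + 10 * B)) ≤ B * (1 + B + (20 + 10 * B)) := by gcongr
      have k2 : N * (1 + N + (out.cost (B + cnt.bnd B) + 20 + 4 * out.bnd (B + cnt.bnd B) +
        4 * cnt.bnd B)) ≤ cnt.bnd B * (1 + cnt.bnd B + (out.cost (B + cnt.bnd B) + 20 +
        4 * out.bnd (B + cnt.bnd B) + 4 * cnt.bnd B)) := by gcongr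
      have k3 := hpow m le_rfl
      have k4 : n ≤ L + n := by omega
      rw [mainCost, ← hL]
      generalize m * (1 + m + (20 + 10 * B)) = x₁ at k1 ⊢
      generalize B * (1 + B + (20 + 10 * B)) = y₁ at k1 ⊢
      generalize N * (1 + N + (out.cost (B + cnt.bnd B) + 20 + 4 * out.bnd (B + cnt.bnd B) +
        4 * cnt.bnd B)) = x₂ at k2 ⊢
      generalize cnt.bnd B * (1 + cnt.bnd B + (out.cost (B + cnt.bnd B) + 20 +
        4 * out.bnd (B + cnt.bnd B) + 4 * cnt.bnd B)) = y₂ at k2 ⊢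
      generalize L * (1 + L + (200 + 50 * L + 5 * B)) = z
      generalize cnt.cost B = w
      generalize p ^ m = q at k3 ⊢
      have k5 : e ≤ B := heB
      have k6 : e * (n + a) ≤ L := by omega
      generalize e * (n + a) = u at k6 ⊢
      clear_value L
      clear * - k1 k2 k3 k5 k6 hpB hmB haB
      linarith [Nat.zero_le L, Nat.zero_le n, Nat.zero_le B]
  obtain ⟨t, ht, hrun⟩ := hfin
  exact ⟨t, ht, s7, hrun, o7⟩

end RAM

/-! ## Logarithmic derivatives of power series, and reverse characteristic polynomials -/

section LogDeriv

open scoped PowerSeries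

variable {R : Type*} [CommRing R]

/-- `F` has constant term `1` and `T F' = F s`. -/
structure HasLogDeriv (F s : R⟦X⟧) : Prop where
  constantCoeff : PowerSeries.constantCoeff F = 1
  deriv : PowerSeries.X * PowerSeries.derivative R F = F * s

theorem HasLogDeriv.mul {F G s t : R⟦X⟧} (hF : HasLogDeriv F s) (hG : HasLogDeriv G t) :
    HasLogDeriv (F * G) (s + t) :=
  ⟨by simp [hF.constantCoeff, hG.constantCoeff], by
    rw [Derivation.leibniz, smul_eq_mul, smul_eq_mul, mul_add]
    linear_combination F * hG.deriv + G * hF.deriv⟩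

/-- Newton's identities, read off from `T F' = F s`; the equation itself forces `s` to have constant
term zero. -/
theorem HasLogDeriv.coeff_succ {F s : R⟦X⟧} (h : HasLogDeriv F s) (k : ℕ) :
    ((k + 1 : ℕ) : R) * PowerSeries.coeff (k + 1) F =
      ∑ i ∈ Finset.range (k + 1), PowerSeries.coeff i F * PowerSeries.coeff (k + 1 - i) s := by
  have h0 : PowerSeries.coeff 0 s = 0 := by
    have := congrArg (PowerSeries.coeff 0) h.deriv
    simpa [h.constantCoeff] using this.symm
  have h1 := congrArg (PowerSeries.coeff (k + 1)) h.deriv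
  rw [PowerSeries.coeff_succ_X_mul, PowerSeries.coeff_derivative, PowerSeries.coeff_mul,
    Finset.Nat.sum_antidiagonal_eq_sum_range_succ (fun i j => PowerSeries.coeff i F * PowerSeries.coeff j s),
    Finset.sum_range_succ, Nat.sub_self, h0, mul_zero, add_zero] at h1
  rw [← h1]
  push_cast
  ring

/-- Newton's identities determine `F` recursively once the factor `k + 1` can be cancelled. This is
why determinants are compared in characteristic zero, before any reduction modulo `p ^ m`. -/
theorem HasLogDeriv.coeff_eq [IsDomain R] [CharZero R] {F G s t : R⟦X⟧} (hF : HasLogDeriv F s)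
    (hG : HasLogDeriv G t) {L : ℕ} (hst : ∀ k, 0 < k → k ≤ L → PowerSeries.coeff k s = PowerSeries.coeff k t) (k : ℕ)
    (hk : k ≤ L) : PowerSeries.coeff k F = PowerSeries.coeff k G := by
  induction k using Nat.strong_induction_on with
  | _ k ih =>
    rcases k with _ | k
    · simp [hF.constantCoeff, hG.constantCoeff]
    · have h0 : ((k + 1 : ℕ) : R) ≠ 0 := Nat.cast_ne_zero.2 (by omega)
      refine mul_left_cancel₀ h0 ?_
      rw [hF.coeff_succ, hG.coeff_succ]
      refine Finset.sum_congr rfl fun i hi => ?_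
      have := Finset.mem_range.1 hi
      rw [ih i (by omega) (by omega), hst _ (by omega) (by omega)]

variable {n : Type*} [Fintype n] [DecidableEq n]

theorem derivation_prod {S ι : Type*} [CommRing S] [Algebra R S] [DecidableEq ι]
    (d : Derivation R S S) (s : Finset ι) (f : ι → S) :
    d (∏ i ∈ s, f i) = ∑ i ∈ s, (∏ j ∈ s.erase i, f j) * d (f i) := by
  induction s using Finset.induction_on with
  | empty => simp
  | insert a s ha ih =>
    rw [Finset.prod_insert ha, Derivation.leibniz, smul_eq_mul, smul_eq_mul, ih,
      Finset.sum_insert ha, Finset.erase_insert ha, Finset.mul_sum, add_comm]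
    congr 1
    refine Finset.sum_congr rfl fun i hi => ?_
    rw [Finset.erase_insert_of_ne (by rintro rfl; exact ha hi), Finset.prod_insert
      (fun h => ha (Finset.mem_of_mem_erase h))]
    ring

/-- Jacobi's formula. -/
theorem derivation_det {S : Type*} [CommRing S] [Algebra R S] (d : Derivation R S S)
    (M : Matrix n n S) : d M.det = (M.adjugate * M.map d).trace := by
  have h (i : n) : (M.adjugate * M.map d) i i = (M.updateCol i fun j => d (M j i)).det := by
    rw [← Matrix.cramer_apply, Matrix.cramer_eq_adjugate_mulVec]
    rfl
  simp only [Matrix.trace, Matrix.diag, h]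
  rw [Matrix.det_apply', map_sum]
  simp_rw [Matrix.det_apply']
  rw [Finset.sum_comm]
  refine Finset.sum_congr rfl fun σ _ => ?_
  rw [← Finset.mul_sum, Derivation.leibniz, Derivation.map_intCast, smul_zero, add_zero,
    smul_eq_mul, derivation_prod]
  congr 1
  refine Finset.sum_congr rfl fun i _ => ?_
  rw [← Finset.mul_prod_erase _ _ (Finset.mem_univ i), Matrix.updateCol_self, mul_comm]
  congr 1
  refine Finset.prod_congr rfl fun j hj => ?_
  rw [Matrix.updateCol_ne (Finset.ne_of_mem_erase hj)]

/-- The matrix `1 - T A` of power series. -/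
noncomputable def oneSub (A : Matrix n n R) : Matrix n n R⟦X⟧ :=
  1 - A.map fun a => PowerSeries.X * PowerSeries.C a

theorem det_oneSub (A : Matrix n n R) : (oneSub A).det = (A.charpolyRev : R⟦X⟧) := by
  rw [Matrix.charpolyRev, ← Polynomial.coeToPowerSeries.ringHom_apply, RingHom.map_det]
  congr 1
  ext1 i j
  by_cases hij : i = j
  · simp [oneSub, hij]
    ring
  · simp [oneSub, hij]
    ring

/-- The power series `∑_{k ≥ 1} tr(A ^ k) T ^ k`. -/
noncomputable def traceSeries (A : Matrix n n R) : R⟦X⟧ :=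
  PowerSeries.X * PowerSeries.mk fun k => (A ^ (k + 1)).trace

theorem coeff_traceSeries (A : Matrix n n R) {k : ℕ} (hk : 0 < k) :
    PowerSeries.coeff k (traceSeries A) = (A ^ k).trace := by
  obtain ⟨k, rfl⟩ := Nat.exists_eq_succ_of_ne_zero hk.ne'
  rw [traceSeries, PowerSeries.coeff_succ_X_mul, PowerSeries.coeff_mk]

theorem constantCoeff_charpolyRev (A : Matrix n n R) :
    PowerSeries.constantCoeff (A.charpolyRev : R⟦X⟧) = 1 := by
  simp [Polynomial.coeff_zero_eq_eval_zero]

/-- The inverse of `1 - T A` is `G = ∑ A ^ k T ^ k`, so its adjugate is `det (1 - T A)` times `G`,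
and Jacobi's formula applies. No division occurs, and any commutative ring will do. -/
theorem hasLogDeriv_charpolyRev (A : Matrix n n R) :
    HasLogDeriv (A.charpolyRev : R⟦X⟧) (-traceSeries A) := by
  refine ⟨constantCoeff_charpolyRev A, ?_⟩
  set G : Matrix n n R⟦X⟧ := Matrix.of fun i j => PowerSeries.mk fun k => (A ^ k) i j with hG
  have h1 : oneSub A * G = 1 := by
    ext i j k
    rw [oneSub, sub_mul, one_mul, Matrix.sub_apply, map_sub, Matrix.mul_apply, map_sum]
    rcases k with _ | k
    · by_cases hij : i = j
      · subst hij
        simp [hG, mul_assoc]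
      · simp [hG, mul_assoc, hij]
    · simp only [hG, Matrix.of_apply, PowerSeries.coeff_mk, Matrix.map_apply, mul_assoc,
        PowerSeries.coeff_succ_X_mul, PowerSeries.coeff_C_mul, pow_succ', Matrix.mul_apply,
        Matrix.one_apply]
      rw [sub_self]
      split_ifs <;> simp [PowerSeries.coeff_one]
  have h2 : (oneSub A).adjugate = (oneSub A).det • G := by
    have := congrArg ((oneSub A).adjugate * ·) h1
    simp only [← mul_assoc, Matrix.adjugate_mul, mul_one, Matrix.smul_mul, one_mul] at this
    exact this.symm
  have h3 : (oneSub A).map (PowerSeries.derivative R) = -A.map PowerSeries.C := by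
    ext1 i j
    simp only [oneSub, Matrix.map_apply, Matrix.sub_apply, Matrix.neg_apply, map_sub,
      Derivation.leibniz, PowerSeries.derivative_C,
      PowerSeries.derivative_X, smul_eq_mul, mul_one]
    rw [Matrix.one_apply]
    split_ifs <;> simp
  rw [← det_oneSub, derivation_det, h2, h3, Matrix.smul_mul, Matrix.trace_smul, smul_eq_mul,
    mul_left_comm]
  congr 1
  rw [traceSeries, ← mul_neg]
  congr 1
  rw [mul_neg, Matrix.trace_neg]
  congr 1
  ext k
  simp [Matrix.trace, hG, Matrix.mul_apply, pow_succ]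

end LogDeriv

/-! ## A recursion for the reverse characteristic polynomial without divisions -/

section BorderedDet

open scoped PowerSeries

variable {R : Type*} [CommRing R]

/-- The leading square block of size `I`. -/
def leading (B : ℕ → ℕ → R) (I : ℕ) : Matrix (Fin I) (Fin I) R := Matrix.of fun i j => B i j

/-- The weights of the walks that start in `I` with weights `D` and then avoid `I` and the larger
indices, by their lengths and end points. -/
def walks (B : ℕ → ℕ → R) (I : ℕ) (D : ℕ → R) : ℕ → ℕ → R
  | 0 => fun _ => 0
  | k + 1 => fun x => ∑ z ∈ Finset.range I, walks B I D k z * B z x + D k * B I x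

/-- The coefficients of `det (1 - T B)` for the leading square block of size `I`, by recursion on
`I`. -/
def detCoeff (B : ℕ → ℕ → R) : ℕ → ℕ → R
  | 0 => fun k => if k = 0 then 1 else 0
  | I + 1 => fun k => detCoeff B I k - walks B I (detCoeff B I) k I

/-- Let `D` be the determinant for size `I`, and let `z` be the row vector with the series of the
walks at the indices below `I` and with `D` at `I`. The recursion for the walks says that `z (1 - T
B)`, for size `I + 1`, is the last unit vector times the series `E` of the new coefficients.
Multiplication by the adjugate, whose last diagonal entry is `D`, gives `D det (1 - T B) = E D`, and
`D` is a unit because its constant term is one. -/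
theorem coeff_charpolyRev_leading (B : ℕ → ℕ → R) (I k : ℕ) :
    (leading B I).charpolyRev.coeff k = detCoeff B I k := by
  suffices h : ∀ I, (oneSub (leading B I)).det = PowerSeries.mk (detCoeff B I) by
    rw [← Polynomial.coeff_coe, ← det_oneSub, h, PowerSeries.coeff_mk]
  clear I k
  intro I
  induction I with
  | zero =>
    ext k
    simp [detCoeff, PowerSeries.coeff_one]
  | succ I ih =>
    set D := detCoeff B I with hD
    set M := oneSub (leading B (I + 1)) with hM
    set z : Fin (I + 1) → R⟦X⟧ := Fin.lastCases (PowerSeries.mk D)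
      (fun x => PowerSeries.mk fun k => walks B I D k x) with hz
    have hzM : Matrix.vecMul z M =
        Pi.single (Fin.last I) (PowerSeries.mk (detCoeff B (I + 1))) := by
      funext x
      have e1 : Matrix.vecMul z M x = z x - PowerSeries.X *
          ∑ i, z i * PowerSeries.C (B i x) := by
        rw [hM, oneSub, Matrix.vecMul_sub, Matrix.vecMul_one, Pi.sub_apply]
        congr 1
        simp only [Matrix.vecMul, dotProduct, Matrix.map_apply, leading, Matrix.of_apply,
          Finset.mul_sum]
        exact Finset.sum_congr rfl fun i _ => by ring
      have e2 : PowerSeries.X * ∑ i, z i * PowerSeries.C (B i x) =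
          PowerSeries.mk fun k => walks B I D k x := by
        ext k
        rcases k with _ | k
        · simp [walks]
        · rw [PowerSeries.coeff_succ_X_mul, map_sum, Fin.sum_univ_castSucc, PowerSeries.coeff_mk,
            walks]
          beta_reduce
          rw [← Fin.sum_univ_eq_sum_range (fun z => walks B I D k z * B z x)]
          simp [hz]
      rw [e1, e2]
      refine Fin.lastCases ?_ (fun x => ?_) x
      · ext k
        simp [hz, detCoeff, hD]
      · simp [hz]
    have h1 := congrArg (fun v => Matrix.vecMul v M.adjugate (Fin.last I)) hzM
    have h2 : M.submatrix (Fin.last I).succAbove (Fin.last I).succAbove =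
        oneSub (leading B I) := by
      ext1 i j
      simp [hM, oneSub, leading, Matrix.one_apply]
    simp only [Matrix.vecMul_vecMul, Matrix.mul_adjugate, Matrix.single_vecMul, Matrix.row,
      Matrix.vecMul_smul, Matrix.vecMul_one, Pi.smul_apply, smul_eq_mul,
      Matrix.adjugate_fin_succ_eq_det_submatrix, h2, ih] at h1
    have hu : IsUnit (PowerSeries.mk D) := by
      rw [PowerSeries.isUnit_iff_constantCoeff, ← ih, det_oneSub, constantCoeff_charpolyRev]
      exact isUnit_one
    refine hu.mul_right_cancel ?_
    -- The sign of the corner cofactor is `(-1) ^ (2 I) = 1`.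
    simpa [hz, ← two_mul, pow_mul] using h1

end BorderedDet

/-! ## Dwork's trace formula for polynomials on a torus over a finite field -/

section Dwork

open MvPolynomial

variable {r : ℕ}

/-- A vector of small numbers as an exponent vector. -/
noncomputable def toExp {V : ℕ} (u : Fin r → Fin V) : Fin r →₀ ℕ :=
  Finsupp.equivFunOnFinite.symm fun l => (u l : ℕ)

@[simp] theorem toExp_apply {V : ℕ} (u : Fin r → Fin V) (l : Fin r) : toExp u l = u l := rfl

theorem toExp_injective {V : ℕ} : Function.Injective (toExp : (Fin r → Fin V) → Fin r →₀ ℕ) := by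
  intro u v h
  funext l
  exact Fin.ext (by simpa using DFunLike.congr_fun h l)

/-- The matrix, on the monomials with exponents less than `V`, of the multiplication by `φ`,
followed by the operator that maps `x ^ (p u)` to `x ^ u` and the other monomials to zero. -/
noncomputable def dworkMatrix (p V : ℕ) (φ : MvPolynomial (Fin r) ℤ) :
    Matrix (Fin r → Fin V) (Fin r → Fin V) ℤ :=
  Matrix.of fun u v => MvPolynomial.coeff (p • toExp u) (monomial (toExp v) 1 * φ)

/-- The product of `φ(x ^ (p ^ i))` for `i < k`. -/
noncomputable def frobProd (p : ℕ) (φ : MvPolynomial (Fin r) ℤ) : ℕ → MvPolynomial (Fin r) ℤ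
  | 0 => 1
  | k + 1 => φ * expand p (frobProd p φ k)

theorem aeval_frobProd {R : Type*} [CommRing R] (p : ℕ) (φ : MvPolynomial (Fin r) ℤ) (k : ℕ)
    (y : Fin r → R) :
    aeval y (frobProd p φ k) = ∏ i ∈ Finset.range k, aeval (y ^ p ^ i) φ := by
  induction k generalizing y with
  | zero => simp [frobProd]
  | succ k ih =>
    rw [frobProd, map_mul, aeval_expand, ih, Finset.prod_range_succ', mul_comm]
    congr 1
    · refine Finset.prod_congr rfl fun i _ => ?_
      rw [← pow_mul, pow_succ']
    · simp

/-- With `ψ` the operator `x ^ (p u) ↦ x ^ u`, this is `ψ(g h(x ^ p)) = ψ(g) h`. The set `S` only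
has to contain the exponents of `ψ(g)`. -/
theorem coeff_mul_expand {p : ℕ} (hp : 0 < p) (g h : MvPolynomial (Fin r) ℤ) (z : Fin r →₀ ℕ)
    (S : Finset (Fin r →₀ ℕ)) (hS : ∀ w, MvPolynomial.coeff (p • w) g ≠ 0 → w ∈ S) :
    MvPolynomial.coeff (p • z) (g * expand p h) =
      ∑ w ∈ S, MvPolynomial.coeff (p • w) g * MvPolynomial.coeff z (monomial w 1 * h) := by
  induction h using MvPolynomial.induction_on' with
  | add h₁ h₂ ih₁ ih₂ =>
    simp only [map_add, mul_add, MvPolynomial.coeff_add, ih₁, ih₂, Finset.sum_add_distrib]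
  | monomial b c =>
    simp only [MvPolynomial.expand_monomial, coeff_mul_monomial', monomial_mul, one_mul,
      MvPolynomial.coeff_monomial]
    have hle : p • b ≤ p • z ↔ b ≤ z := by
      simp only [Finsupp.le_def, Finsupp.smul_apply, smul_eq_mul]
      exact forall_congr' fun i => Nat.mul_le_mul_left_iff hp
    by_cases hb : b ≤ z
    · have hsub : p • z - p • b = p • (z - b) := by
        ext l
        simp [Nat.mul_sub]
      rw [if_pos (hle.2 hb), hsub]
      have hiff : ∀ w, w + b = z ↔ w = z - b := fun w => (eq_tsub_iff_add_eq_of_le hb).symm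
      simp only [hiff, mul_ite, mul_zero]
      rw [Finset.sum_ite_eq']
      split_ifs with hm
      · rfl
      · rw [not_imp_comm.1 (hS _) hm, zero_mul]
    · rw [if_neg (mt hle.1 hb)]
      refine (Finset.sum_eq_zero fun w _ => ?_).symm
      rw [if_neg, mul_zero]
      rintro rfl
      exact hb le_add_self

theorem mem_image_toExp {V : ℕ} {w : Fin r →₀ ℕ} (h : ∀ l, w l < V) :
    w ∈ Finset.univ.image (toExp : (Fin r → Fin V) → Fin r →₀ ℕ) := by
  refine Finset.mem_image.2 ⟨fun l => ⟨w l, h l⟩, Finset.mem_univ _, ?_⟩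
  ext l
  rfl

/-- Moving `ψ` past the multiplications turns `(ψ ∘ φ) ^ k` into `ψ ^ k` after a single
multiplication. The box of monomials is stable: if `p w` is the sum of two vectors with entries
below `V`, then the entries of `w` are below `V`, as `p ≥ 2`. -/
theorem dworkMatrix_pow {p V : ℕ} (hp : 2 ≤ p) {φ : MvPolynomial (Fin r) ℤ}
    (hφ : ∀ w ∈ φ.support, ∀ l, w l < V) (k : ℕ) (u v : Fin r → Fin V) :
    (dworkMatrix p V φ ^ k) u v =
      MvPolynomial.coeff (p ^ k • toExp u) (monomial (toExp v) 1 * frobProd p φ k) := by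
  induction k generalizing u v with
  | zero =>
    rw [pow_zero, Matrix.one_apply, frobProd, mul_one, MvPolynomial.coeff_monomial, pow_zero,
      one_smul]
    simp only [toExp_injective.eq_iff, eq_comm]
  | succ k ih =>
    rw [pow_succ, Matrix.mul_apply, frobProd, ← mul_assoc, pow_succ', mul_smul,
      coeff_mul_expand (by omega) _ _ _ _ (fun w hw => mem_image_toExp (V := V) fun l => ?_),
      Finset.sum_image toExp_injective.injOn]
    · refine Finset.sum_congr rfl fun w _ => ?_
      rw [ih, mul_comm]
      rfl
    · rw [MvPolynomial.coeff_monomial_mul'] at hw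
      split_ifs at hw with hle
      · rw [one_mul] at hw
        have h1 := hφ _ (MvPolynomial.mem_support_iff.2 hw) l
        have h2 := (v l).2
        simp only [Finsupp.coe_tsub, Finsupp.coe_smul, Pi.sub_apply, Pi.smul_apply, toExp_apply,
          smul_eq_mul] at h1
        by_contra hV
        have : 2 * w l ≤ p * w l := Nat.mul_le_mul_right _ hp
        omega
      · exact absurd rfl hw

/-- The exponents are at most `V (1 + p + … + p ^ (k - 1))`; the weaker bound has the shape needed
for sums over the roots of unity of order `p ^ k - 1`. -/
theorem support_frobProd {p V : ℕ} (hp : 2 ≤ p) {φ : MvPolynomial (Fin r) ℤ}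
    (hφ : ∀ w ∈ φ.support, ∀ l, w l ≤ V) (k : ℕ) :
    ∀ w ∈ (frobProd p φ k).support, ∀ l, w l ≤ V * (p ^ k - 1) := by
  induction k with
  | zero =>
    intro w hw l
    have hw' := MvPolynomial.mem_support_iff.1 hw
    rw [frobProd, MvPolynomial.coeff_one] at hw'
    have : (0 : Fin r →₀ ℕ) = w := by by_contra h; exact hw' (if_neg h)
    simp [← this]
  | succ k ih =>
    intro w hw l
    obtain ⟨a, ha, b, hb, rfl⟩ := Finset.mem_add.1 (MvPolynomial.support_mul _ _ hw)
    obtain ⟨c, hc, rfl⟩ := Finset.mem_image.1 (support_expand_subset _ hb)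
    have h1 := hφ a ha l
    have h2 := ih c hc l
    have h3 : 1 ≤ p ^ k := Nat.one_le_pow _ _ (by omega)
    obtain ⟨q, hq⟩ := Nat.exists_eq_add_of_le h3
    have h5 : p ^ (k + 1) - 1 = p * q + (p - 1) := by
      rw [pow_succ', hq, mul_add]
      omega
    rw [hq, Nat.add_sub_cancel_left] at h2
    rw [h5, Finsupp.add_apply, Finsupp.smul_apply, smul_eq_mul]
    calc a l + p * c l ≤ V * 1 + p * (V * q) := by gcongr; omega
      _ ≤ V * (p - 1) + p * (V * q) := by gcongr; omega
      _ = V * (p * q + (p - 1)) := by ring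

theorem trace_dworkMatrix_pow {p V : ℕ} (hp : 2 ≤ p) {φ : MvPolynomial (Fin r) ℤ}
    (hφ : ∀ w ∈ φ.support, ∀ l, w l < V) (k : ℕ) :
    (dworkMatrix p V φ ^ k).trace =
      ∑ u : Fin r → Fin V, MvPolynomial.coeff ((p ^ k - 1) • toExp u) (frobProd p φ k) := by
  rw [Matrix.trace]
  refine Finset.sum_congr rfl fun u _ => ?_
  have h3 : 1 ≤ p ^ k := Nat.one_le_pow _ _ (by omega)
  have h4 : p ^ k • toExp u = toExp u + (p ^ k - 1) • toExp u := by
    conv_lhs => rw [← Nat.add_sub_cancel' h3, add_smul, one_smul]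
  rw [Matrix.diag_apply, dworkMatrix_pow hp hφ, h4, MvPolynomial.coeff_monomial_mul, one_mul]

/-- Character sums over roots of unity. -/
theorem sum_rootsOfUnity_pow {F R : Type*} [Field F] [Finite F] [CommRing R] [IsDomain R]
    (τ : Fˣ →* R) (hτ : Function.Injective τ) {m : ℕ} (hm : m ≠ 0) (hdvd : m ∣ Nat.card Fˣ)
    (S : Finset Fˣ) (hS : ∀ x, x ∈ S ↔ x ^ m = 1) (w : ℕ) :
    ∑ x ∈ S, τ x ^ w = if m ∣ w then (m : R) else 0 := by
  classical
  have : NeZero m := ⟨hm⟩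
  have : Fintype F := Fintype.ofFinite F
  obtain ⟨g, hg⟩ := IsCyclic.exists_ofOrder_eq_natCard (α := Fˣ)
  obtain ⟨s, hs⟩ := hdvd
  have hprim : IsPrimitiveRoot (g ^ s) m := by
    have h1 : IsPrimitiveRoot g (Nat.card Fˣ) := hg ▸ IsPrimitiveRoot.orderOf g
    exact h1.pow Nat.card_pos (by rw [hs, mul_comm])
  have hcard : Nat.card (rootsOfUnity m F) = m :=
    (IsPrimitiveRoot.coe_units_iff.2 hprim).card_rootsOfUnity
  let f : rootsOfUnity m F →* R :=
    ((powMonoidHom w).comp τ).comp (rootsOfUnity m F).subtype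
  have hf : f = 1 ↔ m ∣ w := by
    constructor
    · intro h
      have h1 := DFunLike.congr_fun h ⟨g ^ s, (mem_rootsOfUnity m _).2 hprim.pow_eq_one⟩
      have h2 : τ ((g ^ s) ^ w) = τ 1 := by simpa [f] using h1
      exact hprim.dvd_of_pow_eq_one _ (hτ h2)
    · rintro ⟨c, rfl⟩
      ext ⟨x, hx⟩
      have hx' := (mem_rootsOfUnity m _).1 hx
      simp [f, ← map_pow, pow_mul, hx']
  have hsum := sum_hom_units f
  rw [← Nat.card_eq_fintype_card, hcard] at hsum
  have e : ∑ x ∈ S, τ x ^ w = ∑ x, f x := by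
    refine Finset.sum_bij' (fun x hx => ⟨x, (mem_rootsOfUnity m _).2 ((hS x).1 hx)⟩)
      (fun x _ => x.1) ?_ ?_ ?_ ?_ ?_
    · simp
    · intro x _
      exact (hS _).2 ((mem_rootsOfUnity m _).1 x.2)
    · simp
    · simp
    · intro x _
      rfl
  rw [e, hsum]
  simp [hf]

/-- By orthogonality of characters only the exponent vectors divisible by `m` survive, each with the
factor `m ^ r`. By `hh` they are `m u` with `u` in the box; for `m = p ^ k - 1` this is the sum in
`trace_dworkMatrix_pow`. -/
theorem sum_torus_aeval {F R : Type*} [Field F] [Finite F] [CommRing R] [IsDomain R]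
    (τ : Fˣ →* R) (hτ : Function.Injective τ) {m V : ℕ} (hm : m ≠ 0) (hdvd : m ∣ Nat.card Fˣ)
    (S : Finset Fˣ) (hS : ∀ x, x ∈ S ↔ x ^ m = 1) (h : MvPolynomial (Fin r) ℤ)
    (hh : ∀ w ∈ h.support, ∀ l, w l < V * m) :
    ∑ x ∈ Fintype.piFinset (fun _ : Fin r => S), aeval (fun l => τ (x l)) h =
      (m : R) ^ r * ((∑ u : Fin r → Fin V, MvPolynomial.coeff (m • toExp u) h : ℤ) : R) := by
  classical
  have h1 (w : Fin r →₀ ℕ) : ∑ x ∈ Fintype.piFinset (fun _ : Fin r => S), ∏ l, τ (x l) ^ w l =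
      if ∀ l, m ∣ w l then (m : R) ^ r else 0 := by
    rw [← Finset.prod_univ_sum (fun _ => S) (fun l x => τ x ^ w l)]
    simp only [sum_rootsOfUnity_pow τ hτ hm hdvd S hS]
    rw [Finset.prod_ite_zero]
    simp
  simp only [MvPolynomial.aeval_def, eval₂_eq', algebraMap_int_eq, eq_intCast]
  rw [Finset.sum_comm]
  simp only [← Finset.mul_sum, h1, mul_ite, mul_zero]
  rw [← Finset.sum_filter]
  push_cast
  rw [Finset.mul_sum]
  have hinj : Function.Injective fun u : Fin r → Fin V => m • toExp u := by
    intro u v huv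
    refine toExp_injective (Finsupp.ext fun l => ?_)
    have := DFunLike.congr_fun huv l
    simpa [hm] using this
  have hsub : (h.support.filter fun w => ∀ l, m ∣ w l) ⊆
      Finset.univ.image fun u : Fin r → Fin V => m • toExp u := by
    intro w hw
    obtain ⟨hw1, hw2⟩ := Finset.mem_filter.1 hw
    choose c hc using hw2
    refine Finset.mem_image.2 ⟨fun l => ⟨c l, ?_⟩, Finset.mem_univ _, ?_⟩
    · have := hh w hw1 l
      rw [hc l, mul_comm V] at this
      exact Nat.lt_of_mul_lt_mul_left this
    · ext l
      simp [hc l]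
  rw [Finset.sum_subset hsub, Finset.sum_image hinj.injOn]
  · exact Finset.sum_congr rfl fun u _ => mul_comm _ _
  · intro w hw hw'
    obtain ⟨u, _, rfl⟩ := Finset.mem_image.1 hw
    have : MvPolynomial.coeff (m • toExp u) h = 0 := by
      by_contra hne
      exact hw' (Finset.mem_filter.2 ⟨MvPolynomial.mem_support_iff.2 hne, fun l => by simp⟩)
    rw [this]
    simp

end Dwork

/-! ## Weighted permutation matrices -/

section PermMatrix

variable {Ω S : Type*} [Fintype Ω] [DecidableEq Ω] [CommRing S]

/-- The matrix of the self-map `σ` of a finite set, with weights `w`. -/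
def weightedMap (σ : Ω → Ω) (w : Ω → S) : Matrix Ω Ω S :=
  Matrix.of fun x y => if y = σ x then w x else 0

theorem weightedMap_pow (σ : Ω → Ω) (w : Ω → S) (k : ℕ) (x y : Ω) :
    (weightedMap σ w ^ k) x y =
      if y = σ^[k] x then ∏ i ∈ Finset.range k, w (σ^[i] x) else 0 := by
  induction k generalizing x with
  | zero =>
    by_cases h : y = x
    · simp [h]
    · simp [h, Ne.symm h]
  | succ k ih =>
    rw [pow_succ', Matrix.mul_apply]
    simp only [weightedMap, Matrix.of_apply, ite_mul, zero_mul, Finset.sum_ite_eq',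
      Finset.mem_univ, if_true]
    have := ih (σ x)
    rw [weightedMap] at this
    rw [this, Finset.prod_range_succ']
    by_cases h : y = σ^[k] (σ x)
    · rw [if_pos h, if_pos (by exact h), mul_comm]
      rfl
    · rw [if_neg h, if_neg (by exact h), mul_zero]

theorem trace_weightedMap_pow (σ : Ω → Ω) (w : Ω → S) (k : ℕ) :
    (weightedMap σ w ^ k).trace =
      ∑ x with σ^[k] x = x, ∏ i ∈ Finset.range k, w (σ^[i] x) := by
  rw [Matrix.trace, Finset.sum_filter]
  refine Finset.sum_congr rfl fun x _ => ?_
  simp only [Matrix.diag_apply, weightedMap_pow, eq_comm]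

/-- If the weights are, up to a coboundary, the characteristic function of a stable subset, then the
reverse characteristic polynomial does not see the weights. -/
theorem charpolyRev_weightedMap (σ : Ω → Ω) (w : Ω → S) (U : Ω → Prop) [DecidablePred U]
    (d : Ω → Sˣ) (h1 : ∀ x, U x → d x * w x = d (σ x))
    (h0 : ∀ x, ¬ U x → w x = 0) :
    (weightedMap σ w).charpolyRev =
      (weightedMap σ fun x => if U x then (1 : S) else 0).charpolyRev := by
  -- Conjugation by the diagonal matrix of the units `d` turns one matrix into the other.
  set D : Matrix Ω Ω S[X] := Matrix.diagonal fun x => C (d x : S) with hD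
  have hdet : IsUnit D.det := by
    rw [hD, Matrix.det_diagonal]
    exact (IsUnit.prod_iff).2 fun x _ => (d x).isUnit.map C
  refine hdet.mul_left_cancel ?_
  rw [Matrix.charpolyRev, Matrix.charpolyRev, ← Matrix.det_mul, mul_comm D.det, ← Matrix.det_mul]
  congr 1
  rw [mul_sub, sub_mul, mul_one, one_mul]
  congr 1
  ext1 x y
  simp only [hD, Matrix.diagonal_mul, Matrix.mul_diagonal, Matrix.smul_apply, Matrix.map_apply,
    weightedMap, Matrix.of_apply, smul_eq_mul]
  by_cases hy : y = σ x
  · subst hy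
    by_cases hx : U x
    · simp only [if_true, if_pos hx, ← h1 x hx, map_mul, map_one]
      ring
    · simp [hx, h0 x hx]
  · simp [hy]

end PermMatrix

/-! ### Traces and reverse characteristic polynomials under ring homomorphisms -/

section Maps

variable {n S T : Type*} [Fintype n] [DecidableEq n] [CommRing S] [CommRing T]

theorem charpolyRev_map (f : S →+* T) (A : Matrix n n S) :
    (A.map f).charpolyRev = A.charpolyRev.map f := by
  rw [Matrix.charpolyRev, Matrix.charpolyRev, ← Polynomial.coe_mapRingHom, RingHom.map_det]
  congr 1
  ext1 i j
  by_cases hij : i = j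
  · subst hij; simp
  · simp [hij]

theorem trace_map_pow (f : S →+* T) (A : Matrix n n S) (k : ℕ) :
    ((A.map f) ^ k).trace = f (A ^ k).trace := by
  have : (A.map f) ^ k = (A ^ k).map f := (map_pow f.mapMatrix A k).symm
  rw [this, Matrix.trace, Matrix.trace, map_sum]
  rfl

end Maps

/-! ## Witt vectors over a finite field -/

section Witt

open MvPolynomial

variable {p : ℕ} [hp : Fact p.Prime] {F : Type*} [Field F] [Finite F] [CharP F p]

theorem witt_dvd_iff (x : WittVector p F) : (p : WittVector p F) ∣ x ↔ x.coeff 0 = 0 := by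
  rw [← WittVector.mem_span_p_iff_coeff_zero_eq_zero, Ideal.mem_span_singleton]

theorem witt_intCast_coeff_zero (z : ℤ) : (z : WittVector p F).coeff 0 = z :=
  map_intCast (WittVector.constantCoeff : WittVector p F →+* F) z

/-- Because the zeroth component detects divisibility by `p`, and `p` can be cancelled, congruences
between integers can be tested in the Witt vectors without loss. -/
theorem witt_pow_dvd_intCast (m : ℕ) (z : ℤ) :
    (p ^ m : WittVector p F) ∣ z ↔ (p ^ m : ℤ) ∣ z := by
  constructor
  · induction m generalizing z with
    | zero => simp
    | succ m ih =>
      intro h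
      have h1 : (p : WittVector p F) ∣ z := (dvd_pow_self _ m.succ_ne_zero).trans h
      rw [witt_dvd_iff, witt_intCast_coeff_zero, CharP.intCast_eq_zero_iff F p] at h1
      obtain ⟨y, rfl⟩ := h1
      rw [pow_succ']
      refine mul_dvd_mul_left _ (ih y ?_)
      rw [pow_succ'] at h
      push_cast at h
      exact (mul_dvd_mul_iff_left (WittVector.p_nonzero p F)).1 h
  · rintro ⟨y, rfl⟩
    push_cast
    exact dvd_mul_right _ _

theorem witt_charZero : CharZero (WittVector p F) := by
  refine charZero_of_inj_zero fun n hn => ?_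
  have h (m : ℕ) : (p ^ m : ℤ) ∣ (n : ℤ) := by
    rw [← witt_pow_dvd_intCast (p := p) (F := F), Int.cast_natCast, hn]
    exact dvd_zero _
  by_contra hne
  have := Int.le_of_dvd (by omega) (h n)
  have h2 : n < p ^ n := Nat.lt_pow_self hp.out.one_lt
  have h3 : ((p : ℤ) ^ n) = ((p ^ n : ℕ) : ℤ) := by push_cast; rfl
  omega

theorem teichmuller_injective' :
    Function.Injective (WittVector.teichmuller p : F →* WittVector p F) := fun x y h => by
  simpa using congrArg (fun z => z.coeff 0) h

variable {r : ℕ}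

/-- A polynomial at Teichmüller points and the Teichmüller representative of its value are congruent
modulo `p`, and high powers of them are congruent modulo high powers of `p`. -/
theorem pow_aeval_teichmuller (m : ℕ) (G : MvPolynomial (Fin r) ℤ) (x : Fin r → F) :
    (p ^ m : WittVector p F) ∣ aeval (fun l => WittVector.teichmuller p (x l)) G ^ p ^ m -
      WittVector.teichmuller p (aeval x G) ^ p ^ m := by
  -- Elements congruent modulo `p` have `p ^ m`-th powers congruent modulo `p ^ (m + 1)`.
  refine (pow_dvd_pow _ m.le_succ).trans (dvd_sub_pow_of_dvd_sub ?_ m)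
  rw [witt_dvd_iff]
  have h1 (z : WittVector p F) : z.coeff 0 =
      (WittVector.constantCoeff : WittVector p F →+* F).toIntAlgHom z := rfl
  rw [h1, map_sub, sub_eq_zero, MvPolynomial.comp_aeval_apply, ← h1]
  simp only [← h1, WittVector.teichmuller_coeff_zero]

theorem aeval_pow_char (G : MvPolynomial (Fin r) ℤ) (x : Fin r → F) :
    aeval (fun l => x l ^ p) G = (aeval x G) ^ p := by
  have := MvPolynomial.comp_aeval_apply x (frobenius F p).toIntAlgHom G
  exact this.symm

/-- The weights of the points of the torus with values in `F` that belong to a polynomial. -/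
noncomputable def torusWeight (p : ℕ) [Fact p.Prime] (F : Type*) [Field F]
    (φ : MvPolynomial (Fin r) ℤ) (x : Fin r → Fˣ) : WittVector p F :=
  aeval (fun l => WittVector.teichmuller p (x l : F)) φ

/-- The Frobenius map on the points of the torus with values in `F`. -/
def torusFrob (p : ℕ) (F : Type*) [Field F] (x : Fin r → Fˣ) : Fin r → Fˣ := fun l => x l ^ p

theorem torusFrob_iterate (x : Fin r → Fˣ) (k : ℕ) :
    (torusFrob p F)^[k] x = fun l => x l ^ p ^ k := by
  induction k with
  | zero => simp
  | succ k ih =>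
    rw [Function.iterate_succ_apply', ih]
    funext l
    rw [torusFrob, ← pow_mul, pow_succ]

theorem pow_eq_self_iff {G : Type*} [Group G] (x : G) {a : ℕ} (ha : 0 < a) :
    x ^ a = x ↔ x ^ (a - 1) = 1 := by
  obtain ⟨b, rfl⟩ := Nat.exists_eq_succ_of_ne_zero ha.ne'
  simp [pow_succ]

variable [Fintype (Fin r → Fˣ)] [DecidableEq (Fin r → Fˣ)]

/-- The trace formula. -/
theorem trace_torusWeight {V k : ℕ} {φ : MvPolynomial (Fin r) ℤ}
    (hφ : ∀ w ∈ φ.support, ∀ l, w l < V) (hk : 0 < k) (hdvd : p ^ k - 1 ∣ Nat.card Fˣ) :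
    (weightedMap (torusFrob p F) (torusWeight p F φ) ^ k).trace =
      ((p ^ k - 1 : ℕ) : WittVector p F) ^ r * ((dworkMatrix p V φ ^ k).trace : ℤ) := by
  classical
  have : Fintype Fˣ := Fintype.ofFinite _
  have hpk : 1 < p ^ k := Nat.one_lt_pow hk.ne' hp.out.one_lt
  have hW : ∀ w ∈ (frobProd p φ k).support, ∀ l, w l < V * (p ^ k - 1) := by
    intro w hw l
    have h1 : ∀ w ∈ φ.support, ∀ l, w l ≤ V - 1 := fun w hw l => by
      have := hφ w hw l
      omega
    have h2 := support_frobProd hp.out.two_le h1 k w hw l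
    -- If `V = 0`, the existence of a coordinate `l` forces `φ = 0`, and then the product of `k > 0`
    -- factors has empty support.
    rcases Nat.eq_zero_or_pos V with rfl | hV
    · exfalso
      have h3 : ∀ w ∈ φ.support, False := fun w hw => by
        have := hφ w hw l
        omega
      have h4 : φ = 0 := by
        rw [← MvPolynomial.support_eq_empty]
        exact Finset.eq_empty_of_forall_notMem h3
      obtain ⟨k, rfl⟩ := Nat.exists_eq_succ_of_ne_zero hk.ne'
      rw [frobProd, h4, zero_mul] at hw
      simp at hw
    · refine h2.trans_lt ?_
      exact Nat.mul_lt_mul_of_pos_right (by omega) (by omega)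
  set τ : Fˣ →* WittVector p F := (WittVector.teichmuller p).comp (Units.coeHom F) with hτ
  have hinj : Function.Injective τ := fun x y h => Units.ext (teichmuller_injective' h)
  have key := sum_torus_aeval τ hinj (m := p ^ k - 1) (V := V) (by omega) hdvd
    (Finset.univ.filter fun x => x ^ (p ^ k - 1) = 1) (by simp) (frobProd p φ k) hW
  rw [trace_dworkMatrix_pow hp.out.two_le hφ, ← key, trace_weightedMap_pow]
  refine Finset.sum_congr ?_ fun x _ => ?_
  · ext x
    simp only [Finset.mem_filter, Finset.mem_univ, true_and, torusFrob_iterate,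
      Fintype.mem_piFinset]
    rw [funext_iff]
    exact forall_congr' fun l => pow_eq_self_iff (x l) (by omega)
  · rw [aeval_frobProd]
    refine Finset.prod_congr rfl fun i _ => ?_
    rw [torusFrob_iterate, torusWeight]
    congr 2
    funext l
    simp [hτ]

/-- Modulo `p ^ m`, the weights that belong to the power of a polynomial with exponent
`(p - 1) p ^ m` are, up to a coboundary, the characteristic function of the points where it does not
vanish. -/
theorem charpolyRev_torusWeight (m : ℕ) (G : MvPolynomial (Fin r) ℤ)
    [DecidablePred fun x : Fin r → Fˣ => aeval (fun l => (x l : F)) G ≠ 0] :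
    (weightedMap (torusFrob p F) (torusWeight p F (G ^ ((p - 1) * p ^ m)))).charpolyRev.map
      (Ideal.Quotient.mk (Ideal.span {(p ^ m : WittVector p F)})) =
    (weightedMap (torusFrob p F) fun x : Fin r → Fˣ =>
      if aeval (fun l => (x l : F)) G ≠ 0 then (1 : ℤ) else 0).charpolyRev.map
        (Int.castRingHom (WittVector p F ⧸ Ideal.span {(p ^ m : WittVector p F)})) := by
  set Q := WittVector p F ⧸ Ideal.span {(p ^ m : WittVector p F)} with hQ
  set π : WittVector p F →+* Q := Ideal.Quotient.mk (Ideal.span {(p ^ m : WittVector p F)})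
  have hpr := hp.out.two_le
  rw [← charpolyRev_map, ← charpolyRev_map]
  have e1 : (weightedMap (torusFrob p F) (torusWeight p F (G ^ ((p - 1) * p ^ m)))).map π =
      weightedMap (torusFrob p F) fun x => π (torusWeight p F (G ^ ((p - 1) * p ^ m)) x) := by
    ext1 x y
    simp only [weightedMap, Matrix.map_apply, Matrix.of_apply]
    split_ifs <;> simp
  have e2 : (weightedMap (torusFrob p F) fun x : Fin r → Fˣ =>
      if aeval (fun l => (x l : F)) G ≠ 0 then (1 : ℤ) else 0).map (Int.castRingHom Q) =
      weightedMap (torusFrob p F) fun x =>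
        if aeval (fun l => (x l : F)) G ≠ 0 then (1 : Q) else 0 := by
    ext1 x y
    simp only [weightedMap, Matrix.map_apply, Matrix.of_apply]
    split_ifs <;> simp
  rw [e1, e2]
  set y : F → Q := fun z => π (WittVector.teichmuller p z ^ p ^ m) with hy
  have hyU (z : F) (hz : z ≠ 0) : IsUnit (y z) := by
    refine IsUnit.map π (IsUnit.pow _ ?_)
    exact (IsUnit.mk0 z hz).map (WittVector.teichmuller p)
  have hw (x : Fin r → Fˣ) : π (torusWeight p F (G ^ ((p - 1) * p ^ m)) x) =
      y (aeval (fun l => (x l : F)) G) ^ (p - 1) := by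
    rw [torusWeight, map_pow, mul_comm, pow_mul, map_pow]
    congr 1
    exact Ideal.Quotient.eq.2 (Ideal.mem_span_singleton.2 (pow_aeval_teichmuller m G _))
  have hfrob (x : Fin r → Fˣ) : aeval (fun l => (torusFrob p F x l : F)) G =
      aeval (fun l => (x l : F)) G ^ p := by
    rw [← aeval_pow_char]
    simp [torusFrob]
  classical
  -- The coboundary is that of `d(x) = y(G(x))`: the weight is `y(G(x)) ^ (p - 1)`, and `y(G(x)) ^
  -- p` is the value of `d` at the Frobenius image of `x`.
  refine charpolyRev_weightedMap (torusFrob p F) _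
    (fun x => aeval (fun l => (x l : F)) G ≠ 0)
    (fun x => if h : aeval (fun l => (x l : F)) G ≠ 0 then (hyU _ h).unit else 1)
    (fun x hx => ?_) (fun x hx => ?_)
  · have hx' : aeval (fun l => (torusFrob p F x l : F)) G ≠ 0 := by
      rw [hfrob]
      exact pow_ne_zero _ hx
    rw [dif_pos hx, dif_pos hx', hw, IsUnit.unit_spec, IsUnit.unit_spec, hfrob, ← pow_succ',
      Nat.sub_add_cancel (by omega)]
    simp only [hy, map_pow]
    rw [← pow_mul, ← pow_mul, mul_comm]
  · push Not at hx
    rw [hw, hx]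
    simp only [hy, WittVector.teichmuller_zero]
    rw [zero_pow (pow_ne_zero _ (by omega)), map_zero, zero_pow (by omega)]

end Witt

/-! ## The congruence for the zeta function -/

/-! ### Subsets coded by binary digits -/

section BinaryDigits

/-- The sum of the `r` lowest binary digits. -/
def digitSum : ℕ → ℕ → ℕ
  | 0 => fun _ => 0
  | r + 1 => fun S => S % 2 + digitSum r (S / 2)

theorem digitSum_le (r S : ℕ) : digitSum r S ≤ r := by
  induction r generalizing S with
  | zero => simp [digitSum]
  | succ r ih =>
    have := ih (S / 2)
    simp only [digitSum]
    omega

theorem sum_range_two_mul {M : Type*} [AddCommMonoid M] (f : ℕ → M) (s : ℕ) :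
    ∑ i ∈ Finset.range (2 * s), f i = ∑ i ∈ Finset.range s, (f (2 * i) + f (2 * i + 1)) := by
  induction s with
  | zero => simp
  | succ s ih =>
    rw [mul_add, mul_one, Finset.sum_range_succ, Finset.sum_range_succ, ih, Finset.sum_range_succ,
      add_assoc]

/-- The product of `r` factors `x - 1` is expanded over subsets, coded by binary digits. At `x = p ^
k` each summand is up to sign a `k`-th power, and can be absorbed as a scalar into a matrix whose
`k`-th power is taken. -/
theorem sum_neg_one_pow_digitSum {R : Type*} [CommRing R] (x : R) (r : ℕ) :
    ∑ S ∈ Finset.range (2 ^ r), (-1) ^ digitSum r S * x ^ (r - digitSum r S) = (x - 1) ^ r := by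
  induction r with
  | zero => simp [digitSum]
  | succ r ih =>
    rw [pow_succ', sum_range_two_mul, pow_succ', ← ih, Finset.mul_sum]
    refine Finset.sum_congr rfl fun S _ => ?_
    have h1 := digitSum_le r S
    have h2 : (2 * S + 1) / 2 = S := by omega
    have h3 : 2 * S / 2 = S := by omega
    have h4 : (2 * S + 1) % 2 = 1 := by omega
    have h5 : 2 * S % 2 = 0 := by omega
    simp only [digitSum, h2, h3, h4, h5, zero_add]
    rw [show r + 1 - (1 + digitSum r S) = r - digitSum r S by omega,
      show r + 1 - digitSum r S = (r - digitSum r S) + 1 by omega]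
    ring

end BinaryDigits

/-! ### Determinants of Dwork matrices and Frobenius permutations -/

section Congruence

open scoped PowerSeries

theorem isUnit_of_constantCoeff_eq_one {R : Type*} [CommRing R] {F : R⟦X⟧}
    (h : PowerSeries.constantCoeff F = 1) : IsUnit F := by
  rw [PowerSeries.isUnit_iff_constantCoeff, h]
  exact isUnit_one

theorem X_pow_dvd_sub_iff {R : Type*} [CommRing R] {F G : R⟦X⟧} {L : ℕ} :
    PowerSeries.X ^ (L + 1) ∣ F - G ↔
      ∀ k ≤ L, PowerSeries.coeff k F = PowerSeries.coeff k G := by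
  rw [PowerSeries.X_pow_dvd_iff]
  refine forall_congr' fun k => ?_
  rw [map_sub, sub_eq_zero, Nat.lt_succ_iff]

/-- The weight of the block with number `S` that belongs to the product of some of the two
polynomials, in the matrix with sign `z`. -/
def blockWeight (p r z : ℕ) (t : ℕ × ℕ) : ℕ :=
  if (t.1 % 2 + t.1 / 2 + digitSum r t.2) % 2 = z then p ^ (r - digitSum r t.2) else 0

variable {r : ℕ}

/-- The product of some of the two polynomials `G` and `H`, as coded by the digits of `τ`. -/
noncomputable def subProduct (G H : MvPolynomial (Fin r) ℤ) (τ : ℕ) : MvPolynomial (Fin r) ℤ :=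
  G ^ (τ % 2) * H ^ (τ / 2)

/-- The block diagonal matrices whose reverse characteristic polynomials are the denominator and the
numerator of the zeta function. -/
noncomputable def zetaMatrix (p e V : ℕ) (G H : MvPolynomial (Fin r) ℤ) (z : ℕ) :
    Matrix ((Fin r → Fin V) × (Fin 4 × Fin (2 ^ r))) ((Fin r → Fin V) × (Fin 4 × Fin (2 ^ r))) ℤ :=
  Matrix.blockDiagonal fun t =>
    (blockWeight p r z (t.1, t.2) : ℤ) • dworkMatrix p V (subProduct G H t.1 ^ e)

/-- The parity of the sign makes exactly one of the two weights vanish, and `0 ^ k = 0` because `k >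
0`. -/
theorem blockWeight_pow_sub (p r k : ℕ) (hk : 0 < k) (t : ℕ × ℕ) :
    ((blockWeight p r 0 t : ℤ)) ^ k - (blockWeight p r 1 t : ℤ) ^ k =
      (-1) ^ (t.1 % 2 + t.1 / 2) *
        ((-1) ^ digitSum r t.2 * ((p : ℤ) ^ k) ^ (r - digitSum r t.2)) := by
  rw [← mul_assoc, ← pow_add, ← pow_mul, mul_comm k, pow_mul]
  unfold blockWeight
  rcases Nat.mod_two_eq_zero_or_one (t.1 % 2 + t.1 / 2 + digitSum r t.2) with h | h
  · rw [if_pos h, if_neg (by omega), Even.neg_one_pow (Nat.even_iff.2 h)]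
    simp [hk.ne']
  · rw [if_neg (by omega), if_pos h, Odd.neg_one_pow (Nat.odd_iff.2 h)]
    simp [hk.ne']

/-- The sum over the digits `S` rebuilds the factor `(p ^ k - 1) ^ r` of the trace formula; the
signs in `τ` are those of inclusion and exclusion. -/
theorem trace_zetaMatrix_pow_sub (p e V : ℕ) (G H : MvPolynomial (Fin r) ℤ) {k : ℕ}
    (hk : 0 < k) :
    (zetaMatrix p e V G H 0 ^ k).trace - (zetaMatrix p e V G H 1 ^ k).trace =
      ((p : ℤ) ^ k - 1) ^ r * ∑ τ ∈ Finset.range 4,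
        (-1) ^ (τ % 2 + τ / 2) * (dworkMatrix p V (subProduct G H τ ^ e) ^ k).trace := by
  have h (z : ℕ) : (zetaMatrix p e V G H z ^ k).trace = ∑ τ ∈ Finset.range 4,
      ∑ S ∈ Finset.range (2 ^ r), (blockWeight p r z (τ, S) : ℤ) ^ k *
        (dworkMatrix p V (subProduct G H τ ^ e) ^ k).trace := by
    rw [zetaMatrix, ← Matrix.blockDiagonal_pow, Matrix.trace_blockDiagonal,
      Fintype.sum_prod_type, Finset.sum_range]
    refine Finset.sum_congr rfl fun τ _ => ?_
    rw [Finset.sum_range]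
    refine Finset.sum_congr rfl fun S _ => ?_
    rw [Pi.pow_apply, _root_.smul_pow, Matrix.trace_smul, smul_eq_mul]
  rw [h, h, ← Finset.sum_sub_distrib, Finset.mul_sum]
  refine Finset.sum_congr rfl fun τ _ => ?_
  rw [← Finset.sum_sub_distrib, ← sum_neg_one_pow_digitSum, Finset.sum_mul]
  refine Finset.sum_congr rfl fun S _ => ?_
  rw [← sub_mul, blockWeight_pow_sub p r k hk]
  ring

variable {p : ℕ} [hp : Fact p.Prime] {F : Type*} [Field F] [Finite F] [CharP F p]
variable [Fintype (Fin r → Fˣ)] [DecidableEq (Fin r → Fˣ)]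

open Classical in
/-- The permutation matrix of the Frobenius map on a subset of the torus. -/
noncomputable def frobOn (p : ℕ) (U : (Fin r → Fˣ) → Prop) :
    Matrix (Fin r → Fˣ) (Fin r → Fˣ) ℤ :=
  weightedMap (torusFrob p F) fun x => if U x then (1 : ℤ) else 0

theorem trace_frobOn_pow {U : (Fin r → Fˣ) → Prop} (hU : ∀ x, U x → U (torusFrob p F x))
    (k : ℕ) (hk : 0 < k) : (frobOn p U ^ k).trace =
      Nat.card {x : Fin r → Fˣ // U x ∧ ∀ l, x l ^ p ^ k = x l} := by
  classical
  have h1 (x : Fin r → Fˣ) : (∏ i ∈ Finset.range k, if U ((torusFrob p F)^[i] x) then (1 : ℤ)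
      else 0) = if U x then 1 else 0 := by
    by_cases hx : U x
    · have h2 (i : ℕ) : U ((torusFrob p F)^[i] x) := by
        induction i with
        | zero => exact hx
        | succ i ih =>
          rw [Function.iterate_succ_apply']
          exact hU _ ih
      simp [hx, h2]
    · rw [if_neg hx]
      exact Finset.prod_eq_zero (Finset.mem_range.2 hk) (if_neg hx)
  rw [frobOn, trace_weightedMap_pow, Nat.card_eq_fintype_card, Fintype.card_subtype]
  simp only [h1]
  rw [Finset.sum_boole, Finset.filter_filter]
  congr 2
  ext x
  simp only [Finset.mem_filter, Finset.mem_univ, true_and, torusFrob_iterate, funext_iff]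
  exact and_comm

/-- The points of the torus where two polynomials vanish. -/
def commonZeros (F : Type*) [Field F] (G H : MvPolynomial (Fin r) ℤ) (x : Fin r → Fˣ) : Prop :=
  MvPolynomial.aeval (fun l => (x l : F)) G = 0 ∧ MvPolynomial.aeval (fun l => (x l : F)) H = 0

/-- Abbreviate `det (1 - T A)` to `[A]`. By the trace formula, `[B 0] [M 1] [M 2] = [B 1] [M 0] [M
3]` over the Witt vectors, up to degree `L`; the divisibility `hL` ensures that `F` contains the
roots of unity involved. Modulo `p ^ m` each `M τ` may be replaced by Frobenius on `U τ`. Inclusion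
and exclusion for the sets `U τ` then leave only Frobenius on the common zeros. -/
theorem charpolyRev_zetaMatrix (m L V : ℕ) (hL : ∀ k, 0 < k → k ≤ L → p ^ k - 1 ∣ Nat.card Fˣ)
    (G H : MvPolynomial (Fin r) ℤ)
    (hV : ∀ τ < 4, ∀ w ∈ (subProduct G H τ ^ ((p - 1) * p ^ m)).support, ∀ l, w l < V)
    (k : ℕ) (hk : k ≤ L) :
    (p ^ m : ℤ) ∣ (zetaMatrix p ((p - 1) * p ^ m) V G H 0).charpolyRev.coeff k -
      ((zetaMatrix p ((p - 1) * p ^ m) V G H 1).charpolyRev *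
        (frobOn p (commonZeros F G H)).charpolyRev).coeff k := by
  classical
  have hpr := hp.out
  set e := (p - 1) * p ^ m with he
  set R := WittVector p F
  have hR0 : CharZero R := witt_charZero
  set I : Ideal R := Ideal.span {(p ^ m : R)} with hI
  set B := zetaMatrix p e V G H with hB
  set M : ℕ → Matrix (Fin r → Fˣ) (Fin r → Fˣ) R := fun τ =>
    weightedMap (torusFrob p F) (torusWeight p F (subProduct G H τ ^ e)) with hM
  set U : ℕ → (Fin r → Fˣ) → Prop := fun τ x =>
    MvPolynomial.aeval (fun l => (x l : F)) (subProduct G H τ) ≠ 0 with hUdef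
  have hfrob (G : MvPolynomial (Fin r) ℤ) (x : Fin r → Fˣ) :
      MvPolynomial.aeval (fun l => (torusFrob p F x l : F)) G =
        MvPolynomial.aeval (fun l => (x l : F)) G ^ p := by
    rw [← aeval_pow_char]
    simp [torusFrob]
  have hU (τ : ℕ) (x : Fin r → Fˣ) (hx : U τ x) : U τ (torusFrob p F x) := by
    simp only [hUdef] at hx ⊢
    rw [hfrob]
    exact pow_ne_zero _ hx
  have hX (x : Fin r → Fˣ) (hx : commonZeros F G H x) :
      commonZeros F G H (torusFrob p F x) := by
    unfold commonZeros at hx ⊢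
    rw [hfrob, hfrob, hx.1, hx.2, zero_pow hpr.ne_zero]
    exact ⟨rfl, rfl⟩
  -- the identity in characteristic zero
  have key1 : PowerSeries.X ^ (L + 1) ∣
      ((((B 0).map (Int.castRingHom R)).charpolyRev : R⟦X⟧) *
        (((M 1).charpolyRev : R⟦X⟧) * ((M 2).charpolyRev : R⟦X⟧))) -
      ((((B 1).map (Int.castRingHom R)).charpolyRev : R⟦X⟧) *
        (((M 0).charpolyRev : R⟦X⟧) * ((M 3).charpolyRev : R⟦X⟧))) := by
    rw [X_pow_dvd_sub_iff]
    refine HasLogDeriv.coeff_eq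
      ((hasLogDeriv_charpolyRev _).mul ((hasLogDeriv_charpolyRev _).mul
        (hasLogDeriv_charpolyRev _)))
      ((hasLogDeriv_charpolyRev _).mul ((hasLogDeriv_charpolyRev _).mul
        (hasLogDeriv_charpolyRev _))) fun k hk hkL => ?_
    simp only [map_add, map_neg, coeff_traceSeries _ hk, trace_map_pow]
    have h1 (τ : ℕ) (hτ : τ < 4) : (M τ ^ k).trace = ((p ^ k - 1 : ℕ) : R) ^ r *
        ((dworkMatrix p V (subProduct G H τ ^ e) ^ k).trace : ℤ) :=
      trace_torusWeight (hV τ hτ) hk (hL k hk hkL)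
    have h2 := congrArg (Int.castRingHom R) (trace_zetaMatrix_pow_sub p e V G H hk)
    rw [← hB] at h2
    rw [h1 0 (by norm_num), h1 1 (by norm_num), h1 2 (by norm_num), h1 3 (by norm_num),
      Nat.cast_sub (Nat.one_le_pow _ _ hpr.pos)]
    simp only [Finset.sum_range_succ, Finset.sum_range_zero] at h2
    simp only [map_sub, map_mul, map_add, map_pow, map_one, map_neg, map_natCast, map_zero,
      eq_intCast] at h2 ⊢
    norm_num at h2
    push_cast
    linear_combination -h2
  -- inclusion and exclusion
  have key2 : (((frobOn (F := F) p (U 0)).charpolyRev : ℤ⟦X⟧) *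
        ((frobOn (F := F) p (U 3)).charpolyRev : ℤ⟦X⟧)) =
      ((frobOn p (commonZeros F G H)).charpolyRev : ℤ⟦X⟧) *
        (((frobOn (F := F) p (U 1)).charpolyRev : ℤ⟦X⟧) *
          ((frobOn (F := F) p (U 2)).charpolyRev : ℤ⟦X⟧)) := by
    ext j
    refine HasLogDeriv.coeff_eq (L := j)
      ((hasLogDeriv_charpolyRev _).mul (hasLogDeriv_charpolyRev _))
      ((hasLogDeriv_charpolyRev _).mul ((hasLogDeriv_charpolyRev _).mul
        (hasLogDeriv_charpolyRev _))) (fun k hk _ => ?_) j le_rfl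
    simp only [map_add, map_neg, coeff_traceSeries _ hk, trace_frobOn_pow (hU _) k hk,
      trace_frobOn_pow hX k hk, Nat.card_eq_fintype_card, Fintype.card_subtype,
      Finset.natCast_card_filter]
    simp only [← Finset.sum_neg_distrib, ← Finset.sum_add_distrib]
    refine Finset.sum_congr rfl fun x _ => ?_
    simp only [hUdef, subProduct, commonZeros]
    by_cases h1 : MvPolynomial.aeval (fun l => (x l : F)) G = 0 <;>
    by_cases h2 : MvPolynomial.aeval (fun l => (x l : F)) H = 0 <;>
    by_cases h3 : ∀ l, x l ^ p ^ k = x l <;> simp [h1, h2, h3]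
  -- the reduction
  have hred (τ : ℕ) : PowerSeries.map (Ideal.Quotient.mk I) ((M τ).charpolyRev : R⟦X⟧) =
      PowerSeries.map (Int.castRingHom (R ⧸ I)) ((frobOn (F := F) p (U τ)).charpolyRev : ℤ⟦X⟧) := by
    rw [← Polynomial.polynomial_map_coe, ← Polynomial.polynomial_map_coe]
    congr 1
    exact @charpolyRev_torusWeight p hp F _ _ _ r _ _ m (subProduct G H τ)
      (fun _ => Classical.propDecidable _)
  have hB' (z : ℕ) : PowerSeries.map (Ideal.Quotient.mk I)
      (((B z).map (Int.castRingHom R)).charpolyRev : R⟦X⟧) =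
      PowerSeries.map (Int.castRingHom (R ⧸ I)) ((B z).charpolyRev : ℤ⟦X⟧) := by
    rw [← Polynomial.polynomial_map_coe, ← Polynomial.polynomial_map_coe, charpolyRev_map,
      Polynomial.map_map]
    congr 2
  have key3 := map_dvd (PowerSeries.map (Ideal.Quotient.mk I)) key1
  rw [map_sub, map_mul, map_mul, map_mul, map_mul, hred, hred, hred, hred, hB', hB',
    ← map_mul (PowerSeries.map (Int.castRingHom (R ⧸ I)))
      ((frobOn (F := F) p (U 0)).charpolyRev : ℤ⟦X⟧), key2, map_pow, PowerSeries.map_X] at key3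
  have key4 : PowerSeries.X ^ (L + 1) ∣
      (PowerSeries.map (Int.castRingHom (R ⧸ I)) ((B 0).charpolyRev : ℤ⟦X⟧) -
        PowerSeries.map (Int.castRingHom (R ⧸ I)) (((B 1).charpolyRev : ℤ⟦X⟧) *
          ((frobOn p (commonZeros F G H)).charpolyRev : ℤ⟦X⟧))) *
      PowerSeries.map (Int.castRingHom (R ⧸ I))
        (((frobOn (F := F) p (U 1)).charpolyRev : ℤ⟦X⟧) *
          ((frobOn (F := F) p (U 2)).charpolyRev : ℤ⟦X⟧)) := by
    rw [sub_mul]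
    simpa only [map_mul, mul_assoc] using key3
  -- The factors for `U 1` and `U 2` have constant term one and are cancelled.
  rw [IsUnit.dvd_mul_right, X_pow_dvd_sub_iff] at key4
  · have h1 := key4 k hk
    rw [PowerSeries.coeff_map, PowerSeries.coeff_map, ← Polynomial.coe_mul, Polynomial.coeff_coe,
      Polynomial.coeff_coe, ← sub_eq_zero, ← map_sub] at h1
    rw [← witt_pow_dvd_intCast (p := p) (F := F), ← Ideal.mem_span_singleton,
      ← Ideal.Quotient.eq_zero_iff_mem]
    rw [map_intCast]
    exact h1
  · exact IsUnit.map _ (IsUnit.mul (isUnit_of_constantCoeff_eq_one (constantCoeff_charpolyRev _))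
      (isUnit_of_constantCoeff_eq_one (constantCoeff_charpolyRev _)))

end Congruence

/-! ## Numbers of points -/

section PointCount

variable {p : ℕ} [hp : Fact p.Prime] {K : Type*} [Field K] [Finite K] [CharP K p] {n : ℕ}

/-- An element of a finite field that is fixed by a power of the Frobenius map comes from the
subfield. -/
theorem mem_range_of_pow_eq {F F' : Type*} [Field F] [Field F'] [Finite F'] (φ : F' →+* F) (y : F)
    (hy : y ^ Nat.card F' = y) : ∃ x, φ x = y := by
  classical
  have := Fintype.ofFinite F'
  have h1 : 1 < Nat.card F' := Finite.one_lt_card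
  have h2 : (X ^ Nat.card F' - X : F[X]) ≠ 0 := FiniteField.X_pow_card_sub_X_ne_zero F h1
  have h3 : Finset.univ.image φ = (X ^ Nat.card F' - X : F[X]).roots.toFinset := by
    refine Finset.eq_of_subset_of_card_le (fun z hz => ?_) ?_
    · obtain ⟨x, -, rfl⟩ := Finset.mem_image.1 hz
      rw [Multiset.mem_toFinset, mem_roots h2]
      simp only [IsRoot.def, eval_sub, eval_pow, eval_X]
      rw [← map_pow, Nat.card_eq_fintype_card, FiniteField.pow_card, sub_self]
    · rw [Finset.card_image_of_injective _ φ.injective, Finset.card_univ,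
        ← Nat.card_eq_fintype_card]
      refine (Multiset.toFinset_card_le _).trans ((card_roots' _).trans ?_)
      rw [FiniteField.X_pow_card_sub_X_natDegree_eq F h1]
  have h4 : y ∈ Finset.univ.image φ := by
    rw [h3, Multiset.mem_toFinset, mem_roots h2, IsRoot.def, eval_sub, eval_pow, eval_X, hy,
      sub_self]
  obtain ⟨x, -, hx⟩ := Finset.mem_image.1 h4
  exact ⟨x, hx⟩

/-- The extension of degree `j` embeds into `F` as the fixed field of the `q ^ j`-th power map, so
the points over different extensions can be counted inside one field. -/
theorem torusPointCount_eq {F : Type*} [Field F] [Finite F] [Algebra K F]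
    (f : MvPolynomial (Fin n) K) (j : ℕ) [NeZero j] (hj : j ∣ Module.finrank K F) :
    torusPointCount p f j = Nat.card {x : Fin n → Fˣ //
      MvPolynomial.aeval (fun i => (x i : F)) f = 0 ∧ ∀ l, x l ^ Nat.card K ^ j = x l} := by
  have h1 : Module.finrank K (FiniteField.Extension K p j) ∣ Module.finrank K F := by
    rwa [FiniteField.finrank_extension]
  obtain ⟨φ⟩ := FiniteField.nonempty_algHom_of_finrank_dvd h1
  have hφ : Function.Injective φ := φ.toRingHom.injective
  have hval (x : Fin n → (FiniteField.Extension K p j)ˣ) :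
      MvPolynomial.aeval (fun i => φ (x i)) f =
        φ (MvPolynomial.aeval (fun i => (x i : FiniteField.Extension K p j)) f) :=
    (MvPolynomial.comp_aeval_apply _ φ f).symm
  refine Nat.card_congr (Equiv.ofBijective (fun x => ⟨fun l => Units.map φ (x.1 l), ?_, ?_⟩)
    ⟨fun x y h => ?_, fun y => ?_⟩)
  · have := hval x.1
    rw [x.2, map_zero] at this
    simpa using this
  · intro l
    rw [← map_pow, ← FiniteField.natCard_extension K p j, ← pow_sub_one_mul Nat.card_pos.ne',
      ← Nat.card_units, pow_card_eq_one', one_mul]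
  · refine Subtype.ext (funext fun l => ?_)
    have := congrFun (congrArg Subtype.val h) l
    exact Units.map_injective (f := (φ : _ →* F)) hφ this
  · have h2 (l : Fin n) : ∃ z : (FiniteField.Extension K p j)ˣ, Units.map (φ : _ →* F) z = y.1 l := by
      obtain ⟨z, hz⟩ := mem_range_of_pow_eq φ.toRingHom (y.1 l : F) (by
        rw [FiniteField.natCard_extension K p j, ← Units.val_pow_eq_pow_val, y.2.2 l])
      have hz0 : z ≠ 0 := by
        rintro rfl
        rw [map_zero] at hz
        exact (y.1 l).ne_zero hz.symm
      exact ⟨Units.mk0 z hz0, Units.ext hz⟩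
    choose x hx using h2
    refine ⟨⟨x, hφ ?_⟩, Subtype.ext (funext hx)⟩
    rw [← hval, map_zero, ← y.2.1]
    congr 2
    funext l
    rw [← hx l]
    rfl

variable [Algebra (ZMod p) K]

/-- A power of Frobenius is determined by its value at the generator, and the order of Frobenius is
the degree. -/
theorem pow_gen_eq_iff (b : PowerBasis (ZMod p) K) (k : ℕ) :
    b.gen ^ p ^ k = b.gen ↔ b.dim ∣ k := by
  have h (x : K) : (FiniteField.frobeniusAlgHom (ZMod p) K ^ k) x = x ^ p ^ k := by
    rw [AlgHom.coe_pow, FiniteField.coe_frobeniusAlgHom, pow_iterate, ZMod.card]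
  rw [← b.finrank, ← FiniteField.orderOf_frobeniusAlgHom (ZMod p) K, orderOf_dvd_iff_pow_eq_one,
    ← h]
  refine ⟨fun h1 => b.algHom_ext h1, fun h1 => ?_⟩
  rw [h1]
  rfl

/-- The points of the hypersurface `f = 0`, as a variety over the prime field. -/
theorem card_commonZeros {F : Type*} [Field F] [Finite F] [Algebra (ZMod p) F]
    [Fintype (K →ₐ[ZMod p] F)] (b : PowerBasis (ZMod p) K) (hb : b.gen ≠ 0)
    (f : MvPolynomial (Fin n) K) (G H : MvPolynomial (Fin (n + 1)) ℤ)
    (hG : ∀ y : Fin (n + 1) → F, MvPolynomial.aeval y G = aeval (y 0) (minpoly (ZMod p) b.gen))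
    (hH : ∀ (ι : K →ₐ[ZMod p] F) (y : Fin (n + 1) → F), y 0 = ι b.gen →
      MvPolynomial.aeval y H = MvPolynomial.eval₂ (ι : K →+* F) (fun i => y i.succ) f) (k : ℕ) :
    Nat.card {y : Fin (n + 1) → Fˣ // commonZeros F G H y ∧ ∀ l, y l ^ p ^ k = y l} =
      ∑ ι : K →ₐ[ZMod p] F, Nat.card {x : Fin n → Fˣ //
        (MvPolynomial.eval₂ (ι : K →+* F) (fun i => (x i : F)) f = 0 ∧ ∀ l, x l ^ p ^ k = x l) ∧
          b.dim ∣ k} := by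
  classical
  have : Fintype Fˣ := Fintype.ofFinite _
  -- The first coordinate of a common zero is a root of the minimal polynomial, that is, an
  -- embedding of `K`; the others form a point of the conjugate of `f = 0` under it. As the
  -- generator is nonzero, all such pairs do give points of the torus.
  have e : {q : (K →ₐ[ZMod p] F) × (Fin n → Fˣ) //
      (MvPolynomial.eval₂ (q.1 : K →+* F) (fun i => (q.2 i : F)) f = 0 ∧
        ∀ l, q.2 l ^ p ^ k = q.2 l) ∧ b.dim ∣ k} ≃
      {y : Fin (n + 1) → Fˣ // commonZeros F G H y ∧ ∀ l, y l ^ p ^ k = y l} := by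
    have h0 (ι : K →ₐ[ZMod p] F) : ι b.gen ≠ 0 := by simpa using hb
    have h1 (ι : K →ₐ[ZMod p] F) : (ι b.gen) ^ p ^ k = ι b.gen ↔ b.dim ∣ k := by
      rw [← map_pow]
      exact ι.toRingHom.injective.eq_iff.trans (pow_gen_eq_iff b k)
    refine Equiv.ofBijective (fun q => ⟨Fin.cons (Units.mk0 _ (h0 q.1.1)) q.1.2, ⟨?_, ?_⟩, ?_⟩)
      ⟨fun q q' h => ?_, fun y => ?_⟩
    · rw [hG]
      simp only [Fin.cons_zero, Units.val_mk0]
      rw [aeval_algHom_apply, minpoly.aeval, map_zero]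
    · rw [hH q.1.1 _ (by simp)]
      simpa using q.2.1.1
    · intro l
      refine Fin.cases ?_ (fun l => ?_) l
      · rw [Fin.cons_zero]
        ext
        simpa using (h1 q.1.1).2 q.2.2
      · simpa using q.2.1.2 l
    · have h2 := congrFun (congrArg Subtype.val h)
      refine Subtype.ext (Prod.ext (b.algHom_ext ?_) (funext fun l => ?_))
      · simpa using congrArg Units.val (h2 0)
      · simpa using h2 l.succ
    · obtain ⟨y, ⟨hy1, hy2⟩, hy3⟩ := y
      rw [hG] at hy1
      set ι := b.lift (y 0 : F) hy1 with hι
      have h2 : (y 0 : F) = ι b.gen := (b.lift_gen _ hy1).symm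
      refine ⟨⟨⟨ι, fun i => y i.succ⟩, ⟨?_, fun l => hy3 l.succ⟩, ?_⟩, ?_⟩
      · rwa [hH ι _ h2] at hy2
      · rw [← h1 ι, ← h2, ← Units.val_pow_eq_pow_val, hy3]
      · refine Subtype.ext (funext fun l => ?_)
        refine Fin.cases ?_ (fun l => ?_) l
        · ext
          simp [h2]
        · simp
  rw [← Nat.card_congr e, Nat.card_eq_fintype_card, Fintype.card_subtype, Finset.card_filter,
    Fintype.sum_prod_type]
  refine Finset.sum_congr rfl fun ι _ => ?_
  rw [Nat.card_eq_fintype_card, Fintype.card_subtype, Finset.card_filter]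

theorem card_commonZeros_of_not_dvd {F : Type*} [Field F] [Finite F] [Algebra (ZMod p) F]
    (b : PowerBasis (ZMod p) K) (hb : b.gen ≠ 0)
    (f : MvPolynomial (Fin n) K) (G H : MvPolynomial (Fin (n + 1)) ℤ)
    (hG : ∀ y : Fin (n + 1) → F, MvPolynomial.aeval y G = aeval (y 0) (minpoly (ZMod p) b.gen))
    (hH : ∀ (ι : K →ₐ[ZMod p] F) (y : Fin (n + 1) → F), y 0 = ι b.gen →
      MvPolynomial.aeval y H = MvPolynomial.eval₂ (ι : K →+* F) (fun i => y i.succ) f) (k : ℕ)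
    (hk : ¬ b.dim ∣ k) :
    Nat.card {y : Fin (n + 1) → Fˣ // commonZeros F G H y ∧ ∀ l, y l ^ p ^ k = y l} = 0 := by
  have := Fintype.ofFinite (K →ₐ[ZMod p] F)
  rw [card_commonZeros b hb f G H hG hH]
  simp [hk]

/-- Each of the `b.dim` embeddings makes `F` an extension of `K`, and by `torusPointCount_eq` the
count does not depend on which one is chosen. -/
theorem card_commonZeros_of_dvd {F : Type*} [Field F] [Finite F] [Algebra (ZMod p) F]
    (b : PowerBasis (ZMod p) K) (hb : b.gen ≠ 0)
    (f : MvPolynomial (Fin n) K) (G H : MvPolynomial (Fin (n + 1)) ℤ)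
    (hG : ∀ y : Fin (n + 1) → F, MvPolynomial.aeval y G = aeval (y 0) (minpoly (ZMod p) b.gen))
    (hH : ∀ (ι : K →ₐ[ZMod p] F) (y : Fin (n + 1) → F), y 0 = ι b.gen →
      MvPolynomial.aeval y H = MvPolynomial.eval₂ (ι : K →+* F) (fun i => y i.succ) f)
    (j : ℕ) [NeZero j] (hj : b.dim * j ∣ Module.finrank (ZMod p) F) :
    Nat.card {y : Fin (n + 1) → Fˣ //
      commonZeros F G H y ∧ ∀ l, y l ^ p ^ (b.dim * j) = y l} = b.dim * torusPointCount p f j := by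
  have := Fintype.ofFinite (K →ₐ[ZMod p] F)
  rw [card_commonZeros b hb f G H hG hH]
  have h1 (ι : K →ₐ[ZMod p] F) : Nat.card {x : Fin n → Fˣ //
        (MvPolynomial.eval₂ (ι : K →+* F) (fun i => (x i : F)) f = 0 ∧
          ∀ l, x l ^ p ^ (b.dim * j) = x l) ∧ b.dim ∣ b.dim * j} = torusPointCount p f j := by
    let _ : Algebra K F := (ι : K →+* F).toAlgebra
    have : IsScalarTower (ZMod p) K F := .of_algebraMap_eq' (Subsingleton.elim _ _)
    have h2 : j ∣ Module.finrank K F := by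
      rw [← Module.finrank_mul_finrank (ZMod p) K F, b.finrank] at hj
      exact Nat.dvd_of_mul_dvd_mul_left b.dim_pos hj
    rw [torusPointCount_eq f j h2, ← FiniteField.pow_finrank_eq_natCard p K, b.finrank]
    simp only [← pow_mul]
    simp only [dvd_mul_right, and_true]
    rfl
  rw [Finset.sum_congr rfl fun ι _ => h1 ι, Finset.sum_const, Finset.card_univ,
    Fintype.card_eq_nat_card, FiniteField.natCard_algHom_of_finrank_dvd, smul_eq_mul, b.finrank]
  rw [b.finrank]
  exact (dvd_mul_right _ _).trans hj

end PointCount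

/-! ## The reduction of the zeta function -/

section Reduction

open scoped PowerSeries

theorem HasLogDeriv.of_mul_eq_one {R : Type*} [CommRing R] {F G s : R⟦X⟧} (hF : HasLogDeriv F s)
    (h : F * G = 1) : HasLogDeriv G (-s) := by
  have h0 := congrArg PowerSeries.constantCoeff h
  rw [map_mul, hF.constantCoeff, one_mul, map_one] at h0
  refine ⟨h0, ?_⟩
  have h1 := congrArg (PowerSeries.derivative R) h
  rw [Derivation.leibniz, smul_eq_mul, smul_eq_mul, Derivation.map_one_eq_zero] at h1
  linear_combination (-(PowerSeries.X * PowerSeries.derivative R G) - G * s) * h - G ^ 2 * hF.deriv +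
    PowerSeries.X * G * h1

theorem sum_range_mul_of_support {M : Type*} [AddCommMonoid M] {a : ℕ} (ha : 0 < a) (k : ℕ)
    (φ : ℕ → M) (h : ∀ i < a * k, ¬ a ∣ i → φ i = 0) :
    ∑ i ∈ Finset.range (a * k), φ i = ∑ i ∈ Finset.range k, φ (a * i) := by
  induction k with
  | zero => simp
  | succ k ih =>
    rw [mul_add, mul_one] at h
    rw [Finset.sum_range_succ, ← ih fun i hi => h i (by omega), mul_add, mul_one,
      Finset.sum_range_add]
    congr 1
    rw [Finset.sum_eq_single_of_mem 0 (Finset.mem_range.2 ha), add_zero]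
    intro i hi hi0
    have hia := Finset.mem_range.1 hi
    refine h _ (by omega) fun hd => ?_
    rw [Nat.dvd_add_right (dvd_mul_right a k)] at hd
    exact hi0 (Nat.eq_zero_of_dvd_of_lt hd hia)

variable {p : ℕ} [hp : Fact p.Prime] {K : Type*} [Field K] [Finite K] [CharP K p] {n : ℕ}

/-- By the chain rule `exp S` has logarithmic derivative `T S'`, and the differentiation removes the
denominators. -/
theorem hasLogDeriv_torusZeta (f : MvPolynomial (Fin n) K) :
    HasLogDeriv (torusZeta p f)
      (PowerSeries.X * PowerSeries.mk fun j => (torusPointCount p f (j + 1) : ℚ)) := by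
  have h0 : PowerSeries.constantCoeff (torusLogZeta p f) = 0 := by simp [torusLogZeta]
  have h1 := PowerSeries.HasSubst.of_constantCoeff_zero' h0
  refine ⟨?_, ?_⟩
  · have h2 : torusZeta p f = 1 + ((PowerSeries.exp ℚ) - 1).subst (torusLogZeta p f) := by
      have : PowerSeries.exp ℚ = 1 + (PowerSeries.exp ℚ - 1) := by ring
      rw [torusZeta, this, PowerSeries.subst_add h1]
      congr 1
      · rw [← PowerSeries.coe_substAlgHom h1, map_one]
      · simp
    have h3 : PowerSeries.constantCoeff ((PowerSeries.exp ℚ - 1).subst (torusLogZeta p f)) = 0 :=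
      PowerSeries.constantCoeff_subst_eq_zero h0 _ (by simp [PowerSeries.constantCoeff_exp])
    rw [h2, map_add, map_one, h3, add_zero]
  · rw [torusZeta, PowerSeries.derivative_subst h1, PowerSeries.derivative_exp, mul_left_comm]
    congr 1
    ext k
    rcases k with _ | k
    · simp
    · rw [PowerSeries.coeff_succ_X_mul, PowerSeries.coeff_succ_X_mul, PowerSeries.coeff_derivative,
        torusLogZeta, PowerSeries.coeff_succ_X_mul, PowerSeries.coeff_mk, PowerSeries.coeff_mk]
      have : ((k : ℚ) + 1) ≠ 0 := by positivity
      push_cast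
      field_simp

/-- The reverse characteristic polynomial of the Frobenius map on the points over the prime field
against the inverse of the zeta function. -/
theorem coeff_eq_of_trace {a : ℕ} (ha : 0 < a) {P Y : ℚ⟦X⟧} {s t : ℚ⟦X⟧} (hP : HasLogDeriv P s)
    (hY : HasLogDeriv Y t) (L : ℕ)
    (h0 : ∀ k, 0 < k → k ≤ L → ¬ a ∣ k → PowerSeries.coeff k s = 0)
    (h1 : ∀ k, 0 < k → a * k ≤ L → PowerSeries.coeff (a * k) s = a * PowerSeries.coeff k t) :
    (∀ i ≤ L, ¬ a ∣ i → PowerSeries.coeff i P = 0) ∧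
      ∀ k, a * k ≤ L → PowerSeries.coeff (a * k) P = PowerSeries.coeff k Y := by
  have h2 (i : ℕ) : i ≤ L → ¬ a ∣ i → PowerSeries.coeff i P = 0 := by
    induction i using Nat.strong_induction_on with
    | _ i ih =>
      intro hi hai
      rcases i with _ | i
      · exact absurd (dvd_zero a) hai
      have h3 : ((i + 1 : ℕ) : ℚ) ≠ 0 := by positivity
      have h4 := hP.coeff_succ i
      rw [Finset.sum_eq_zero, mul_eq_zero, or_iff_right h3] at h4
      · exact h4
      · intro j hj
        have hj' := Finset.mem_range.1 hj
        -- Of two numbers with sum `i + 1`, which `a` does not divide, one is not divisible by `a`.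
        by_cases haj : a ∣ j
        · rw [h0 (i + 1 - j) (by omega) (by omega), mul_zero]
          rw [← Nat.dvd_add_right haj, Nat.add_sub_cancel' (by omega)]
          exact hai
        · rw [ih j hj' (by omega) haj, zero_mul]
  refine ⟨h2, fun k => ?_⟩
  induction k using Nat.strong_induction_on with
  | _ k ih =>
    intro hk
    rcases k with _ | k
    · rw [mul_zero, PowerSeries.coeff_zero_eq_constantCoeff, hP.constantCoeff, hY.constantCoeff]
    have h3 : ((a * (k + 1) : ℕ) : ℚ) ≠ 0 := by positivity
    refine mul_left_cancel₀ h3 ?_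
    obtain ⟨c, hc⟩ : ∃ c, a * (k + 1) = c + 1 :=
      Nat.exists_eq_succ_of_ne_zero (Nat.mul_pos ha k.succ_pos).ne'
    have h4 := hP.coeff_succ c
    rw [← hc, sum_range_mul_of_support ha] at h4
    · rw [h4, Nat.cast_mul, mul_assoc, hY.coeff_succ, Finset.mul_sum]
      refine Finset.sum_congr rfl fun i hi => ?_
      have hi' := Finset.mem_range.1 hi
      rw [ih i hi' ((Nat.mul_le_mul_left a hi'.le).trans hk), ← Nat.mul_sub,
        h1 _ (by omega) ((Nat.mul_le_mul_left a (Nat.sub_le _ _)).trans hk)]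
      ring
    · intro i hi hai
      rw [h2 i (by omega) hai, zero_mul]

variable [Algebra (ZMod p) K]

/-- The matrices compute the reduction of the zeta function. -/
theorem isReductionMod_torusZeta (m : ℕ) (b : PowerBasis (ZMod p) K) (hb : b.gen ≠ 0)
    (f : MvPolynomial (Fin n) K) (G H : MvPolynomial (Fin (n + 1)) ℤ)
    (hG : ∀ (F : Type) [Field F] [Algebra (ZMod p) F] (y : Fin (n + 1) → F),
      MvPolynomial.aeval y G = aeval (y 0) (minpoly (ZMod p) b.gen))
    (hH : ∀ (F : Type) [Field F] [Algebra (ZMod p) F] (ι : K →ₐ[ZMod p] F) (y : Fin (n + 1) → F),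
      y 0 = ι b.gen →
      MvPolynomial.aeval y H = MvPolynomial.eval₂ (ι : K →+* F) (fun i => y i.succ) f)
    (V : ℕ)
    (hV : ∀ τ < 4, ∀ w ∈ (subProduct G H τ ^ ((p - 1) * p ^ m)).support, ∀ l, w l < V)
    (g h : (ZMod (p ^ m))[X])
    (hg : ∀ k, g.coeff k =
      ((zetaMatrix p ((p - 1) * p ^ m) V G H 1).charpolyRev.coeff (b.dim * k) : ℤ))
    (hh : ∀ k, h.coeff k =
      ((zetaMatrix p ((p - 1) * p ^ m) V G H 0).charpolyRev.coeff (b.dim * k) : ℤ)) :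
    IsReductionMod (p ^ m) (torusZeta p f) g h := by
  classical
  have hpr := hp.out
  set a := b.dim with ha
  have ha0 : 0 < a := b.dim_pos
  set B := zetaMatrix p ((p - 1) * p ^ m) V G H with hB
  set Z := torusZeta p f with hZ
  have hZL := hasLogDeriv_torusZeta (p := p) f
  rw [← hZ] at hZL
  have hZY : Z * Z⁻¹ = 1 := PowerSeries.mul_inv_cancel _ (by rw [hZL.constantCoeff]; exact one_ne_zero)
  have hYL := hZL.of_mul_eq_one hZY
  -- The polynomial `P`, which represents `Z(X, T ^ a)⁻¹` up to degree `a * k`, comes from a finite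
  -- field that grows with `k`.
  have key (k : ℕ) : ∃ P : ℤ[X],
      (∀ i ≤ a * k, ¬ a ∣ i → P.coeff i = 0) ∧
      (∀ i ≤ k, (P.coeff (a * i) : ℚ) = PowerSeries.coeff i Z⁻¹) ∧
      (p ^ m : ℤ) ∣ (B 0).charpolyRev.coeff (a * k) - ((B 1).charpolyRev * P).coeff (a * k) := by
    set L := a * k with hL
    -- The degree `L!` over `K` makes `F` contain all extensions of the prime field of degree at
    -- most `L`.
    have : NeZero L.factorial := ⟨L.factorial_ne_zero⟩
    let F := FiniteField.Extension K p L.factorial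
    have hF : Module.finrank (ZMod p) F = a * L.factorial := by
      rw [FiniteField.finrank_zmod_extension, b.finrank]
    have : CharP F p := charP_of_injective_algebraMap (algebraMap (ZMod p) F).injective p
    have : Fintype (Fin (n + 1) → Fˣ) := Fintype.ofFinite _
    have hLd (j : ℕ) (hj : 0 < j) (hjL : j ≤ L) : j ∣ Module.finrank (ZMod p) F := by
      rw [hF]
      exact (Nat.dvd_factorial hj hjL).mul_left _
    have hFd (j : ℕ) (hj : 0 < j) (hjL : j ≤ L) : p ^ j - 1 ∣ Nat.card Fˣ := by
      have := Fintype.ofFinite F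
      rw [Nat.card_units, ← FiniteField.pow_finrank_eq_natCard p F]
      exact Nat.pow_sub_one_dvd_pow_sub_one p (hLd j hj hjL)
    set P := (frobOn (F := F) p (commonZeros F G H)).charpolyRev with hP
    have hX (x : Fin (n + 1) → Fˣ) (hx : commonZeros F G H x) :
        commonZeros F G H (torusFrob p F x) := by
      have hfrob (G : MvPolynomial (Fin (n + 1)) ℤ) (x : Fin (n + 1) → Fˣ) :
          MvPolynomial.aeval (fun l => (torusFrob p F x l : F)) G =
            MvPolynomial.aeval (fun l => (x l : F)) G ^ p := by
        rw [← aeval_pow_char]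
        simp [torusFrob]
      unfold commonZeros at hx ⊢
      rw [hfrob, hfrob, hx.1, hx.2, zero_pow hpr.ne_zero]
      exact ⟨rfl, rfl⟩
    have hPL : HasLogDeriv (((frobOn (F := F) p (commonZeros F G H)).map
        (Int.castRingHom ℚ)).charpolyRev : ℚ⟦X⟧) _ := hasLogDeriv_charpolyRev _
    have hcoeff (i : ℕ) : PowerSeries.coeff i (((frobOn (F := F) p (commonZeros F G H)).map
        (Int.castRingHom ℚ)).charpolyRev : ℚ⟦X⟧) = P.coeff i := by
      rw [Polynomial.coeff_coe, charpolyRev_map, Polynomial.coeff_map]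
      rfl
    have htr (j : ℕ) (hj : 0 < j) : PowerSeries.coeff j (-traceSeries
        ((frobOn (F := F) p (commonZeros F G H)).map (Int.castRingHom ℚ))) =
        -(Nat.card {y : Fin (n + 1) → Fˣ //
          commonZeros F G H y ∧ ∀ l, y l ^ p ^ j = y l} : ℚ) := by
      rw [map_neg, coeff_traceSeries _ hj, trace_map_pow, trace_frobOn_pow hX j hj]
      simp
    obtain ⟨h1, h2⟩ := coeff_eq_of_trace ha0 hPL hYL L (fun j hj hjL haj => by
      rw [htr j hj, card_commonZeros_of_not_dvd b hb f G H (hG F) (hH F) j haj, Nat.cast_zero,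
        neg_zero]) (fun j hj hjL => by
      obtain ⟨i, rfl⟩ := Nat.exists_eq_succ_of_ne_zero hj.ne'
      rw [htr _ (by positivity), card_commonZeros_of_dvd b hb f G H (hG F) (hH F) (i + 1)
        (hLd _ (by positivity) hjL), map_neg, PowerSeries.coeff_succ_X_mul, PowerSeries.coeff_mk]
      push_cast
      ring)
    simp only [hcoeff] at h1 h2
    exact ⟨P, fun i hi hai => by exact_mod_cast h1 i hi hai,
      fun i hi => h2 i (Nat.mul_le_mul_left a hi),
      charpolyRev_zetaMatrix m L V hFd G H hV L le_rfl⟩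
  choose P hP1 hP2 hP3 using key
  -- From each `P k` the coefficient of degree `a * k` is used. This shows that `Z⁻¹` is integral,
  -- and so is `Z`, the constant term being one.
  set Y : ℤ⟦X⟧ := PowerSeries.mk fun k => (P k).coeff (a * k) with hY
  have hYmap : PowerSeries.map (Int.castRingHom ℚ) Y = Z⁻¹ := by
    ext k
    rw [PowerSeries.coeff_map, PowerSeries.coeff_mk, ← hP2 k k le_rfl]
    rfl
  have hP4 (k i : ℕ) (hi : i ≤ k) : (P k).coeff (a * i) = PowerSeries.coeff i Y := by
    rw [hY, PowerSeries.coeff_mk]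
    exact_mod_cast (hP2 k i hi).trans (hP2 i i le_rfl).symm
  have hY0 : PowerSeries.constantCoeff Y = ((1 : ℤˣ) : ℤ) := by
    have := congrArg PowerSeries.constantCoeff hYmap
    rw [hYL.constantCoeff, ← PowerSeries.coeff_zero_eq_constantCoeff_apply,
      PowerSeries.coeff_map, PowerSeries.coeff_zero_eq_constantCoeff_apply, eq_intCast] at this
    exact_mod_cast this
  have hYZ := PowerSeries.mul_invOfUnit Y 1 hY0
  refine ⟨?_, PowerSeries.invOfUnit Y 1, ?_, ?_⟩
  · have := constantCoeff_charpolyRev (B 0)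
    rw [← PowerSeries.coeff_zero_eq_constantCoeff_apply, Polynomial.coeff_coe] at this
    rw [hh, mul_zero, this, Int.cast_one]
  · have h1 := congrArg (PowerSeries.map (Int.castRingHom ℚ)) hYZ
    rw [map_mul, hYmap, map_one] at h1
    calc _ = Z * Z⁻¹ * PowerSeries.map (Int.castRingHom ℚ) (PowerSeries.invOfUnit Y 1) := by
          rw [hZY, one_mul]
      _ = Z := by rw [mul_assoc, h1, mul_one]
  -- Since `P k` lives in degrees divisible by `a`, taking every `a`-th coefficient is compatible
  -- with the product by it.
  · have h2 : (h : (ZMod (p ^ m))⟦X⟧) =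
        g * PowerSeries.map (Int.castRingHom (ZMod (p ^ m))) Y := by
      ext k
      have h3 : (((B 0).charpolyRev.coeff (a * k) : ℤ) : ZMod (p ^ m)) =
          (((B 1).charpolyRev * P k).coeff (a * k) : ℤ) := by
        rw [ZMod.intCast_eq_intCast_iff_dvd_sub, ← dvd_neg, neg_sub]
        exact_mod_cast hP3 k
      rw [Polynomial.coeff_coe, hh, h3, Polynomial.coeff_mul, PowerSeries.coeff_mul,
        Finset.Nat.sum_antidiagonal_eq_sum_range_succ
          (fun i j => (B 1).charpolyRev.coeff i * (P k).coeff j),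
        Finset.Nat.sum_antidiagonal_eq_sum_range_succ (fun i j =>
          PowerSeries.coeff i (g : (ZMod (p ^ m))⟦X⟧) *
            PowerSeries.coeff j (PowerSeries.map (Int.castRingHom (ZMod (p ^ m))) Y)),
        Finset.sum_range_succ, Finset.sum_range_succ, sum_range_mul_of_support ha0]
      · push_cast
        congr 1
        · refine Finset.sum_congr rfl fun i hi => ?_
          have hi' := Finset.mem_range.1 hi
          rw [hg, ← Nat.mul_sub, hP4 k _ (Nat.sub_le _ _),
            PowerSeries.coeff_map]
          rfl
        · rw [hg, Nat.sub_self, Nat.sub_self, PowerSeries.coeff_map,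
            ← hP4 k 0 (Nat.zero_le _), mul_zero]
          rfl
      · intro i hi hai
        rw [hP1 k _ (Nat.sub_le _ _), mul_zero]
        intro hd
        rw [← Nat.dvd_add_right hd, Nat.sub_add_cancel hi.le] at hai
        exact hai (dvd_mul_right _ _)
    rw [h2, mul_assoc, ← map_mul, hYZ, map_one, mul_one]

end Reduction

namespace RAM

/-! ## Functions that are defined by terms -/

/-- The function `F` of the arrays and of the variables is the value of a term that binds arrays with
legal names from `l` on. -/
def Definable (l : ℕ) (F : (ℕ → ℕ → ℕ) → (ℕ → ℕ) → ℕ) : Prop :=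
  ∃ t : Tm, t.OK l ∧ ∀ α ρ, t.eval α ρ = F α ρ

namespace Definable

variable {l : ℕ} {F F₁ F₂ F₃ F₄ : (ℕ → ℕ → ℕ) → (ℕ → ℕ) → ℕ}

theorem const (c : ℕ) : Definable l fun _ _ => c := ⟨.const c, trivial, fun _ _ => rfl⟩

theorem var (i : ℕ) : Definable l fun _ ρ => ρ i := ⟨.var i, trivial, fun _ _ => rfl⟩

theorem op (o : Op) (h₁ : Definable l F₁) (h₂ : Definable l F₂) :
    Definable l fun α ρ => o.eval (F₁ α ρ) (F₂ α ρ) := by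
  obtain ⟨t₁, k₁, e₁⟩ := h₁
  obtain ⟨t₂, k₂, e₂⟩ := h₂
  exact ⟨.op o t₁ t₂, ⟨k₁, k₂⟩, fun α ρ => by rw [Tm.eval, e₁, e₂]⟩

theorem add (h₁ : Definable l F₁) (h₂ : Definable l F₂) : Definable l fun α ρ => F₁ α ρ + F₂ α ρ :=
  h₁.op .add h₂

theorem sub (h₁ : Definable l F₁) (h₂ : Definable l F₂) : Definable l fun α ρ => F₁ α ρ - F₂ α ρ :=
  h₁.op .sub h₂

theorem mul (h₁ : Definable l F₁) (h₂ : Definable l F₂) : Definable l fun α ρ => F₁ α ρ * F₂ α ρ :=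
  h₁.op .mul h₂

theorem div (h₁ : Definable l F₁) (h₂ : Definable l F₂) : Definable l fun α ρ => F₁ α ρ / F₂ α ρ :=
  h₁.op .div h₂

theorem congr (h : Definable l F₁) (he : ∀ α ρ, F₁ α ρ = F₂ α ρ) : Definable l F₂ := by
  obtain ⟨t, k, e⟩ := h
  exact ⟨t, k, fun α ρ => (e α ρ).trans (he α ρ)⟩

theorem mod (h₁ : Definable l F₁) (h₂ : Definable l F₂) : Definable l fun α ρ => F₁ α ρ % F₂ α ρ :=
  (h₁.sub (h₂.mul (h₁.div h₂))).congr fun _ _ => (Nat.mod_def _ _).symm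

/-- Terms have no case distinction. Truncated differences give the indicator of equality, and both
alternatives are evaluated and weighted by it. -/
theorem ite_eq (h₁ : Definable l F₁) (h₂ : Definable l F₂) (h₃ : Definable l F₃)
    (h₄ : Definable l F₄) :
    Definable l fun α ρ => if F₁ α ρ = F₂ α ρ then F₃ α ρ else F₄ α ρ := by
  have h : Definable l fun α ρ => 1 - ((F₁ α ρ - F₂ α ρ) + (F₂ α ρ - F₁ α ρ)) :=
    (const 1).sub ((h₁.sub h₂).add (h₂.sub h₁))
  refine ((h.mul h₃).add (((const 1).sub h).mul h₄)).congr fun α ρ => ?_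
  by_cases he : F₁ α ρ = F₂ α ρ
  · simp [he]
  · have : 1 - ((F₁ α ρ - F₂ α ρ) + (F₂ α ρ - F₁ α ρ)) = 0 := by omega
    simp [he, this]

theorem ite_lt (h₁ : Definable l F₁) (h₂ : Definable l F₂) (h₃ : Definable l F₃)
    (h₄ : Definable l F₄) :
    Definable l fun α ρ => if F₁ α ρ < F₂ α ρ then F₃ α ρ else F₄ α ρ := by
  refine (ite_eq ((h₁.add (const 1)).sub h₂) (const 0) h₃ h₄).congr fun α ρ => ?_
  by_cases he : F₁ α ρ < F₂ α ρ
  · rw [if_pos he, if_pos (by omega)]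
  · rw [if_neg he, if_neg (by omega)]

theorem look {a : ℕ} (ha : a < 15) (h : Definable l F) : Definable l fun α ρ => α a (F α ρ) := by
  obtain ⟨t, k, e⟩ := h
  exact ⟨.look a t, ⟨ha, k⟩, fun α ρ => by rw [Tm.eval, e]⟩

theorem sum {G : (ℕ → ℕ → ℕ) → (ℕ → ℕ) → ℕ → ℕ} (h : Definable l F)
    (hG : Definable l fun α ρ => G α (fun i => ρ (i + 1)) (ρ 0)) :
    Definable l fun α ρ => ∑ t ∈ Finset.range (F α ρ), G α ρ t := by
  obtain ⟨t, k, e⟩ := h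
  obtain ⟨t', k', e'⟩ := hG
  exact ⟨.sum t t', ⟨k, k'⟩, fun α ρ => by simp only [Tm.eval, e, e', push_succ, push_zero]⟩

theorem table {a : ℕ} (hl : l ≤ a) (ha : a < 15) {n M q : (ℕ → ℕ → ℕ) → (ℕ → ℕ) → ℕ}
    {G : (ℕ → ℕ → ℕ) → (ℕ → ℕ) → ℕ → ℕ} (hn : Definable l n) (hM : Definable l M)
    (hG : Definable (a + 1) fun α ρ => G α (fun i => ρ (i + 1)) (ρ 0)) (hq : Definable l q) :
    Definable l fun α ρ => RAM.table
      (fun t S => G (Function.update α a S) ρ t % (M α ρ + 1)) (n α ρ) (q α ρ) := by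
  obtain ⟨tn, kn, en⟩ := hn
  obtain ⟨tM, kM, eM⟩ := hM
  obtain ⟨tG, kG, eG⟩ := hG
  obtain ⟨tq, kq, eq⟩ := hq
  exact ⟨.tab a tn tM tG tq, ⟨hl, ha, kn, kM, kG, kq⟩, fun α ρ => by
    simp only [Tm.eval, en, eM, eG, eq, push_succ, push_zero]⟩

theorem ren (σ : ℕ → ℕ) (h : Definable l F) : Definable l fun α ρ => F α fun i => ρ (σ i) := by
  obtain ⟨t, k, e⟩ := h
  exact ⟨.ren σ t, k, fun α ρ => by rw [Tm.eval, e]⟩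

theorem letin {G : (ℕ → ℕ → ℕ) → (ℕ → ℕ) → ℕ} (h : Definable l F) (hG : Definable l G) :
    Definable l fun α ρ => G α (push (F α ρ) ρ) := by
  obtain ⟨t, k, e⟩ := h
  obtain ⟨t', k', e'⟩ := hG
  exact ⟨.letin t t', ⟨k, k'⟩, fun α ρ => by rw [Tm.eval, e, e']⟩

theorem comp₁ {G : (ℕ → ℕ → ℕ) → ℕ → ℕ} (hG : Definable l fun α ρ => G α (ρ 0))
    (h₁ : Definable l F₁) : Definable l fun α ρ => G α (F₁ α ρ) :=
  (h₁.letin hG).congr fun _ _ => rfl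

/-- The arguments are bound from the last to the first; the renaming skips the value already bound.
-/
theorem comp₂ {G : (ℕ → ℕ → ℕ) → ℕ → ℕ → ℕ} (hG : Definable l fun α ρ => G α (ρ 0) (ρ 1))
    (h₁ : Definable l F₁) (h₂ : Definable l F₂) : Definable l fun α ρ => G α (F₁ α ρ) (F₂ α ρ) :=
  (h₂.letin ((h₁.ren (· + 1)).letin hG)).congr fun _ _ => rfl

theorem comp₃ {G : (ℕ → ℕ → ℕ) → ℕ → ℕ → ℕ → ℕ}
    (hG : Definable l fun α ρ => G α (ρ 0) (ρ 1) (ρ 2)) (h₁ : Definable l F₁) (h₂ : Definable l F₂)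
    (h₃ : Definable l F₃) : Definable l fun α ρ => G α (F₁ α ρ) (F₂ α ρ) (F₃ α ρ) :=
  (h₃.letin ((h₂.ren (· + 1)).letin ((h₁.ren (· + 2)).letin hG))).congr fun _ _ => rfl

theorem pow (h : Definable l F) (k : ℕ) : Definable l fun α ρ => F α ρ ^ k := by
  induction k with
  | zero => exact (const 1).congr fun _ _ => (pow_zero _).symm
  | succ k ih => exact (ih.mul h).congr fun _ _ => (pow_succ _ _).symm

theorem sum_const {G : ℕ → (ℕ → ℕ → ℕ) → (ℕ → ℕ) → ℕ} (k : ℕ) (h : ∀ i, Definable l (G i)) :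
    Definable l fun α ρ => ∑ i ∈ Finset.range k, G i α ρ := by
  induction k with
  | zero => exact (const 0).congr fun _ _ => rfl
  | succ k ih => exact (ih.add (h k)).congr fun _ _ => (Finset.sum_range_succ _ _).symm

theorem digitSum (r : ℕ) (h : Definable l F) : Definable l fun α ρ => digitSum r (F α ρ) := by
  induction r generalizing F with
  | zero => exact const 0
  | succ r ih => exact (h.mod (const 2)).add (ih (h.div (const 2)))

end Definable

/-! ## The algorithm

The functions below have the input list `I`, as a function on `ℕ`, and the modulus `N = p ^ m` as
arguments.  Polynomials in several variables are represented by polynomials in one variable, by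
Kronecker substitution. -/

/-- The position in the input of the term with number `e`. -/
def termPos (n : ℕ) (I : ℕ → ℕ) (e : ℕ) : ℕ := 4 + I 2 + e * (n + I 2)

/-- The sum of all exponents in the input. -/
def degSum (n : ℕ) (I : ℕ → ℕ) : ℕ :=
  ∑ e ∈ Finset.range (I (3 + I 2)), ∑ l ∈ Finset.range n, I (termPos n I e + l)

/-- The exponent of the polynomials. -/
def powExp (I : ℕ → ℕ) (N : ℕ) : ℕ := (I 0 - 1) * N

/-- A bound for the exponents of the variables. -/
def boxSize (n : ℕ) (I : ℕ → ℕ) (N : ℕ) : ℕ := 2 * (degSum n I + I 2) * powExp I N + 1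

/-- The base of the Kronecker substitution. -/
def base (n : ℕ) (I : ℕ → ℕ) (N : ℕ) : ℕ := I 0 * boxSize n I N

/-- The coefficients of the minimal polynomial of the generator of the field, or of `T - 1`, if
the degree is one. -/
def muCoeff (I : ℕ → ℕ) (N x : ℕ) : ℕ :=
  if x < I 2 then (if I 2 = 1 then N - 1 else I (3 + x)) else if x = I 2 then 1 else 0

/-- The exponent that belongs to a power of the generator and the monomial in a term. -/
def termExp (n : ℕ) (I : ℕ → ℕ) (N e j : ℕ) : ℕ :=
  j + ∑ l ∈ Finset.range n, I (termPos n I e + l) * base n I N ^ (l + 1)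

/-- The coefficients of the lift of `f`. -/
def fCoeff (n : ℕ) (I : ℕ → ℕ) (N x : ℕ) : ℕ :=
  ∑ e ∈ Finset.range (I (3 + I 2)), ∑ j ∈ Finset.range (I 2),
    if x = termExp n I N e j then I (termPos n I e + n + j) else 0

/-- The coefficients of the factor with number `t` of the product with code `τ`. -/
def factorCoeff (n : ℕ) (I : ℕ → ℕ) (N τ t x : ℕ) : ℕ :=
  if t < powExp I N then (if τ % 2 = 1 then muCoeff I N x else if x = 0 then 1 else 0)
  else if τ / 2 = 1 then fCoeff n I N x else if x = 0 then 1 else 0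

/-- The number of coefficients that matter. -/
def numCoeff (n : ℕ) (I : ℕ → ℕ) (N : ℕ) : ℕ := base n I N ^ (n + 1)

/-- The recursion for the coefficients of the partial products. -/
def prodStep (n : ℕ) (I : ℕ → ℕ) (N τ s : ℕ) (S : ℕ → ℕ) : ℕ :=
  if s < numCoeff n I N then if s = 0 then 1 else 0 else
    ∑ y ∈ Finset.range (s % numCoeff n I N + 1),
      S ((s / numCoeff n I N - 1) * numCoeff n I N + (s % numCoeff n I N - y)) *
        factorCoeff n I N τ (s / numCoeff n I N - 1) y

/-- The coefficients of the product with code `τ`. -/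
def prodCoeff (n : ℕ) (I : ℕ → ℕ) (N τ x : ℕ) : ℕ :=
  RAM.table (fun s S => prodStep n I N τ s S % (N - 1 + 1)) ((2 * powExp I N + 1) * numCoeff n I N)
    (2 * powExp I N * numCoeff n I N + x)

/-- The exponent of the Kronecker substitution that belongs to a number with digits with base
`boxSize`. -/
def expCode (n : ℕ) (I : ℕ → ℕ) (N i : ℕ) : ℕ :=
  ∑ l ∈ Finset.range (n + 1), i / boxSize n I N ^ l % boxSize n I N * base n I N ^ l

/-- The weight of the block with number `t`. -/
def weight (n : ℕ) (I : ℕ → ℕ) (z t : ℕ) : ℕ :=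
  if (t / 2 ^ (n + 1) % 2 + t / 2 ^ (n + 1) / 2 + digitSum (n + 1) (t % 2 ^ (n + 1))) % 2 = z then
    ∑ s ∈ Finset.range (n + 2),
      if s = n + 1 - digitSum (n + 1) (t % 2 ^ (n + 1)) then I 0 ^ s else 0
  else 0

/-- The size of the blocks. -/
def blockSize (n : ℕ) (I : ℕ → ℕ) (N : ℕ) : ℕ := boxSize n I N ^ (n + 1)

/-- The entries of the matrix with sign `z`. -/
def entry (n : ℕ) (I : ℕ → ℕ) (N z i j : ℕ) : ℕ :=
  if i / blockSize n I N = j / blockSize n I N then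
    if I 0 * expCode n I N (i % blockSize n I N) < expCode n I N (j % blockSize n I N) then 0 else
      weight n I z (i / blockSize n I N) *
        prodCoeff n I N (i / blockSize n I N / 2 ^ (n + 1))
          (I 0 * expCode n I N (i % blockSize n I N) - expCode n I N (j % blockSize n I N))
  else 0

/-- The size of the matrices. -/
def matSize (n : ℕ) (I : ℕ → ℕ) (N : ℕ) : ℕ := 4 * 2 ^ (n + 1) * blockSize n I N

/-- The position in the table of the weight of the walks of length `k` with end point `x`. -/
def walkPos (n : ℕ) (I : ℕ → ℕ) (N J k x : ℕ) : ℕ :=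
  (J * (I 2 * matSize n I N + 1) + k) * matSize n I N + x

/-- The coefficients of the determinant for the leading square blocks, as stored in the table. -/
def detStored (n : ℕ) (I : ℕ → ℕ) (N : ℕ) (S : ℕ → ℕ) (J k : ℕ) : ℕ :=
  if J = 0 then if k = 0 then 1 else 0 else S (walkPos n I N (J - 1) k (J - 1))

/-- The recursion for the weights of the walks. -/
def walkStep (n : ℕ) (I : ℕ → ℕ) (N z : ℕ) (S : ℕ → ℕ) (J k x : ℕ) : ℕ :=
  if k = 0 then 0 else
    ∑ y ∈ Finset.range J, S (walkPos n I N J (k - 1) y) * entry n I N z y x +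
      detStored n I N S J (k - 1) * entry n I N z J x

/-- The recursion for the table of the weights of the walks and of the coefficients of the
determinants. -/
def detStep (n : ℕ) (I : ℕ → ℕ) (N z : ℕ) (S : ℕ → ℕ) (J k x : ℕ) : ℕ :=
  if x = J then detStored n I N S J k + (N - 1) * walkStep n I N z S J k J
  else walkStep n I N z S J k x

/-- The coefficients of the reverse characteristic polynomial of the matrix with sign `z`. -/
def zetaCoeff (n : ℕ) (I : ℕ → ℕ) (N z k : ℕ) : ℕ :=
  RAM.table (fun s S => detStep n I N z S (s / matSize n I N / (I 2 * matSize n I N + 1))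
      (s / matSize n I N % (I 2 * matSize n I N + 1)) (s % matSize n I N) % (N - 1 + 1))
    (walkPos n I N (matSize n I N) 0 0) (walkPos n I N (matSize n I N - 1) k (matSize n I N - 1))

/-- The number of coefficients of the numerator and of the denominator. -/
def numOut (n : ℕ) (I : ℕ → ℕ) (N : ℕ) : ℕ := matSize n I N + 1

/-- The output. -/
def outputAt (n : ℕ) (I : ℕ → ℕ) (N i : ℕ) : ℕ :=
  if i = 0 then numOut n I N
  else if i < numOut n I N + 1 then zetaCoeff n I N 1 (I 2 * (i - 1))
  else if i = numOut n I N + 1 then numOut n I N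
  else zetaCoeff n I N 0 (I 2 * (i - (numOut n I N + 2)))

/-! ### Terms for the algorithm -/

section

variable (n : ℕ) {l : ℕ}

theorem definable_termPos : Definable l fun α ρ => termPos n (α 0) (ρ 0) := by
  unfold termPos
  repeat' first
    | exact .const _ | exact .var _ | apply Definable.add | apply Definable.mul
    | refine Definable.look (by norm_num) ?_

theorem definable_degSum : Definable l fun α _ => degSum n (α 0) := by
  refine Definable.sum (Definable.look (by norm_num) ((Definable.const 3).add
    (Definable.look (by norm_num) (.const 2)))) (.sum_const n fun i => ?_)
  exact Definable.look (by norm_num) (((definable_termPos n).comp₁ (.var 0)).add (.const _))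

theorem definable_powExp : Definable l fun α _ => powExp (α 0) (α 1 0) := by
  unfold powExp
  repeat' first
    | exact .const _ | apply Definable.sub | apply Definable.mul
    | refine Definable.look (by norm_num) ?_

theorem definable_boxSize : Definable l fun α _ => boxSize n (α 0) (α 1 0) :=
  (((Definable.const 2).mul ((definable_degSum n).add (.look (by norm_num) (.const 2)))).mul
    definable_powExp).add (.const 1)

theorem definable_base : Definable l fun α _ => base n (α 0) (α 1 0) :=
  (Definable.look (by norm_num) (.const 0)).mul (definable_boxSize n)

theorem definable_muCoeff : Definable l fun α ρ => muCoeff (α 0) (α 1 0) (ρ 0) := by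
  unfold muCoeff
  repeat' first
    | exact .const _ | exact .var _ | apply Definable.ite_lt | apply Definable.ite_eq
    | apply Definable.add | apply Definable.sub | refine Definable.look (by norm_num) ?_

theorem definable_termExp : Definable l fun α ρ => termExp n (α 0) (α 1 0) (ρ 0) (ρ 1) :=
  (Definable.var 1).add (.sum_const n fun _ => (Definable.look (by norm_num)
    ((definable_termPos n).add (.const _))).mul ((definable_base n).pow _))

theorem definable_fCoeff : Definable l fun α ρ => fCoeff n (α 0) (α 1 0) (ρ 0) := by
  refine Definable.sum (Definable.look (by norm_num) ((Definable.const 3).add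
    (Definable.look (by norm_num) (.const 2)))) (.sum (Definable.look (by norm_num) (.const 2)) ?_)
  exact .ite_eq (.var _) (.comp₂ (G := fun α => termExp n (α 0) (α 1 0)) (definable_termExp n)
    (.var _) (.var _)) (.look (by norm_num) ((((definable_termPos n).comp₁ (.var _)).add
    (.const _)).add (.var _))) (.const 0)

theorem definable_factorCoeff :
    Definable l fun α ρ => factorCoeff n (α 0) (α 1 0) (ρ 0) (ρ 1) (ρ 2) :=
  .ite_lt (.var 1) definable_powExp
    (.ite_eq (.mod (.var 0) (.const 2)) (.const 1)
      (.comp₁ (G := fun α => muCoeff (α 0) (α 1 0)) definable_muCoeff (.var 2))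
      (.ite_eq (.var 2) (.const 0) (.const 1) (.const 0)))
    (.ite_eq (.div (.var 0) (.const 2)) (.const 1)
      (.comp₁ (G := fun α => fCoeff n (α 0) (α 1 0)) (definable_fCoeff n) (.var 2))
      (.ite_eq (.var 2) (.const 0) (.const 1) (.const 0)))

theorem definable_numCoeff : Definable l fun α _ => numCoeff n (α 0) (α 1 0) :=
  (definable_base n).pow _

/-- The products go to array `3`, because they are needed inside the body of the table in array `2`.
They are recomputed for every matrix entry, which a polynomial bound permits. -/
theorem definable_prodCoeff {l : ℕ} (hl : l ≤ 3) :
    Definable l fun α ρ => prodCoeff n (α 0) (α 1 0) (ρ 0) (ρ 1) := by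
  have hL {l : ℕ} : Definable l fun α _ => numCoeff n (α 0) (α 1 0) := definable_numCoeff n
  have hE {l : ℕ} : Definable l fun α _ => powExp (α 0) (α 1 0) := definable_powExp
  refine (Definable.table (a := 3)
    (G := fun α ρ t => prodStep n (α 0) (α 1 0) (ρ 0) t (α 3)) hl (by norm_num)
    ((((Definable.const 2).mul hE).add (.const 1)).mul hL)
    ((Definable.look (a := 1) (by norm_num) (.const 0)).sub (.const 1)) ?_
    ((((Definable.const 2).mul hE).mul hL).add (.var 1))).congr fun α ρ => ?_
  · refine .ite_lt (.var 0) hL (.ite_eq (.var 0) (.const 0) (.const 1) (.const 0))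
      (.sum ((Definable.mod (.var 0) hL).add (.const 1)) (.mul (.look (a := 3) (by norm_num) ?_)
      (.comp₃ (G := fun α => factorCoeff n (α 0) (α 1 0)) (definable_factorCoeff n) (.var _)
        ((Definable.div (.var _) hL).sub (.const 1)) (.var _))))
    exact ((((Definable.div (.var _) hL).sub (.const 1)).mul hL).add
      ((Definable.mod (.var _) hL).sub (.var _)))
  · simp [prodCoeff]

theorem definable_expCode : Definable l fun α ρ => expCode n (α 0) (α 1 0) (ρ 0) :=
  .sum_const (n + 1) fun l => ((((Definable.var 0).div ((definable_boxSize n).pow l)).mod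
    (definable_boxSize n)).mul ((definable_base n).pow l))

theorem definable_weight : Definable l fun α ρ => weight n (α 0) (ρ 0) (ρ 1) := by
  have h2 : Definable l fun _ _ => 2 ^ (n + 1) := .const _
  have ht : Definable l fun _ ρ => ρ 1 / 2 ^ (n + 1) := (Definable.var 1).div h2
  have hS : Definable l fun _ ρ => digitSum (n + 1) (ρ 1 % 2 ^ (n + 1)) :=
    ((Definable.var 1).mod h2).digitSum _
  exact .ite_eq ((((ht.mod (.const 2)).add (ht.div (.const 2))).add hS).mod (.const 2)) (.var 0)
    (.sum_const _ fun s => .ite_eq (.const s) ((Definable.const (n + 1)).sub hS)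
      ((Definable.look (by norm_num) (.const 0)).pow s) (.const 0)) (.const 0)

theorem definable_blockSize : Definable l fun α _ => blockSize n (α 0) (α 1 0) :=
  (definable_boxSize n).pow _

theorem definable_entry {l : ℕ} (hl : l ≤ 3) :
    Definable l fun α ρ => entry n (α 0) (α 1 0) (ρ 0) (ρ 1) (ρ 2) := by
  have hB {l : ℕ} : Definable l fun α _ => blockSize n (α 0) (α 1 0) := definable_blockSize n
  have hp : Definable l fun α _ => α 0 0 := .look (by norm_num) (.const 0)
  have hc (i : ℕ) : Definable l fun α ρ =>
      expCode n (α 0) (α 1 0) (ρ i % blockSize n (α 0) (α 1 0)) :=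
    .comp₁ (G := fun α => expCode n (α 0) (α 1 0)) (definable_expCode n)
      ((Definable.var i).mod hB)
  exact .ite_eq ((Definable.var 1).div hB) ((Definable.var 2).div hB)
    (.ite_lt (hp.mul (hc 1)) (hc 2) (.const 0)
      ((Definable.comp₂ (G := fun α => weight n (α 0)) (definable_weight n) (.var 0)
        ((Definable.var 1).div hB)).mul
      (Definable.comp₂ (G := fun α => prodCoeff n (α 0) (α 1 0)) (definable_prodCoeff n hl)
        (((Definable.var 1).div hB).div (.const (2 ^ (n + 1)))) ((hp.mul (hc 1)).sub (hc 2)))))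
    (.const 0)

theorem definable_matSize : Definable l fun α _ => matSize n (α 0) (α 1 0) :=
  (Definable.const (4 * 2 ^ (n + 1))).mul (definable_blockSize n)

theorem definable_walkPos :
    Definable l fun α ρ => walkPos n (α 0) (α 1 0) (ρ 0) (ρ 1) (ρ 2) :=
  ((((Definable.var 0).mul (((Definable.look (by norm_num) (.const 2)).mul
    (definable_matSize n)).add (.const 1))).add (.var 1)).mul (definable_matSize n)).add (.var 2)

theorem definable_zetaCoeff :
    Definable 2 fun α ρ => zetaCoeff n (α 0) (α 1 0) (ρ 0) (ρ 1) := by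
  have hM {l : ℕ} : Definable l fun α _ => matSize n (α 0) (α 1 0) := definable_matSize n
  have hK {l : ℕ} : Definable l fun α _ => α 0 2 * matSize n (α 0) (α 1 0) + 1 :=
    ((Definable.look (by norm_num) (.const 2)).mul hM).add (.const 1)
  have hP {l : ℕ} {F₁ F₂ F₃ : (ℕ → ℕ → ℕ) → (ℕ → ℕ) → ℕ} (h₁ : Definable l F₁)
      (h₂ : Definable l F₂) (h₃ : Definable l F₃) :
      Definable l fun α ρ => walkPos n (α 0) (α 1 0) (F₁ α ρ) (F₂ α ρ) (F₃ α ρ) :=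
    .comp₃ (G := fun α => walkPos n (α 0) (α 1 0)) (definable_walkPos n) h₁ h₂ h₃
  have hE {F₁ F₂ F₃ : (ℕ → ℕ → ℕ) → (ℕ → ℕ) → ℕ} (h₁ : Definable 3 F₁)
      (h₂ : Definable 3 F₂) (h₃ : Definable 3 F₃) :
      Definable 3 fun α ρ => entry n (α 0) (α 1 0) (F₁ α ρ) (F₂ α ρ) (F₃ α ρ) :=
    .comp₃ (G := fun α => entry n (α 0) (α 1 0)) (definable_entry n le_rfl) h₁ h₂ h₃
  have hD {F₁ F₂ : (ℕ → ℕ → ℕ) → (ℕ → ℕ) → ℕ} (h₁ : Definable 3 F₁) (h₂ : Definable 3 F₂) :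
      Definable 3 fun α ρ => detStored n (α 0) (α 1 0) (α 2) (F₁ α ρ) (F₂ α ρ) :=
    .ite_eq h₁ (.const 0) (.ite_eq h₂ (.const 0) (.const 1) (.const 0))
      (.look (by norm_num) (hP (h₁.sub (.const 1)) h₂ (h₁.sub (.const 1))))
  have hW {F₁ F₂ F₃ F₄ : (ℕ → ℕ → ℕ) → (ℕ → ℕ) → ℕ} (h₁ : Definable 3 F₁)
      (h₂ : Definable 3 F₂) (h₃ : Definable 3 F₃) (h₄ : Definable 3 F₄) :
      Definable 3 fun α ρ =>
        walkStep n (α 0) (α 1 0) (F₁ α ρ) (α 2) (F₂ α ρ) (F₃ α ρ) (F₄ α ρ) :=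
    .ite_eq h₃ (.const 0) (.const 0) (.add (.sum h₂ (.mul (.look (by norm_num)
      (hP (h₂.ren (· + 1)) ((h₃.ren (· + 1)).sub (.const 1)) (.var 0)))
        (hE (h₁.ren (· + 1)) (.var 0) (h₄.ren (· + 1)))))
      ((hD h₂ (h₃.sub (.const 1))).mul (hE h₁ h₂ h₄)))
  have hJ : Definable 3 fun α ρ =>
      ρ 0 / matSize n (α 0) (α 1 0) / (α 0 2 * matSize n (α 0) (α 1 0) + 1) :=
    ((Definable.var 0).div hM).div hK
  have hk : Definable 3 fun α ρ =>
      ρ 0 / matSize n (α 0) (α 1 0) % (α 0 2 * matSize n (α 0) (α 1 0) + 1) :=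
    ((Definable.var 0).div hM).mod hK
  have hx : Definable 3 fun α ρ => ρ 0 % matSize n (α 0) (α 1 0) := (Definable.var 0).mod hM
  have hN {l : ℕ} : Definable l fun α _ => α 1 0 - 1 :=
    (Definable.look (by norm_num) (.const 0)).sub (.const 1)
  refine (Definable.table (a := 2)
    (G := fun α ρ s => detStep n (α 0) (α 1 0) (ρ 0) (α 2)
      (s / matSize n (α 0) (α 1 0) / (α 0 2 * matSize n (α 0) (α 1 0) + 1))
      (s / matSize n (α 0) (α 1 0) % (α 0 2 * matSize n (α 0) (α 1 0) + 1))
      (s % matSize n (α 0) (α 1 0))) le_rfl (by norm_num)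
    (hP hM (.const 0) (.const 0)) hN ?_
    (hP (hM.sub (.const 1)) (.var 1) (hM.sub (.const 1)))).congr fun α ρ => ?_
  · exact .ite_eq hx hJ ((hD hJ hk).add (hN.mul (hW (.var 1) hJ hk hJ))) (hW (.var 1) hJ hk hx)
  · simp [zetaCoeff]

theorem definable_numOut : Definable l fun α _ => numOut n (α 0) (α 1 0) :=
  (definable_matSize n).add (.const 1)

theorem definable_outputAt : Definable 2 fun α ρ => outputAt n (α 0) (α 1 0) (ρ 0) := by
  have hO : Definable 2 fun α _ => numOut n (α 0) (α 1 0) := definable_numOut n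
  have hZ (z : ℕ) {F : (ℕ → ℕ → ℕ) → (ℕ → ℕ) → ℕ} (h : Definable 2 F) :
      Definable 2 fun α ρ => zetaCoeff n (α 0) (α 1 0) z (α 0 2 * F α ρ) :=
    .comp₂ (G := fun α => zetaCoeff n (α 0) (α 1 0)) (definable_zetaCoeff n) (.const z)
      ((Definable.look (by norm_num) (.const 2)).mul h)
  exact .ite_eq (.var 0) (.const 0) hO (.ite_lt (.var 0) (hO.add (.const 1))
    (hZ 1 ((Definable.var 0).sub (.const 1))) (.ite_eq (.var 0) (hO.add (.const 1)) hO
    (hZ 0 ((Definable.var 0).sub (hO.add (.const 2))))))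

end

end RAM

namespace RAM

/-! ## The coefficients of the products -/

open scoped PowerSeries

theorem table_apply_of_lt {f : ℕ → (ℕ → ℕ) → ℕ} {i s : ℕ} (h : i < s) {n : ℕ} (hn : s ≤ n) :
    table f s i = table f n i := (table_stable h hn).symm

section

variable (n : ℕ) (I : ℕ → ℕ) {N : ℕ}

theorem one_le_boxSize : 1 ≤ boxSize n I N := Nat.le_add_left _ _

theorem numCoeff_pos (hp : 0 < I 0) : 0 < numCoeff n I N :=
  pow_pos (Nat.mul_pos hp (one_le_boxSize n I)) _

/-- With `L` the number of coefficients kept, position `t * L + x` of the table holds coefficient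
`x` of the product of the first `t` factors. Truncation at `L` is harmless, since lower coefficients
of a product depend only on lower ones. -/
theorem prodCoeff_eq (hN : 0 < N) (hp : 0 < I 0) (τ : ℕ) {x : ℕ} (hx : x < numCoeff n I N) :
    (prodCoeff n I N τ x : ZMod N) = PowerSeries.coeff x (∏ t ∈ Finset.range (2 * powExp I N),
      PowerSeries.mk fun y => (factorCoeff n I N τ t y : ZMod N)) := by
  have hL := numCoeff_pos n I (N := N) hp
  have hN1 : N - 1 + 1 = N := by omega
  unfold prodCoeff
  rw [hN1]
  set L := numCoeff n I N with hLdef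
  set f : ℕ → (ℕ → ℕ) → ℕ := fun s S => prodStep n I N τ s S % N with hf
  have hfs (s : ℕ) (S : ℕ → ℕ) : f s S = prodStep n I N τ s S % N := rfl
  set T := table f ((2 * powExp I N + 1) * L) with hT
  suffices h : ∀ t ≤ 2 * powExp I N, ∀ x < L, (T (t * L + x) : ZMod N) =
      PowerSeries.coeff x (∏ t ∈ Finset.range t,
        PowerSeries.mk fun y => (factorCoeff n I N τ t y : ZMod N)) from h _ le_rfl x hx
  intro t
  induction t with
  | zero =>
    intro _ x hx
    have h0 : 0 * L + x < (2 * powExp I N + 1) * L := by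
      rw [zero_mul, zero_add, add_mul, one_mul]
      omega
    rw [hT, table_eq h0, zero_mul, zero_add, hfs]
    simp only [prodStep, ← hLdef]
    rw [if_pos hx, ZMod.natCast_mod, Finset.range_zero, Finset.prod_empty,
      PowerSeries.coeff_one]
    split_ifs <;> simp
  | succ t ih =>
    intro ht x hx
    have h0 : (t + 1) * L + x < (2 * powExp I N + 1) * L := by
      have : (t + 1) * L ≤ 2 * powExp I N * L := Nat.mul_le_mul_right _ ht
      rw [add_mul (2 * powExp I N), one_mul]
      omega
    have h1 : ((t + 1) * L + x) % L = x := by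
      rw [Nat.mul_add_mod', Nat.mod_eq_of_lt hx]
    have h2 : ((t + 1) * L + x) / L = t + 1 := by
      rw [mul_comm, Nat.mul_add_div hL, Nat.div_eq_of_lt hx, add_zero]
    have h3 : ¬ (t + 1) * L + x < L := by
      rw [add_mul, one_mul]
      omega
    rw [hT, table_eq h0, hfs]
    simp only [prodStep, ← hLdef]
    rw [if_neg h3, h1, h2, ZMod.natCast_mod, Nat.add_sub_cancel, Finset.prod_range_succ,
      PowerSeries.coeff_mul, ← Finset.Nat.sum_antidiagonal_swap,
      Finset.Nat.sum_antidiagonal_eq_sum_range_succ_mk, Nat.cast_sum]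
    refine Finset.sum_congr rfl fun y hy => ?_
    have hy' := Finset.mem_range.1 hy
    rw [table_apply_of_lt (n := (2 * powExp I N + 1) * L) _ h0.le, ← hT, Nat.cast_mul,
      ih (by omega) _ (by omega)]
    · simp [PowerSeries.coeff_mk]
    · rw [add_mul, one_mul]
      omega

/-- A polynomial that is missing from the product with code `τ` is replaced by factors `1`, so that
the table has the same shape for every `τ`. -/
theorem prod_factorCoeff (τ : ℕ) (hτ : τ < 4) :
    (∏ t ∈ Finset.range (2 * powExp I N),
      PowerSeries.mk fun y => (factorCoeff n I N τ t y : ZMod N)) =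
    (PowerSeries.mk fun y => (muCoeff I N y : ZMod N)) ^ (τ % 2 * powExp I N) *
      (PowerSeries.mk fun y => (fCoeff n I N y : ZMod N)) ^ (τ / 2 * powExp I N) := by
  have h1 : (PowerSeries.mk fun y => (((if y = 0 then 1 else 0 : ℕ)) : ZMod N)) = 1 := by
    ext y
    rw [PowerSeries.coeff_mk, PowerSeries.coeff_one]
    split_ifs <;> simp
  rw [two_mul, Finset.prod_range_add]
  congr 1
  · rw [Finset.prod_congr rfl fun t ht => by
      rw [show (fun y => (factorCoeff n I N τ t y : ZMod N)) = fun y =>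
        ((if τ % 2 = 1 then muCoeff I N y else if y = 0 then 1 else 0 : ℕ) : ZMod N) from
        funext fun y => by rw [factorCoeff, if_pos (Finset.mem_range.1 ht)]], Finset.prod_const,
      Finset.card_range]
    rcases Nat.mod_two_eq_zero_or_one τ with h | h
    · simp only [h, zero_ne_one, if_false, zero_mul, pow_zero]
      rw [h1, one_pow]
    · simp only [h, if_true, one_mul]
  · rw [Finset.prod_congr rfl fun t _ => by
      rw [show (fun y => (factorCoeff n I N τ (powExp I N + t) y : ZMod N)) = fun y =>
        ((if τ / 2 = 1 then fCoeff n I N y else if y = 0 then 1 else 0 : ℕ) : ZMod N) from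
        funext fun y => by rw [factorCoeff, if_neg (by omega)]], Finset.prod_const,
      Finset.card_range]
    obtain h | h : τ / 2 = 0 ∨ τ / 2 = 1 := by omega
    · simp only [h, zero_ne_one, if_false, zero_mul, pow_zero]
      rw [h1, one_pow]
    · simp only [h, if_true, one_mul]

/-! ## The coefficients of the determinants -/

theorem matSize_pos : 0 < matSize n I N := by
  have := one_le_boxSize n I (N := N)
  unfold matSize blockSize
  positivity

/-- The positions `(J, k, x)` are filled in lexicographic order, so each step reads only earlier
entries. Entries with `x < J` are weights of walks; the entry with `x = J` is reused for the
determinant of size `J + 1`, with `N - 1` playing the role of `-1`. -/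
theorem zetaCoeff_eq (hN : 0 < N) (z : ℕ) {k : ℕ} (hk : k ≤ I 2 * matSize n I N) :
    (zetaCoeff n I N z k : ZMod N) =
      detCoeff (fun i j => (entry n I N z i j : ZMod N)) (matSize n I N) k := by
  have hM := matSize_pos n I (N := N)
  have hN1 : N - 1 + 1 = N := by omega
  unfold zetaCoeff
  rw [hN1]
  set M := matSize n I N with hMdef
  set B : ℕ → ℕ → ZMod N := fun i j => (entry n I N z i j : ZMod N) with hB
  set R := I 2 * M + 1 with hR
  set f : ℕ → (ℕ → ℕ) → ℕ := fun s S =>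
    detStep n I N z S (s / M / R) (s / M % R) (s % M) % N with hf
  have hfs (s : ℕ) (S : ℕ → ℕ) :
      f s S = detStep n I N z S (s / M / R) (s / M % R) (s % M) % N := rfl
  set T := table f (walkPos n I N M 0 0) with hT
  have hpos (J k x : ℕ) : walkPos n I N J k x = (J * R + k) * M + x := rfl
  have hdec {J k x : ℕ} (hk : k < R) (hx : x < M) :
      walkPos n I N J k x / M / R = J ∧ walkPos n I N J k x / M % R = k ∧
        walkPos n I N J k x % M = x := by
    rw [hpos]
    have h1 : ((J * R + k) * M + x) / M = J * R + k := by
      rw [mul_comm, Nat.mul_add_div hM, Nat.div_eq_of_lt hx, add_zero]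
    rw [h1, Nat.mul_add_mod', Nat.mul_add_mod', Nat.mod_eq_of_lt hx, Nat.mod_eq_of_lt hk]
    refine ⟨?_, rfl, rfl⟩
    rw [mul_comm, Nat.mul_add_div (by omega), Nat.div_eq_of_lt hk, add_zero]
  have hlt {J k x J' k' x' : ℕ} (hk : k < R) (hx : x < M) (h : J < J' ∨ J = J' ∧ k < k') :
      walkPos n I N J k x < walkPos n I N J' k' x' := by
    rw [hpos, hpos]
    have h1 : J * R + k + 1 ≤ J' * R + k' := by
      rcases h with h | ⟨rfl, h⟩
      · have : (J + 1) * R ≤ J' * R := Nat.mul_le_mul_right _ h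
        rw [add_mul, one_mul] at this
        omega
      · omega
    have h2 := Nat.mul_le_mul_right M h1
    rw [add_mul (J * R + k), one_mul] at h2
    omega
  have hval {J k x : ℕ} (hJ : J < M) (hk : k < R) (hx : x < M) :
      (T (walkPos n I N J k x) : ZMod N) =
        (detStep n I N z (table f (walkPos n I N J k x)) J k x : ℕ) := by
    have h0 : walkPos n I N J k x < walkPos n I N M 0 0 := hlt hk hx (Or.inl hJ)
    rw [hT, table_eq h0, hfs, (hdec hk hx).1, (hdec hk hx).2.1, (hdec hk hx).2.2,
      ZMod.natCast_mod]
  suffices h : ∀ J ≤ M, ∀ k < R, ((detStored n I N T J k : ℕ) : ZMod N) = detCoeff B J k by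
    have h1 := h M le_rfl k (by omega)
    rwa [detStored, if_neg hM.ne'] at h1
  intro J
  induction J with
  | zero =>
    intro _ k _
    rw [detStored, if_pos rfl, detCoeff]
    by_cases hk : k = 0 <;> simp [hk]
  | succ J ihJ =>
    intro hJ
    have hDs {k x k' : ℕ} (hk : k < R) (hk' : k' < R) (hx : x < M) :
        detStored n I N (table f (walkPos n I N J k x)) J k' = detStored n I N T J k' := by
      unfold detStored
      split_ifs with h1
      · rfl
      · rfl
      · exact table_apply_of_lt (hlt hk' (by omega) (Or.inl (by omega)))
          (hlt hk hx (Or.inl hJ)).le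
    have hwalk (k : ℕ) : k < R → ∀ x ≤ J, ∀ y < M,
        ((walkStep n I N z (table f (walkPos n I N J k y)) J k x : ℕ) : ZMod N) =
          walks B J (detCoeff B J) k x := by
      induction k with
      | zero =>
        intro _ x _ y _
        rw [walkStep, if_pos rfl, walks, Nat.cast_zero]
      | succ k ihk =>
        intro hk x hx y hy
        rw [walkStep, if_neg k.succ_ne_zero, Nat.add_sub_cancel, walks,
          hDs hk (by omega) hy, Nat.cast_add, Nat.cast_mul, ihJ (by omega) k (by omega),
          Nat.cast_sum]
        congr 1
        refine Finset.sum_congr rfl fun w hw => ?_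
        have hw' := Finset.mem_range.1 hw
        rw [table_apply_of_lt (n := walkPos n I N M 0 0)
          (hlt (by omega) (by omega) (Or.inr ⟨rfl, by omega⟩)) (hlt hk hy (Or.inl hJ)).le, ← hT,
          Nat.cast_mul, hval hJ (by omega) (by omega), detStep, if_neg hw'.ne,
          ihk (by omega) w hw'.le w (by omega)]
    intro k hk
    rw [detStored, if_neg J.succ_ne_zero, Nat.add_sub_cancel, hval hJ hk hJ, detStep, if_pos rfl,
      hDs hk hk hJ, Nat.cast_add, Nat.cast_mul, ihJ (by omega) k hk, hwalk k hk J le_rfl J hJ,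
      detCoeff, Nat.cast_sub hN, ZMod.natCast_self]
    push_cast
    ring

theorem zetaCoeff_lt (hN : 0 < N) (z k : ℕ) : zetaCoeff n I N z k < N := by
  refine lt_of_le_of_lt (table_le (M := N - 1) (fun t S => ?_) _ _) (by omega)
  exact Nat.le_of_lt_succ (Nat.mod_lt _ (by omega))

end

end RAM

/-! ## Kronecker substitution -/

section Kronecker

variable {r : ℕ}

/-- The value of an exponent vector under the Kronecker substitution with base `W`. -/
def expValue (W : ℕ) (w : Fin r →₀ ℕ) : ℕ := ∑ l : Fin r, w l * W ^ (l : ℕ)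

/-- The Kronecker substitution. -/
noncomputable def kronecker (W : ℕ) : MvPolynomial (Fin r) ℤ →ₐ[ℤ] ℤ[X] :=
  MvPolynomial.aeval fun l => X ^ W ^ (l : ℕ)

theorem kronecker_monomial (W : ℕ) (w : Fin r →₀ ℕ) (c : ℤ) :
    kronecker W (MvPolynomial.monomial w c) = monomial (expValue W w) c := by
  rw [kronecker, MvPolynomial.aeval_monomial, Finsupp.prod_fintype _ _ (fun _ => pow_zero _),
    ← C_mul_X_pow_eq_monomial, expValue]
  simp only [← pow_mul, Finset.prod_pow_eq_pow_sum, mul_comm (W ^ _)]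
  rfl

theorem expValue_injOn {W : ℕ} {v w : Fin r →₀ ℕ} (hv : ∀ l, v l < W) (hw : ∀ l, w l < W)
    (h : expValue W v = expValue W w) : v = w := by
  have h1 : finFunctionFinEquiv (fun l => (⟨v l, hv l⟩ : Fin W)) =
      finFunctionFinEquiv fun l => (⟨w l, hw l⟩ : Fin W) := by
    ext
    rw [finFunctionFinEquiv_apply, finFunctionFinEquiv_apply]
    exact h
  ext l
  exact congrArg Fin.val (congrFun (finFunctionFinEquiv.injective h1) l)

theorem coeff_kronecker {W : ℕ} {ψ : MvPolynomial (Fin r) ℤ} (hψ : ∀ w ∈ ψ.support, ∀ l, w l < W)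
    {w : Fin r →₀ ℕ} (hw : ∀ l, w l < W) :
    (kronecker W ψ).coeff (expValue W w) = ψ.coeff w := by
  conv_lhs => rw [ψ.as_sum]
  rw [map_sum, finsetSum_coeff]
  simp only [kronecker_monomial, coeff_monomial]
  rw [Finset.sum_eq_single w]
  · rw [if_pos rfl]
  · intro v hv hvw
    exact if_neg fun h => hvw (expValue_injOn (hψ v hv) hw h)
  · intro hw'
    rw [if_pos rfl, MvPolynomial.notMem_support_iff.1 hw']

/-- The exponents of `x ^ v φ` are below `2 V ≤ p V`, and so are those of `x ^ (p u)` below `p V`.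
In base `p V` there are no carries, and the coefficient can be read off after the substitution. -/
theorem dworkMatrix_apply_eq_coeff_kronecker {p V : ℕ} (hp : 2 ≤ p) {φ : MvPolynomial (Fin r) ℤ}
    (hφ : ∀ w ∈ φ.support, ∀ l, w l < V) (u v : Fin r → Fin V) :
    dworkMatrix p V φ u v = if expValue (p * V) (toExp v) ≤ p * expValue (p * V) (toExp u) then
      (kronecker (p * V) φ).coeff
        (p * expValue (p * V) (toExp u) - expValue (p * V) (toExp v)) else 0 := by
  have h1 : expValue (p * V) (p • toExp u) = p * expValue (p * V) (toExp u) := by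
    simp only [expValue, Finset.mul_sum, Finsupp.smul_apply, smul_eq_mul, mul_assoc]
  have h2 : kronecker (p * V) (MvPolynomial.monomial (toExp v) 1 * φ) =
      X ^ expValue (p * V) (toExp v) * kronecker (p * V) φ := by
    rw [map_mul, kronecker_monomial, ← C_mul_X_pow_eq_monomial, C_1, one_mul]
  rw [← coeff_X_pow_mul', ← h1, ← h2, coeff_kronecker]
  · rfl
  · intro w hw l
    have hw' := MvPolynomial.support_mul _ _ hw
    obtain ⟨w₁, h₁, w₂, h₂, rfl⟩ := Finset.mem_add.1 hw'
    rw [MvPolynomial.support_monomial, if_neg one_ne_zero, Finset.mem_singleton] at h₁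
    subst h₁
    have h3 := hφ w₂ h₂ l
    have h4 := (v l).2
    rw [Finsupp.add_apply, toExp_apply]
    have : 2 * V ≤ p * V := Nat.mul_le_mul_right V hp
    omega
  · intro l
    rw [Finsupp.smul_apply, toExp_apply, smul_eq_mul]
    exact Nat.mul_lt_mul_of_pos_left (u l).2 (by omega)

end Kronecker

/-! ### Renumbering of indices, and the degree of the determinant -/

section Reindex

variable {m n R : Type*} [Fintype m] [DecidableEq m] [Fintype n] [DecidableEq n] [CommRing R]

theorem charpolyRev_submatrix_equiv (e : n ≃ m) (A : Matrix m m R) :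
    (A.submatrix e e).charpolyRev = A.charpolyRev := by
  rw [Matrix.charpolyRev, Matrix.charpolyRev, ← Matrix.det_submatrix_equiv_self e]
  congr 1
  ext1 i j
  simp [Matrix.one_apply, e.injective.eq_iff]

theorem coeff_charpolyRev_eq_zero (A : Matrix m m R) {k : ℕ} (hk : Fintype.card m < k) :
    A.charpolyRev.coeff k = 0 := by
  nontriviality R
  rw [← Matrix.reverse_charpoly]
  refine coeff_eq_zero_of_natDegree_lt (lt_of_le_of_lt (reverse_natDegree_le _) ?_)
  rwa [Matrix.charpoly_natDegree_eq_dim]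

end Reindex

/-! ### Integral lifts of the defining polynomials -/

namespace RAM

open scoped PowerSeries

section Lifts

variable (n : ℕ) (I : ℕ → ℕ) (N : ℕ)

/-- The lift of the polynomial that defines the field. -/
noncomputable def muLift : MvPolynomial (Fin (n + 1)) ℤ :=
  ∑ x ∈ Finset.range (I 2 + 1), MvPolynomial.monomial (Finsupp.single 0 x) (muCoeff I N x : ℤ)

/-- The exponents that belong to a power of the generator and the monomial in a term. -/
noncomputable def termVec (e j : ℕ) : Fin (n + 1) →₀ ℕ :=
  Finsupp.equivFunOnFinite.symm (Fin.cons j fun l : Fin n => I (termPos n I e + l))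

/-- The lift of `f`. -/
noncomputable def fLift : MvPolynomial (Fin (n + 1)) ℤ :=
  ∑ e ∈ Finset.range (I (3 + I 2)), ∑ j ∈ Finset.range (I 2),
    MvPolynomial.monomial (termVec n I e j) (I (termPos n I e + n + j) : ℤ)

theorem kronecker_muLift {M : ℕ} (W : ℕ) :
    PowerSeries.map (Int.castRingHom (ZMod M)) (kronecker W (muLift n I N) : ℤ⟦X⟧) =
      PowerSeries.mk fun y => (muCoeff I N y : ZMod M) := by
  ext y
  rw [muLift, PowerSeries.coeff_map, Polynomial.coeff_coe, PowerSeries.coeff_mk, map_sum,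
    finsetSum_coeff]
  have h (x : ℕ) : expValue W (Finsupp.single (0 : Fin (n + 1)) x) = x := by
    rw [expValue, Fin.sum_univ_succ]
    simp
  simp only [kronecker_monomial, h, coeff_monomial, Finset.sum_ite_eq', Finset.mem_range]
  split_ifs with hy
  · simp
  · rw [muCoeff, if_neg (by omega), if_neg (by omega)]
    simp

theorem kronecker_fLift {M : ℕ} :
    PowerSeries.map (Int.castRingHom (ZMod M)) (kronecker (base n I N) (fLift n I) : ℤ⟦X⟧) =
      PowerSeries.mk fun y => (fCoeff n I N y : ZMod M) := by
  ext y
  rw [fLift, PowerSeries.coeff_map, Polynomial.coeff_coe, PowerSeries.coeff_mk, map_sum,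
    finsetSum_coeff, fCoeff, map_sum, Nat.cast_sum]
  refine Finset.sum_congr rfl fun e _ => ?_
  rw [map_sum, finsetSum_coeff, map_sum, Nat.cast_sum]
  refine Finset.sum_congr rfl fun j _ => ?_
  have h : expValue (base n I N) (termVec n I e j) = termExp n I N e j := by
    rw [expValue, Fin.sum_univ_succ, termExp, Finset.sum_range]
    simp [termVec]
  rw [kronecker_monomial, h, coeff_monomial]
  simp only [eq_comm (a := y)]
  split_ifs <;> simp

theorem degreeOf_muLift_le (l : Fin (n + 1)) : (muLift n I N).degreeOf l ≤ I 2 := by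
  refine (MvPolynomial.degreeOf_sum_le _ _ _).trans (Finset.sup_le fun x hx => ?_)
  have hx' := Finset.mem_range.1 hx
  by_cases h : (muCoeff I N x : ℤ) = 0
  · simp [h]
  · rw [MvPolynomial.degreeOf_monomial_eq _ _ h]
    rw [Finsupp.single_apply]
    split_ifs <;> omega

/-- The sum of all exponents in the input is a crude bound for each of them, but a polynomial one;
the second summand takes care of the powers of the generator. -/
theorem degreeOf_fLift_le (l : Fin (n + 1)) : (fLift n I).degreeOf l ≤ degSum n I + I 2 := by
  refine (MvPolynomial.degreeOf_sum_le _ _ _).trans (Finset.sup_le fun e he => ?_)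
  refine (MvPolynomial.degreeOf_sum_le _ _ _).trans (Finset.sup_le fun j hj => ?_)
  have hj' := Finset.mem_range.1 hj
  by_cases h : (I (termPos n I e + n + j) : ℤ) = 0
  · simp [h]
  · rw [MvPolynomial.degreeOf_monomial_eq _ _ h]
    refine Fin.cases ?_ (fun l => ?_) l
    · simp only [termVec, Finsupp.equivFunOnFinite_symm_apply_apply, Fin.cons_zero]
      omega
    · simp only [termVec, Finsupp.equivFunOnFinite_symm_apply_apply, Fin.cons_succ]
      refine le_trans ?_ (Nat.le_add_right _ _)
      refine le_trans ?_ (Finset.single_le_sum (f := fun e => ∑ l ∈ Finset.range n,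
        I (termPos n I e + l)) (fun _ _ => Nat.zero_le _) he)
      exact Finset.single_le_sum (f := fun l => I (termPos n I e + l))
        (fun _ _ => Nat.zero_le _) (Finset.mem_range.2 l.2)

/-- One copy of each lift has degree at most `I 2 + (degSum n I + I 2)` in every variable, which
accounts for the factor `2` in `boxSize`; the final `+ 1` makes the inequality strict. -/
theorem support_subProduct_lt {τ : ℕ} (hτ : τ < 4) :
    ∀ w ∈ (subProduct (muLift n I N) (fLift n I) τ ^ powExp I N).support, ∀ l,
      w l < boxSize n I N := by
  intro w hw l
  refine Nat.lt_succ_of_le ((MvPolynomial.monomial_le_degreeOf l hw).trans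
    ((MvPolynomial.degreeOf_pow_le _ _ _).trans ?_))
  rw [mul_comm]
  refine Nat.mul_le_mul_right _ ((MvPolynomial.degreeOf_mul_le _ _ _).trans ?_)
  have h1 := MvPolynomial.degreeOf_pow_le l (muLift n I N) (τ % 2)
  have h2 := MvPolynomial.degreeOf_pow_le l (fLift n I) (τ / 2)
  have h3 : τ % 2 * (muLift n I N).degreeOf l ≤ 1 * I 2 :=
    Nat.mul_le_mul (by omega) (degreeOf_muLift_le n I N l)
  have h4 : τ / 2 * (fLift n I).degreeOf l ≤ 1 * (degSum n I + I 2) :=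
    Nat.mul_le_mul (by omega) (degreeOf_fLift_le n I l)
  omega

end Lifts

/-! ### The computed numbers are the coefficients for `zetaMatrix` -/

section Link

variable (n : ℕ) (I : ℕ → ℕ) {N : ℕ}

theorem prodCoeff_eq_coeff_kronecker (hN : 0 < N) (hp : 0 < I 0) {τ : ℕ} (hτ : τ < 4) {x : ℕ}
    (hx : x < numCoeff n I N) : (prodCoeff n I N τ x : ZMod N) =
      ((kronecker (base n I N) (subProduct (muLift n I N) (fLift n I) τ ^ powExp I N)).coeff x :
        ℤ) := by
  rw [prodCoeff_eq n I hN hp τ hx, prod_factorCoeff n I τ hτ, ← kronecker_muLift n I N (base n I N),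
    ← kronecker_fLift n I N, ← map_pow, ← map_pow, ← map_mul, PowerSeries.coeff_map, subProduct,
    ← Polynomial.coe_pow, ← Polynomial.coe_pow, ← Polynomial.coe_mul, Polynomial.coeff_coe,
    map_pow, map_mul, map_pow, map_pow, mul_pow, ← pow_mul, ← pow_mul]
  rfl

/-- The numbering of the indices of the matrices. -/
def indexEquiv (r V : ℕ) : (Fin r → Fin V) × (Fin 4 × Fin (2 ^ r)) ≃ Fin (4 * 2 ^ r * V ^ r) :=
  (Equiv.prodComm _ _).trans
    ((Equiv.prodCongr finProdFinEquiv finFunctionFinEquiv).trans finProdFinEquiv)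

theorem indexEquiv_val (r V : ℕ) (u : Fin r → Fin V) (t : Fin 4 × Fin (2 ^ r)) :
    (indexEquiv r V (u, t) : ℕ) =
      finFunctionFinEquiv u + V ^ r * (finProdFinEquiv t : ℕ) := rfl

theorem expCode_eq (u : Fin (n + 1) → Fin (boxSize n I N)) :
    expCode n I N (finFunctionFinEquiv u) = expValue (base n I N) (toExp u) := by
  rw [expCode, expValue, Finset.sum_range]
  refine Finset.sum_congr rfl fun l _ => ?_
  rw [toExp_apply]
  congr 1
  conv_rhs => rw [← finFunctionFinEquiv.symm_apply_apply u]
  rfl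

theorem expValue_lt {r W : ℕ} {w : Fin r →₀ ℕ} (hw : ∀ l, w l < W) : expValue W w < W ^ r :=
  (finFunctionFinEquiv fun l => (⟨w l, hw l⟩ : Fin W)).2

/-- `Definable.pow` allows only constant exponents, so the algorithm selects the power of `p` by a
sum over all the possible exponents. -/
theorem weight_eq (z : ℕ) (t : Fin 4 × Fin (2 ^ (n + 1))) :
    weight n I z (finProdFinEquiv t : ℕ) = blockWeight (I 0) (n + 1) z (t.1, t.2) := by
  have h1 : (finProdFinEquiv t : ℕ) / 2 ^ (n + 1) = t.1 := by
    conv_rhs => rw [← finProdFinEquiv.symm_apply_apply t]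
    rfl
  have h2 : (finProdFinEquiv t : ℕ) % 2 ^ (n + 1) = t.2 := by
    conv_rhs => rw [← finProdFinEquiv.symm_apply_apply t]
    rfl
  rw [weight, blockWeight, h1, h2, Finset.sum_ite_eq', if_pos (Finset.mem_range.2 (by omega))]

theorem entry_eq (hN : 0 < N) (hp : 2 ≤ I 0) (z : ℕ)
    (i j : (Fin (n + 1) → Fin (boxSize n I N)) × (Fin 4 × Fin (2 ^ (n + 1)))) :
    (entry n I N z (indexEquiv _ _ i : ℕ) (indexEquiv _ _ j : ℕ) : ZMod N) =
      (zetaMatrix (I 0) (powExp I N) (boxSize n I N) (muLift n I N) (fLift n I) z i j : ℤ) := by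
  obtain ⟨u, t⟩ := i
  obtain ⟨v, t'⟩ := j
  have hB : 0 < boxSize n I N ^ (n + 1) := pow_pos (one_le_boxSize n I) _
  have hdiv (u : Fin (n + 1) → Fin (boxSize n I N)) (t : Fin 4 × Fin (2 ^ (n + 1))) :
      (indexEquiv (n + 1) (boxSize n I N) (u, t) : ℕ) / blockSize n I N = finProdFinEquiv t := by
    rw [indexEquiv_val, blockSize, add_comm, Nat.mul_add_div hB,
      Nat.div_eq_of_lt (finFunctionFinEquiv u).2, add_zero]
  have hmod (u : Fin (n + 1) → Fin (boxSize n I N)) (t : Fin 4 × Fin (2 ^ (n + 1))) :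
      (indexEquiv (n + 1) (boxSize n I N) (u, t) : ℕ) % blockSize n I N =
        finFunctionFinEquiv u := by
    rw [indexEquiv_val, blockSize, Nat.add_mul_mod_self_left,
      Nat.mod_eq_of_lt (finFunctionFinEquiv u).2]
  rw [entry, hdiv, hdiv, hmod, hmod, expCode_eq, expCode_eq, weight_eq, zetaMatrix,
    Matrix.blockDiagonal_apply]
  by_cases htt : t = t'
  · subst htt
    have h1 : (finProdFinEquiv t : ℕ) / 2 ^ (n + 1) = t.1 := by
      conv_rhs => rw [← finProdFinEquiv.symm_apply_apply t]
      rfl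
    rw [if_pos rfl, if_pos rfl, Matrix.smul_apply,
      dworkMatrix_apply_eq_coeff_kronecker hp (support_subProduct_lt n I N t.1.2), h1, base]
    by_cases hlt : expValue (I 0 * boxSize n I N) (toExp v) ≤
        I 0 * expValue (I 0 * boxSize n I N) (toExp u)
    · rw [if_neg (not_lt.2 hlt), if_pos hlt, Nat.cast_mul, prodCoeff_eq_coeff_kronecker n I hN
        (by omega) t.1.2, base]
      · simp
      · refine lt_of_le_of_lt (Nat.sub_le _ _) ?_
        have h2 : expValue (base n I N) (I 0 • toExp u) =
            I 0 * expValue (base n I N) (toExp u) := by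
          simp only [expValue, Finset.mul_sum, Finsupp.smul_apply, smul_eq_mul, mul_assoc]
        rw [← base, ← h2]
        refine expValue_lt fun l => ?_
        rw [Finsupp.smul_apply, toExp_apply, smul_eq_mul]
        exact Nat.mul_lt_mul_of_pos_left (u l).2 (by omega)
    · rw [if_pos (not_le.1 hlt), if_neg hlt]
      simp
  · rw [if_neg fun h => htt (finProdFinEquiv.injective (Fin.ext h)), if_neg htt]
    simp

theorem zetaCoeff_eq_coeff (hN : 0 < N) (hp : 2 ≤ I 0) (z : ℕ) {k : ℕ}
    (hk : k ≤ I 2 * matSize n I N) : (zetaCoeff n I N z k : ZMod N) =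
      ((zetaMatrix (I 0) (powExp I N) (boxSize n I N) (muLift n I N)
        (fLift n I) z).charpolyRev.coeff k : ℤ) := by
  rw [zetaCoeff_eq n I hN z hk, ← coeff_charpolyRev_leading, ← eq_intCast (Int.castRingHom _),
    ← Polynomial.coeff_map, ← charpolyRev_map]
  refine (congrArg (fun q : (ZMod N)[X] => q.coeff k) (charpolyRev_submatrix_equiv (m := Fin (matSize n I N))
    (indexEquiv (n + 1) (boxSize n I N)) (leading _ _)).symm).trans ?_
  congr 2
  ext i j
  exact entry_eq n I hN hp z i j

theorem coeff_zetaMatrix_eq_zero (p e : ℕ) (G H : MvPolynomial (Fin (n + 1)) ℤ) (z : ℕ) {k : ℕ}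
    (hk : matSize n I N < k) :
    (zetaMatrix p e (boxSize n I N) G H z).charpolyRev.coeff k = 0 := by
  refine coeff_charpolyRev_eq_zero _ (lt_of_eq_of_lt ?_ hk)
  rw [Fintype.card_congr (indexEquiv (n + 1) (boxSize n I N)), Fintype.card_fin]
  rfl

end Link

end RAM

/-! ## The input -/

section Input

theorem getD_ofFn {n i : ℕ} (f : Fin n → ℕ) (h : i < n) : (List.ofFn f).getD i 0 = f ⟨i, h⟩ := by
  rw [List.getD_eq_getElem _ _ (by simpa using h), List.getElem_ofFn]

theorem getD_flatMap {α : Type*} {L : ℕ} {g : α → List ℕ} (hg : ∀ x, (g x).length = L) (E : List α)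
    {e i : ℕ} (he : e < E.length) (hi : i < L) :
    (E.flatMap g).getD (e * L + i) 0 = (g E[e]).getD i 0 := by
  induction E generalizing e with
  | nil => simp at he
  | cons x E ih =>
    rw [List.flatMap_cons]
    rcases e with _ | e
    · rw [zero_mul, zero_add, List.getD_append _ _ _ _ (by rwa [hg])]
      rfl
    · rw [List.getD_append_right _ _ _ _ (by rw [hg, add_mul, one_mul]; omega), hg,
        show (e + 1) * L + i - L = e * L + i by rw [add_mul, one_mul]; omega,
        ih (by simpa using he)]
      rfl

theorem length_flatMap_of_length_eq {α : Type*} {L : ℕ} {g : α → List ℕ}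
    (hg : ∀ x, (g x).length = L) (E : List α) : (E.flatMap g).length = E.length * L := by
  induction E with
  | nil => simp
  | cons x E ih => rw [List.flatMap_cons, List.length_append, ih, hg, List.length_cons]; ring

theorem coeff_polyOfList {R : Type*} [Semiring R] (l : List R) (k : ℕ) :
    (polyOfList l).coeff k = l.getD k 0 := by
  rw [polyOfList, finsetSum_coeff]
  simp only [coeff_monomial]
  by_cases hk : k < l.length
  · rw [Finset.sum_eq_single ⟨k, hk⟩, if_pos rfl, List.getD_eq_getElem _ _ hk]
    · rfl
    · intro i _ hi
      exact if_neg fun h => hi (Fin.ext h)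
    · simp
  · rw [List.getD_eq_default _ _ (not_lt.1 hk)]
    refine Finset.sum_eq_zero fun i _ => if_neg fun h => hk ?_
    rw [← h]
    exact i.2

variable {p : ℕ} [hp : Fact p.Prime] {K : Type*} [Field K] [Algebra (ZMod p) K] (m : ℕ)
  (b : PowerBasis (ZMod p) K) {n : ℕ} (f : MvPolynomial (Fin n) K) (E : List (Fin n →₀ ℕ))

theorem length_encodeInput :
    (encodeInput m b f E).length = 4 + b.dim + E.length * (n + b.dim) := by
  rw [encodeInput, List.length_append, length_flatMap_of_length_eq (L := n + b.dim) (by simp)]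
  simp
  ring

theorem getD_encodeInput_zero : (encodeInput m b f E).getD 0 0 = p := rfl

theorem getD_encodeInput_one : (encodeInput m b f E).getD 1 0 = m := rfl

theorem getD_encodeInput_two : (encodeInput m b f E).getD 2 0 = b.dim := rfl

theorem getD_encodeInput_minpoly {j : ℕ} (hj : j < b.dim) :
    (encodeInput m b f E).getD (3 + j) 0 = ((minpoly (ZMod p) b.gen).coeff j).val := by
  rw [encodeInput, List.getD_append _ _ _ _ (by simp; omega),
    List.getD_append _ _ _ _ (by simp; omega), List.getD_append_right _ _ _ _ (by simp)]
  have : 3 + j - [p, m, b.dim].length = j := by simp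
  rw [this, getD_ofFn _ hj]

theorem getD_encodeInput_length : (encodeInput m b f E).getD (3 + b.dim) 0 = E.length := by
  rw [encodeInput, List.getD_append _ _ _ _ (by simp; omega),
    List.getD_append_right _ _ _ _ (by simp; omega)]
  have : 3 + b.dim - ([p, m, b.dim] ++ List.ofFn (fun i : Fin b.dim =>
      ((minpoly (ZMod p) b.gen).coeff i).val)).length = 0 := by
    simp
    omega
  rw [this]
  rfl

theorem getD_encodeInput_exponent {e : ℕ} (he : e < E.length) (l : Fin n) :
    (encodeInput m b f E).getD (4 + b.dim + e * (n + b.dim) + l) 0 = E[e] l := by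
  rw [encodeInput, List.getD_append_right _ _ _ _ (by simp; omega)]
  have : 4 + b.dim + e * (n + b.dim) + (l : ℕ) - ([p, m, b.dim] ++ List.ofFn (fun i : Fin b.dim =>
      ((minpoly (ZMod p) b.gen).coeff i).val) ++ [E.length]).length =
      e * (n + b.dim) + (l : ℕ) := by
    simp
    omega
  rw [this, getD_flatMap (by simp) _ he (by omega), List.getD_append _ _ _ _ (by simp),
    getD_ofFn _ l.2]

theorem getD_encodeInput_coeff {e : ℕ} (he : e < E.length) (j : Fin b.dim) :
    (encodeInput m b f E).getD (4 + b.dim + e * (n + b.dim) + n + j) 0 =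
      (b.basis.repr (f.coeff E[e]) j).val := by
  rw [encodeInput, List.getD_append_right _ _ _ _ (by simp; omega)]
  have : 4 + b.dim + e * (n + b.dim) + n + (j : ℕ) - ([p, m, b.dim] ++ List.ofFn (fun i : Fin b.dim
      => ((minpoly (ZMod p) b.gen).coeff i).val) ++ [E.length]).length =
      e * (n + b.dim) + (n + (j : ℕ)) := by
    simp
    omega
  rw [this, getD_flatMap (by simp) _ he (by omega), List.getD_append_right _ _ _ _ (by simp),
    List.length_ofFn, Nat.add_sub_cancel_left, getD_ofFn _ j.2]

theorem getD_encodeInput_le {B : ℕ} (hpB : p ≤ B) (hm : m ≤ B) (ha : b.dim ≤ B) (hE : E.length ≤ B)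
    (hd : ∀ e ∈ E, ∀ l, e l ≤ B) (i : ℕ) : (encodeInput m b f E).getD i 0 ≤ B := by
  have h : ∀ x ∈ encodeInput m b f E, x ≤ B := by
    intro x hx
    simp only [encodeInput, List.mem_append, List.mem_cons, List.not_mem_nil, or_false,
      List.mem_flatMap, List.mem_ofFn] at hx
    rcases hx with ((((rfl | rfl | rfl) | ⟨j, rfl⟩) | rfl) | ⟨e, he, ⟨l, rfl⟩ | ⟨j, rfl⟩⟩)
    · exact hpB
    · exact hm
    · exact ha
    · exact (ZMod.val_lt _).le.trans hpB
    · exact hE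
    · exact hd e he l
    · exact (ZMod.val_lt _).le.trans hpB
  by_cases hi : i < (encodeInput m b f E).length
  · rw [List.getD_eq_getElem _ _ hi]
    exact h _ (List.getElem_mem hi)
  · rw [List.getD_eq_default _ _ (not_lt.1 hi)]
    exact Nat.zero_le _

/-- The generator is a coordinate on the torus and must not vanish. It is zero only if its minimal
polynomial is `T`, of degree one. In degree one, `1` is used as generator instead, and the
coordinates stay the same because only the zeroth power occurs. -/
theorem exists_powerBasis_gen_ne_zero : ∃ pb : PowerBasis (ZMod p) K, pb.dim = b.dim ∧
    pb.gen ≠ 0 ∧ (b.dim = 1 → pb.gen = 1) ∧ (b.dim ≠ 1 → pb.gen = b.gen) ∧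
    ∀ c : K, c = ∑ j : Fin b.dim, b.basis.repr c j • pb.gen ^ (j : ℕ) := by
  by_cases h : b.dim = 1
  · have hpow (i : Fin b.dim) : b.basis i = 1 ^ (i : ℕ) := by
      rw [b.basis_eq_pow, show (i : ℕ) = 0 by omega, pow_zero, pow_zero]
    refine ⟨⟨1, b.dim, b.basis, hpow⟩, rfl, one_ne_zero, fun _ => rfl, fun h' => absurd h h',
      fun c => ?_⟩
    conv_lhs => rw [← b.basis.sum_repr c]
    simp only [hpow]
  · refine ⟨b, rfl, fun h0 => h ?_, fun h' => absurd h' h, fun _ => rfl, fun c => ?_⟩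
    · rw [← b.natDegree_minpoly, h0, minpoly.zero, natDegree_X]
    · conv_lhs => rw [← b.basis.sum_repr c]
      simp only [b.basis_eq_pow]

end Input

namespace RAM

/-! ### The lifts specialise to the given field and polynomial -/

section InputLifts

variable {p : ℕ} [hp : Fact p.Prime] {K : Type*} [Field K] [Algebra (ZMod p) K] {m : ℕ}
  (b : PowerBasis (ZMod p) K) {n : ℕ} (f : MvPolynomial (Fin n) K) (E : List (Fin n →₀ ℕ))

/-- In degree one the constant coefficient `p ^ m - 1` has to become `-1` in characteristic `p`, so
that the polynomial is `T - 1`; this requires `m > 0`. -/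
theorem aeval_muLift (hm : 0 < m) {pb : PowerBasis (ZMod p) K} (hdim : pb.dim = b.dim)
    (h1 : b.dim = 1 → pb.gen = 1) (h2 : b.dim ≠ 1 → pb.gen = b.gen)
    {F : Type*} [Field F] [Algebra (ZMod p) F] (y : Fin (n + 1) → F) :
    MvPolynomial.aeval y (muLift n (fun i => (encodeInput m b f E).getD i 0) (p ^ m)) =
      aeval (y 0) (minpoly (ZMod p) pb.gen) := by
  have hp0 : (p : F) = 0 := by
    rw [← map_natCast (algebraMap (ZMod p) F), ZMod.natCast_self, map_zero]
  rw [muLift, map_sum, aeval_eq_sum_range, pb.natDegree_minpoly, getD_encodeInput_two, hdim]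
  refine Finset.sum_congr rfl fun x hx => ?_
  have hx' := Finset.mem_range.1 hx
  rw [MvPolynomial.aeval_monomial, Finsupp.prod_single_index (by exact pow_zero _),
    Algebra.smul_def]
  congr 1
  rw [eq_intCast, Int.cast_natCast]
  unfold muCoeff
  beta_reduce
  rw [getD_encodeInput_two]
  by_cases hx1 : x < b.dim
  · rw [if_pos hx1]
    by_cases hd : b.dim = 1
    · have hx0 : x = 0 := by omega
      have hpm : 1 ≤ p ^ m := Nat.one_le_pow _ _ hp.out.pos
      rw [if_pos hd, h1 hd, minpoly.one, hx0, Nat.cast_sub hpm, Nat.cast_pow, hp0,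
        zero_pow hm.ne']
      simp
    · rw [if_neg hd, getD_encodeInput_minpoly m b f E hx1, h2 hd,
        ← map_natCast (algebraMap (ZMod p) F), ZMod.natCast_zmod_val]
  · have hx2 : x = b.dim := by omega
    rw [if_neg hx1, if_pos hx2, hx2, ← hdim, ← pb.natDegree_minpoly, coeff_natDegree,
      minpoly.monic pb.isIntegral_gen, map_one, Nat.cast_one]

/-- Substituting the image of the generator for the first variable reassembles each coefficient from
its coordinates. Without repetitions in `E` every term counts once, and listed exponents outside the
support contribute zero. -/
theorem aeval_fLift (hE : E.Nodup) (hf : ∀ e ∈ f.support, e ∈ E) {pb : PowerBasis (ZMod p) K}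
    (hrepr : ∀ c : K, c = ∑ j : Fin b.dim, b.basis.repr c j • pb.gen ^ (j : ℕ))
    {F : Type*} [Field F] [Algebra (ZMod p) F] (ι : K →ₐ[ZMod p] F) (y : Fin (n + 1) → F)
    (hy : y 0 = ι pb.gen) :
    MvPolynomial.aeval y (fLift n fun i => (encodeInput m b f E).getD i 0) =
      MvPolynomial.eval₂ (ι : K →+* F) (fun i => y i.succ) f := by
  classical
  have h1 (c : K) : ι c = ∑ j : Fin b.dim, ((b.basis.repr c j).val : F) * y 0 ^ (j : ℕ) := by
    conv_lhs => rw [hrepr c]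
    rw [map_sum]
    refine Finset.sum_congr rfl fun j _ => ?_
    rw [map_smul, map_pow, hy, Algebra.smul_def, ← map_natCast (algebraMap (ZMod p) F),
      ZMod.natCast_zmod_val]
  have h2 : MvPolynomial.eval₂ (ι : K →+* F) (fun i => y i.succ) f =
      ∑ e ∈ E.toFinset, ι (f.coeff e) * ∏ l, y l.succ ^ e l := by
    rw [MvPolynomial.eval₂_eq']
    refine Finset.sum_subset (fun e he => List.mem_toFinset.2 (hf e he)) fun e _ he => ?_
    rw [MvPolynomial.notMem_support_iff.1 he, map_zero, zero_mul]
  rw [h2, List.sum_toFinset _ hE, ← Fin.sum_univ_fun_getElem, fLift, map_sum,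
    getD_encodeInput_two, getD_encodeInput_length, Finset.sum_range]
  refine Finset.sum_congr rfl fun e _ => ?_
  rw [map_sum, h1, Finset.sum_mul, Finset.sum_range]
  refine Finset.sum_congr rfl fun j _ => ?_
  rw [MvPolynomial.aeval_monomial, Finsupp.prod_fintype _ _ fun _ => pow_zero _,
    Fin.prod_univ_succ, ← mul_assoc, termPos, getD_encodeInput_two,
    getD_encodeInput_coeff m b f E e.2 j, eq_intCast, Int.cast_natCast]
  have h3 (l : Fin n) : termVec n (fun i => (encodeInput m b f E).getD i 0) e j l.succ =
      E[(e : ℕ)] l := by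
    rw [termVec, Finsupp.equivFunOnFinite_symm_apply_apply, Fin.cons_succ, termPos,
      getD_encodeInput_two, getD_encodeInput_exponent m b f E e.2 l]
  simp only [h3]
  rfl

end InputLifts

end RAM

/-! ### The number of monomials of bounded degree -/

section Counting

/-- The number of exponent vectors of degree at most `d`. -/
theorem length_le_choose {n d : ℕ} {E : List (Fin n →₀ ℕ)} (hE : E.Nodup)
    (hd : ∀ e ∈ E, e.degree ≤ d) : E.length ≤ (d + n).choose n := by
  classical
  have hdeg (w : Fin (n + 1) →₀ ℕ) : Multiset.card (Finsupp.toMultiset w) = w.degree := by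
    rw [Finsupp.card_toMultiset]
    rfl
  -- Homogenisation: an additional variable takes up the missing degree, which gives a multiset of
  -- size `d` on `n + 1` letters.
  let g (e : {e : Fin n →₀ ℕ // e ∈ E}) : Sym (Fin (n + 1)) d :=
    ⟨Finsupp.toMultiset (Finsupp.cons (d - e.1.degree) e.1), by
      rw [hdeg, Finsupp.degree_eq_sum, Fin.sum_univ_succ]
      simp only [Finsupp.cons_zero, Finsupp.cons_succ]
      rw [← Finsupp.degree_eq_sum, Nat.sub_add_cancel (hd _ e.2)]⟩
  have hg : Function.Injective g := fun e e' h => by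
    have h1 := Function.LeftInverse.injective Finsupp.toMultiset_toFinsupp
      (congrArg Subtype.val h)
    refine Subtype.ext (Finsupp.ext fun l => ?_)
    simpa using DFunLike.congr_fun h1 l.succ
  have : Fintype {e : Fin n →₀ ℕ // e ∈ E} := Fintype.subtype E.toFinset (by simp)
  have h1 := Fintype.card_le_of_injective g hg
  rw [Sym.card_sym_eq_choose, Fintype.card_fin, Fintype.card_of_subtype E.toFinset (by simp),
    List.toFinset_card_of_nodup hE] at h1
  refine h1.trans (le_of_eq ?_)
  rw [show n + 1 + d - 1 = d + n by omega, Nat.choose_symm_add]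

/-- This bounds the exponents in the input. The index `l` excludes `n = 0`, where the binomial
coefficient is `1`. -/
theorem le_choose_of_fin {n d : ℕ} (l : Fin n) : d ≤ (d + n).choose n := by
  have hn : 0 < n := l.pos
  have h1 : d + 1 ≤ d + n := by omega
  have h2 := Nat.choose_le_choose d h1
  rw [Nat.choose_succ_self_right] at h2
  rw [← Nat.choose_symm_add]
  omega

end Counting

/-! ### The output and its meaning -/

namespace RAM

theorem definable_cntOut (n : ℕ) : Definable 2 fun α _ => 2 * (numOut n (α 0) (α 1 0) + 1) :=
  (Definable.const 2).mul ((definable_numOut n).add (.const 1))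

/-- The numerator (`z = 1`) and the denominator (`z = 0`) of the zeta function, as computed by the
algorithm. -/
def zetaList (n : ℕ) (I : ℕ → ℕ) (N z : ℕ) : List (ZMod N) :=
  (List.range (numOut n I N)).map fun i => (zetaCoeff n I N z (I 2 * i) : ZMod N)

theorem encodeResidues_zetaList (n : ℕ) (I : ℕ → ℕ) {N : ℕ} (hN : 0 < N) (z : ℕ) :
    encodeResidues (zetaList n I N z) = numOut n I N ::
      (List.range (numOut n I N)).map fun i => zetaCoeff n I N z (I 2 * i) := by
  rw [encodeResidues, zetaList, List.length_map, List.length_range, List.map_map]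
  congr 1
  refine List.map_congr_left fun i _ => ?_
  exact ZMod.val_cast_of_lt (zetaCoeff_lt n I hN z _)

theorem map_outputAt (n : ℕ) (I : ℕ → ℕ) {N : ℕ} (hN : 0 < N) :
    (List.range (2 * (numOut n I N + 1))).map (outputAt n I N) =
      encodeResidues (zetaList n I N 1) ++ encodeResidues (zetaList n I N 0) := by
  rw [encodeResidues_zetaList n I hN, encodeResidues_zetaList n I hN, two_mul, List.range_add,
    List.map_append, List.range_succ_eq_map, List.map_cons, List.map_map, List.map_cons,
    List.map_cons, List.map_map, List.map_map]
  congr 1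
  · congr 1
    refine List.map_congr_left fun i hi => ?_
    have hi' := List.mem_range.1 hi
    simp only [Function.comp_apply, outputAt]
    rw [if_neg (by omega), if_pos (by omega)]
    congr 1
  · congr 1
    · simp [outputAt]
    · refine List.map_congr_left fun i _ => ?_
      simp only [Function.comp_apply, outputAt]
      rw [if_neg (by omega), if_neg (by omega), if_neg (by omega)]
      congr 2
      omega

theorem isReductionMod_zetaList {p : ℕ} [hp : Fact p.Prime] {K : Type*} [Field K] [Finite K]
    [CharP K p] [Algebra (ZMod p) K] {m : ℕ} (hm : 0 < m) (b : PowerBasis (ZMod p) K) {n : ℕ}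
    (f : MvPolynomial (Fin n) K) {E : List (Fin n →₀ ℕ)} (hE : E.Nodup)
    (hf : ∀ e ∈ f.support, e ∈ E) :
    IsReductionMod (p ^ m) (torusZeta p f)
      (polyOfList (zetaList n (fun i => (encodeInput m b f E).getD i 0) (p ^ m) 1))
      (polyOfList (zetaList n (fun i => (encodeInput m b f E).getD i 0) (p ^ m) 0)) := by
  obtain ⟨pb, hdim, hgen, h1, h2, hrepr⟩ := exists_powerBasis_gen_ne_zero b
  set I : ℕ → ℕ := fun i => (encodeInput m b f E).getD i 0 with hI
  have hN : 0 < p ^ m := pow_pos hp.out.pos m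
  have hI0 : I 0 = p := getD_encodeInput_zero m b f E
  have hI2 : I 2 = b.dim := getD_encodeInput_two m b f E
  have hE' : powExp I (p ^ m) = (p - 1) * p ^ m := by rw [powExp, hI0]
  have hcoeff (z k : ℕ) : (polyOfList (zetaList n I (p ^ m) z)).coeff k =
      ((zetaMatrix p ((p - 1) * p ^ m) (boxSize n I (p ^ m)) (muLift n I (p ^ m))
        (fLift n I) z).charpolyRev.coeff (pb.dim * k) : ℤ) := by
    rw [coeff_polyOfList, hdim]
    by_cases hk : k < numOut n I (p ^ m)
    · have h3 := zetaCoeff_eq_coeff n I hN (hI0 ▸ hp.out.two_le) z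
        (Nat.mul_le_mul_left (I 2) (Nat.le_of_lt_succ hk))
      rw [hI0, hE', hI2] at h3
      rw [← h3, List.getD_eq_getElem _ _ (by simpa [zetaList] using hk)]
      simp [zetaList, hI2]
    -- The default `0` beyond the end of the list is correct, because the degree then exceeds the
    -- size of the matrix.
    · rw [List.getD_eq_default _ _ (by simpa [zetaList] using hk), coeff_zetaMatrix_eq_zero,
        Int.cast_zero]
      refine lt_of_lt_of_le ?_ (Nat.le_mul_of_pos_left k b.dim_pos)
      exact not_lt.1 hk
  refine isReductionMod_torusZeta m pb hgen f (muLift n I (p ^ m)) (fLift n I)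
    (fun F _ _ y => aeval_muLift b f E hm hdim h1 h2 y)
    (fun F _ _ ι y hy => aeval_fLift b f E hE hf hrepr ι y hy) (boxSize n I (p ^ m))
    (fun τ hτ => ?_) _ _ (hcoeff 1) (hcoeff 0)
  have := support_subProduct_lt n I (p ^ m) hτ
  rwa [hE'] at this

end RAM

/-- For each fixed `n`, one program computes `Z(X, T)` modulo `p ^ m`, as a quotient of two
polynomials over `ℤ / p ^ m`, for every hypersurface `X` of degree `d` in the `n`-dimensional torus
over a finite field of `q` elements and characteristic `p`, in time polynomial in `p ^ m` and
`(d + n).choose n * log q`. -/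
theorem corollary5p3 (n : ℕ) :
    ∃ (P : RAM.Prog) (C c : ℕ),
      ∀ (p m : ℕ) [Fact p.Prime] (_ : 0 < m)
        (K : Type*) [Field K] [Finite K] [CharP K p] [Algebra (ZMod p) K]
        (b : PowerBasis (ZMod p) K) (f : MvPolynomial (Fin n) K) (E : List (Fin n →₀ ℕ))
        (_ : E.Nodup) (_ : ∀ e ∈ f.support, e ∈ E) (_ : ∀ e ∈ E, e.degree ≤ f.totalDegree),
        ∃ (g h : List (ZMod (p ^ m))) (t : ℕ),
          RAM.Computes P (encodeInput m b f E) (encodeResidues g ++ encodeResidues h) t ∧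
          t ≤ C * (p ^ m * ((f.totalDegree + n).choose n * Nat.log 2 (Nat.card K))) ^ c ∧
          IsReductionMod (p ^ m) (torusZeta p f) (polyOfList g) (polyOfList h) := by
  obtain ⟨cnt, hcnt, ecnt⟩ := RAM.definable_cntOut n
  obtain ⟨out, hout, eout⟩ := RAM.definable_outputAt n
  obtain ⟨c, hc⟩ := RAM.polyBounded_mainCost n cnt out
  -- Constant factors are absorbed by the exponent, since the base `B` below is at least `p ≥ 2`.
  refine ⟨RAM.mainProg n cnt out, 1, c, ?_⟩
  intro p m hp hm K _ _ _ _ b f E hE hf hd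
  set I : ℕ → ℕ := fun i => (encodeInput m b f E).getD i 0 with hI
  have hN : 0 < p ^ m := pow_pos hp.out.pos m
  -- All three factors are at least one, so `B` bounds each of them, and with them every number of
  -- the input.
  set B := p ^ m * ((f.totalDegree + n).choose n * Nat.log 2 (Nat.card K)) with hB
  have hchoose : 1 ≤ (f.totalDegree + n).choose n := Nat.choose_pos (Nat.le_add_left _ _)
  have hlog : b.dim ≤ Nat.log 2 (Nat.card K) := by
    rw [← FiniteField.pow_finrank_eq_natCard p K, b.finrank]
    refine Nat.le_log_of_pow_le one_lt_two (Nat.pow_le_pow_left hp.out.two_le _)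
  have hlog1 : 1 ≤ Nat.log 2 (Nat.card K) := b.dim_pos.trans_le hlog
  have hB1 : p ^ m ≤ B := Nat.le_mul_of_pos_right _ (by positivity)
  have hB2 : (f.totalDegree + n).choose n ≤ B :=
    (Nat.le_mul_of_pos_right _ hlog1).trans (Nat.le_mul_of_pos_left _ hN)
  have hB3 : Nat.log 2 (Nat.card K) ≤ B :=
    (Nat.le_mul_of_pos_left _ hchoose).trans (Nat.le_mul_of_pos_left _ hN)
  have hpB : p ≤ B := (Nat.le_self_pow hm.ne' p).trans hB1
  obtain ⟨t, ht, hrun⟩ := RAM.mainProg_run (n := n) (B := B) hcnt hout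
    (getD_encodeInput_zero m b f E) (getD_encodeInput_one m b f E) (getD_encodeInput_two m b f E)
    (getD_encodeInput_length m b f E) (length_encodeInput m b f E).le
    (getD_encodeInput_le m b f E hpB ((Nat.lt_pow_self hp.out.one_lt).le.trans hB1)
      (hlog.trans hB3) ((length_le_choose hE hd).trans hB2) fun e he l =>
        ((Finsupp.le_degree l e).trans (hd e he)).trans ((le_choose_of_fin l).trans hB2))
    (fun i hi => (Nat.pow_le_pow_right hp.out.pos hi).trans hB1)
  have hα0 : RAM.initArrays (encodeInput m b f E) (p ^ m) 0 = I := by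
    funext i
    simp [RAM.initArrays, hI]
  have hα1 : RAM.initArrays (encodeInput m b f E) (p ^ m) 1 0 = p ^ m := by
    simp [RAM.initArrays]
  simp only [ecnt, eout, hα0, hα1, RAM.push_zero] at hrun
  rw [show (fun i => RAM.outputAt n I (p ^ m) i) = RAM.outputAt n I (p ^ m) from rfl,
    RAM.map_outputAt n I hN] at hrun
  exact ⟨_, _, t, hrun, by rw [one_mul]; exact ht.trans (hc B (hp.out.two_le.trans hpB)),
    RAM.isReductionMod_zetaList hm b f hE hf⟩
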